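/- Fix $d\ge 1$. Definitions. Let $\mathcal L$ be a compact metric space. A prototile set with label space $\mathcal L$ assigns to each $\ell\in\mathcal L$ a compact set $S_\ell\subset\mathbb R^d$ that is homeomorphic to a closed $d$-ball and contains the origin (its control point), such that $\ell\mapsto S_\ell$ is continuous for the Hausdorff metric; the prototile of $\ell$ is the pair $(S_\ell,\ell)$. A tile is a pair $t=(\mathrm{supp}(t),\mathrm{label}(t))$ which is a translate of a prototile, where $t-x=(\mathrm{supp}(t)-x,\mathrm{label}(t))$ for $x\in\mathbb R^d$. A patch is a set of tiles whose supports pairwise intersect only on their boundaries and have a connected union. A tiling $T$ is a patch whose supports cover $\mathbb R^d$, such that each bounded set meets only finitely many tiles; $T-x$ is its translate. The distance of two tiles is the maximum of the Hausdorff distance of their supports and the distance of their labels. The distance $d(T,T')$ of two tilings is the infimum of all $\epsilon\in(0,1]$ for which $T$ and $T'$ have finite patches, both covering the ball of radius $1/\epsilon$ around the origin, whose tiles are in one-to-one correspondence with corresponding tiles at distance at most $\epsilon$; it is $1$ if there is no such $\epsilon$. A tiling space $\Omega$ is a set of tilings, built from a fixed prototile set, that is translation invariant and closed in the topology of $d$.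 Its transversal is the set of all $T\in\Omega$ that contain a prototile $(S_\ell,\ell)$. $\Omega$ is strongly expansive if there is an $\epsilon>0$ such that for all $T,T'\in\Omega$: if there is a homeomorphism $h$ of $\mathbb R^d$ with $h(0)=0$ and $d(T-x,T'-h(x))<\epsilon$ for all $x\in\mathbb R^d$, then $T=T'-x_0$ for some $x_0\in\mathbb R^d$ with $|x_0|<\epsilon$. $\Omega$ has finite local complexity (FLC) if, up to translation, only finitely many two-tile patches occur in the tilings of $\Omega$. Theorem. Let $\Omega$ be a tiling space of $\mathbb R^d$ that is strongly expansive and has a totally disconnected transversal. Suppose that $\Omega$ is homeomorphic to a tiling space $\Omega'$ of $\mathbb R^d$ (possibly with another prototile set, and possibly with infinitely many labels) in which only finitely many two-tile patches occur up to translation if the labels are ignored, that is, finitely many pairs of supports. Then $\Omega$ is homeomorphic to an FLC tiling space of $\mathbb R^d$. -/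

import Mathlib

/-! Tilings of Euclidean space whose tiles carry labels in a compact metric space. -/

namespace LabelledTiling

/-- The Euclidean space `ℝ^d`. -/
abbrev E (d : ℕ) : Type := EuclideanSpace ℝ (Fin d)

/-- The translate `S - x` of a subset of `ℝ^d`. -/
def translateSet {d : ℕ} (S : Set (E d)) (x : E d) : Set (E d) := (fun y => y - x) '' S

/-- A labelled region of `ℝ^d`: a support together with a label. -/
@[ext]
structure Tile (d : ℕ) (L : Type*) where
  supp : Set (E d)
  label : L

/-- The translate `t - x` of a tile: the support moves, the label stays. -/
def Tile.translate {d : ℕ} {L : Type*} (t : Tile d L) (x : E d) : Tile d L :=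
  ⟨translateSet t.supp x, t.label⟩

/-- The translate `A - x` of a collection of tiles. -/
def translatePatch {d : ℕ} {L : Type*} (A : Set (Tile d L)) (x : E d) : Set (Tile d L) :=
  (fun t => t.translate x) '' A

/-- The region covered by a collection of tiles. -/
def patchSupp {d : ℕ} {L : Type*} (A : Set (Tile d L)) : Set (E d) := ⋃ t ∈ A, t.supp

/-- The distance of two tiles: the maximum of the Hausdorff distance of the supports and of the
distance of the labels. -/
noncomputable def tileDist {d : ℕ} {L : Type*} [MetricSpace L] (t t' : Tile d L) : ℝ :=
  max (Metric.hausdorffDist t.supp t'.supp) (dist t.label t'.label)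

/-- A prototile set with label space `L`: every label has one prototile, whose support is
homeomorphic to a closed ball of `ℝ^d` and has its control point at the origin, and the supports
depend continuously on the label for the Hausdorff metric (this is the metric of
`TopologicalSpace.NonemptyCompacts`). -/
structure PrototileSet (d : ℕ) (L : Type*) [MetricSpace L] where
  shape : L → TopologicalSpace.NonemptyCompacts (E d)
  homeomorphic_ball : ∀ l, Nonempty ((shape l : Set (E d)) ≃ₜ Metric.closedBall (0 : E d) 1)
  control_mem : ∀ l, (0 : E d) ∈ shape l
  continuous_shape : Continuous shape

section

variable {d : ℕ} {L : Type*} [MetricSpace L]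

/-- The prototile with label `l`. -/
def PrototileSet.proto (P : PrototileSet d L) (l : L) : Tile d L := ⟨(P.shape l : Set (E d)), l⟩

/-- A patch: a collection of translates of prototiles whose supports meet only on their
boundaries and have a connected union. -/
structure IsPatch (P : PrototileSet d L) (A : Set (Tile d L)) : Prop where
  equiv_proto : ∀ t ∈ A, ∃ l x, t = (P.proto l).translate x
  boundary : ∀ t ∈ A, ∀ t' ∈ A, t ≠ t' → t.supp ∩ t'.supp ⊆ frontier t.supp ∩ frontier t'.supp
  connected : IsConnected (patchSupp A)

/-- A tiling: a patch that covers `ℝ^d`; every bounded region meets only finitely many of its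
tiles. -/
@[ext]
structure Tiling (P : PrototileSet d L) where
  tiles : Set (Tile d L)
  isPatch : IsPatch P tiles
  covers : patchSupp tiles = Set.univ
  locally_finite : ∀ r : ℝ, {t ∈ tiles | (t.supp ∩ Metric.closedBall 0 r).Nonempty}.Finite

theorem translateSet_eq (S : Set (E d)) (x : E d) :
    translateSet S x = Homeomorph.subRight x '' S := rfl

theorem translate_translate (t : Tile d L) (x y : E d) :
    (t.translate x).translate y = t.translate (x + y) := by
  ext z
  · simp only [Tile.translate, translateSet, Set.image_image, sub_sub]
  · rfl

theorem patchSupp_translatePatch (A : Set (Tile d L)) (x : E d) :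
    patchSupp (translatePatch A x) = translateSet (patchSupp A) x := by
  simp only [patchSupp, translatePatch, Set.biUnion_image, translateSet, Tile.translate,
    Set.image_iUnion₂]

theorem IsPatch.translate {P : PrototileSet d L} {A : Set (Tile d L)} (hA : IsPatch P A)
    (x : E d) : IsPatch P (translatePatch A x) where
  equiv_proto := by
    rintro _ ⟨t, ht, rfl⟩
    obtain ⟨l, y, rfl⟩ := hA.equiv_proto t ht
    exact ⟨l, y + x, translate_translate _ _ _⟩
  boundary := by
    rintro _ ⟨t, ht, rfl⟩ _ ⟨s, hs, rfl⟩ hne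
    have hts : t ≠ s := fun h => hne (by rw [h])
    simp only [Tile.translate, translateSet_eq]
    rw [← Homeomorph.image_frontier, ← Homeomorph.image_frontier,
      ← Set.image_inter (Homeomorph.injective _), ← Set.image_inter (Homeomorph.injective _)]
    exact Set.image_mono (hA.boundary t ht s hs hts)
  connected := by
    rw [patchSupp_translatePatch, translateSet_eq]
    exact hA.connected.image _ (Homeomorph.continuous _).continuousOn

/-- The translate `T - x` of a tiling. -/
def Tiling.translate {P : PrototileSet d L} (T : Tiling P) (x : E d) : Tiling P where
  tiles := translatePatch T.tiles x
  isPatch := T.isPatch.translate x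
  covers := by
    rw [patchSupp_translatePatch, T.covers, translateSet_eq]
    exact Set.image_univ_of_surjective (Homeomorph.surjective _)
  locally_finite := by
    intro r
    refine ((T.locally_finite (r + ‖x‖)).image (fun t => t.translate x)).subset ?_
    rintro _ ⟨⟨t, ht, rfl⟩, z, ⟨y, hy, rfl⟩, hz⟩
    refine ⟨t, ⟨ht, y, hy, ?_⟩, rfl⟩
    rw [mem_closedBall_zero_iff] at hz ⊢
    calc ‖y‖ = ‖(y - x) + x‖ := by rw [sub_add_cancel]
      _ ≤ ‖y - x‖ + ‖x‖ := norm_add_le _ _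
      _ ≤ r + ‖x‖ := add_le_add_left hz _

/-- The tilings have finite patches that contain the ball of radius `1 / ε` around the origin and
differ by at most `ε`: their tiles correspond one to one, at distance at most `ε`. -/
def AgreeUpTo {P : PrototileSet d L} (ε : ℝ) (T T' : Tiling P) : Prop :=
  ∃ A B : Set (Tile d L), A ⊆ T.tiles ∧ B ⊆ T'.tiles ∧ A.Finite ∧ B.Finite ∧
    IsPatch P A ∧ IsPatch P B ∧
    Metric.closedBall 0 (1 / ε) ⊆ patchSupp A ∧ Metric.closedBall 0 (1 / ε) ⊆ patchSupp B ∧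
    ∃ e : A ≃ B, ∀ t : A, tileDist (t : Tile d L) (e t : Tile d L) ≤ ε

/-- The tiling distance: the least `ε ≤ 1` up to which the tilings agree, and `1` if there is
none. -/
noncomputable def tilingDist {P : PrototileSet d L} (T T' : Tiling P) : ℝ :=
  sInf ({ε : ℝ | 0 < ε ∧ ε ≤ 1 ∧ AgreeUpTo ε T T'} ∪ {1})

/-- The topology of the tiling distance: a set is open if it contains a ball around each of its
points. -/
instance (P : PrototileSet d L) : TopologicalSpace (Tiling P) where
  IsOpen U := ∀ T ∈ U, ∃ ε > 0, ∀ T', tilingDist T T' < ε → T' ∈ U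
  isOpen_univ := fun _ _ => ⟨1, one_pos, fun _ _ => trivial⟩
  isOpen_inter := by
    rintro U V hU hV T ⟨hTU, hTV⟩
    obtain ⟨a, ha, hUa⟩ := hU T hTU
    obtain ⟨b, hb, hVb⟩ := hV T hTV
    exact ⟨min a b, lt_min ha hb, fun T' h =>
      ⟨hUa T' (h.trans_le (min_le_left _ _)), hVb T' (h.trans_le (min_le_right _ _))⟩⟩
  isOpen_sUnion := by
    rintro 𝒰 h𝒰 T ⟨U, hU, hT⟩
    obtain ⟨a, ha, hUa⟩ := h𝒰 U hU T hT
    exact ⟨a, ha, fun T' h => ⟨U, hU, hUa T' h⟩⟩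

/-- A tiling space: a closed, translation invariant set of tilings built from one prototile
set. -/
structure IsTilingSpace {P : PrototileSet d L} (Ω : Set (Tiling P)) : Prop where
  isClosed : IsClosed Ω
  translate_mem : ∀ T ∈ Ω, ∀ x : E d, T.translate x ∈ Ω

/-- The transversal: the tilings in `Ω` with a control point at the origin, that is, which contain
a prototile. -/
def transversal {P : PrototileSet d L} (Ω : Set (Tiling P)) : Set (Tiling P) :=
  {T ∈ Ω | ∃ l, P.proto l ∈ T.tiles}

/-- Strong expansivity of the translation action. -/
def IsStronglyExpansive {P : PrototileSet d L} (Ω : Set (Tiling P)) : Prop :=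
  ∃ ε > 0, ∀ T ∈ Ω, ∀ T' ∈ Ω,
    (∃ h : E d ≃ₜ E d, h 0 = 0 ∧ ∀ x, tilingDist (T.translate x) (T'.translate (h x)) < ε) →
    ∃ x₀ : E d, ‖x₀‖ < ε ∧ T = T'.translate x₀

/-- The two-tile patches that occur in the tilings of `Ω`. -/
def twoTilePatches {P : PrototileSet d L} (Ω : Set (Tiling P)) : Set (Set (Tile d L)) :=
  {A | A.encard = 2 ∧ IsPatch P A ∧ ∃ T ∈ Ω, A ⊆ T.tiles}

/-- Finite local complexity: up to translation there are only finitely many two-tile patches. -/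
def HasFLC {P : PrototileSet d L} (Ω : Set (Tiling P)) : Prop :=
  ∃ F : Set (Set (Tile d L)), F.Finite ∧
    ∀ A ∈ twoTilePatches Ω, ∃ B ∈ F, ∃ x : E d, A = translatePatch B x

/-- Up to translation there are only finitely many two-tile patches if the labels are ignored,
that is, if only the pair of supports is recorded. -/
def HasFinitelyManyTwoTileShapes {P : PrototileSet d L} (Ω : Set (Tiling P)) : Prop :=
  ∃ F : Set (Set (Set (E d))), F.Finite ∧
    ∀ A ∈ twoTilePatches Ω, ∃ B ∈ F, ∃ x : E d,
      Tile.supp '' A = (fun S => translateSet S x) '' B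

end

end LabelledTiling

/-!
Write `Ω'` for the tiling space with finitely many pairs of supports and `ψ : Ω' → Ω` for the given
homeomorphism. The tilings in `Ω'` are coded by new tilings with the same supports, in which the
label of a tile records its shape and one of finitely many colours. The space of coded tilings has
finite local complexity, and it remains to choose the colours so that the code is continuous and
injective.

*Orbits.* Since the transversal of `Ω` is totally disconnected, small connected sets in `Ω` lie in
orbits (`IsTilingSpace.hasLocalCocycles`). Hence `ψ` maps orbits into orbits, with a displacement
that lifts to a continuous self-map of `ℝ^d` because the periods of a tiling form a discrete group.
By invariance of domain the displacement is a homeomorphism of `ℝ^d`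
(`exists_homeomorph_displacement`). Invariance of domain is proved here from the no-retraction
theorem; it also shows that tiles are closures of their interiors.

*Compactness.* Every tile has a neighbour, so finitely many pairs of supports give finitely many
shapes. Tiles of finitely many shapes that are close to each other overlap, and therefore limits of
tilings are tilings: `Ω'` is compact (`IsTilingSpace.isCompact`), and so is `Ω`.

*Colours.* Fix for every shape a point, the anchor. The tilings in `Ω'` with a tile anchored at the
origin form a compact set `Ξ`, which meets each orbit in countably many translates; hence `Ξ` is
locally totally disconnected (`isTotallyDisconnected_inter_anchored`). So it has finite, locally
constant colourings with arbitrarily small colour classes (`exists_colouring`). The colour of a tile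
is that of the translate of the tiling with this tile anchored at the origin. The code is continuous
(`continuous_code`) and commutes with translations.

*Injectivity.* Let `T` and `T'` have the same code. Every point of `ℝ^d` is at bounded distance from
an anchor, so if the colour classes are small, then `ψ (T - x)` and `ψ (T' - x)` are close for all
`x`. Reparametrized by the displacements this says that `ψ T` and `ψ T'` shadow each other, so by
strong expansivity `ψ T = ψ T' - z` for some `z`. The constant in the definition of strong
expansivity need not be small, but `z` can be forced to be small by making the shadowing closer
(`exists_entourage_of_stronglyExpansive`): otherwise the tilings would have relatively dense periods
and could be compared by linear maps between their period lattices. For small `z` the displacement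
`y` with `T = T' - y` is small as well. As `T` and `T'` have the same supports, `y = 0`
(`exists_separating_colouring`).
-/

namespace LabelledTiling

open Set Metric Topology Filter
open scoped Uniformity

/-! ### Retractions of the ball onto its boundary -/

section

open MeasureTheory
open scoped ContDiff

/-- `det (id + t A)` is a polynomial of degree at most `d` in `t`, so it is determined by its
values at `d + 1` nodes. -/
theorem det_id_add_smul_eq_sum {d : ℕ} (A : E d →L[ℝ] E d) (t₀ : ℝ) (ht₀ : t₀ ≠ 0) (t : ℝ) :
    (ContinuousLinearMap.id ℝ (E d) + t • A).det =
      ∑ i ∈ Finset.range (d + 1),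
        (ContinuousLinearMap.id ℝ (E d) + (t₀ * i) • A).det *
          (Lagrange.basis (Finset.range (d + 1)) (fun i : ℕ => t₀ * (i : ℝ)) i).eval t := by
  classical
  set b := (EuclideanSpace.basisFun (Fin d) ℝ).toBasis
  set M : Matrix (Fin d) (Fin d) ℝ := LinearMap.toMatrix b b (A : E d →ₗ[ℝ] E d) with hM
  set p : Polynomial ℝ := Matrix.det ((Polynomial.X : Polynomial ℝ) • M.map Polynomial.C +
    (1 : Matrix (Fin d) (Fin d) ℝ).map Polynomial.C) with hp
  have hpe : ∀ s : ℝ, p.eval s = (ContinuousLinearMap.id ℝ (E d) + s • A).det := by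
    intro s
    rw [ContinuousLinearMap.det, ← LinearMap.det_toMatrix b, hp,
      ← Polynomial.coe_evalRingHom, RingHom.map_det]
    have h1 : ((ContinuousLinearMap.id ℝ (E d) + s • A : E d →L[ℝ] E d) : E d →ₗ[ℝ] E d) =
        LinearMap.id + s • (A : E d →ₗ[ℝ] E d) := rfl
    rw [h1, (LinearMap.toMatrix b b).map_add, (LinearMap.toMatrix b b).map_smul,
      LinearMap.toMatrix_id, ← hM]
    refine congrArg Matrix.det ?_
    ext i j
    by_cases hij : i = j <;>
      simp [RingHom.mapMatrix_apply, Matrix.map_apply, hij, mul_comm s, add_comm (1 : ℝ)]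
  have hdeg : p.degree < (Finset.range (d + 1)).card := by
    have := Polynomial.natDegree_det_X_add_C_le M 1
    rw [Finset.card_range]
    refine (Polynomial.degree_le_natDegree).trans_lt ?_
    rw [Fintype.card_fin] at this
    exact_mod_cast Nat.lt_succ_of_le this
  have hinj : Set.InjOn (fun i : ℕ => t₀ * (i : ℝ)) (Finset.range (d + 1)) := by
    intro i _ j _ h
    exact_mod_cast mul_left_cancel₀ ht₀ h
  have := congrArg (Polynomial.eval t) (Lagrange.eq_interpolate hinj hdeg)
  rw [hpe, Lagrange.interpolate_apply, Polynomial.eval_finsetSum] at this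
  rw [this]
  refine Finset.sum_congr rfl fun i _ => ?_
  simp [hpe]

section

variable {d : ℕ}

/-- If `t g` is a contraction, `id + t g'` is invertible and even orientation preserving. -/
theorem det_id_add_smul_pos (A : E d →L[ℝ] E d) {t C : ℝ} (hA : ‖A‖ ≤ C) (ht : 0 ≤ t)
    (htC : t * C < 1) : 0 < (ContinuousLinearMap.id ℝ (E d) + t • A).det := by
  have hne : ∀ s ∈ Icc 0 t, (ContinuousLinearMap.id ℝ (E d) + s • A).det ≠ 0 := by
    intro s hs h0
    have h0' : LinearMap.det ((ContinuousLinearMap.id ℝ (E d) + s • A : E d →L[ℝ] E d) :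
      E d →ₗ[ℝ] E d) = 0 := h0
    obtain ⟨v, hv, hv0⟩ := (Submodule.ne_bot_iff _).1
      (LinearMap.bot_lt_ker_of_det_eq_zero h0').ne'
    have h1 : v + s • A v = 0 := hv
    have h2 : ‖v‖ ≤ t * C * ‖v‖ := by
      calc ‖v‖ = ‖s • A v‖ := by rw [← norm_neg (s • A v), ← eq_neg_of_add_eq_zero_left h1]
        _ = s * ‖A v‖ := by rw [norm_smul, Real.norm_of_nonneg hs.1]
        _ ≤ t * (C * ‖v‖) := by
          have := (A.le_opNorm v).trans (mul_le_mul_of_nonneg_right hA (norm_nonneg v))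
          exact mul_le_mul hs.2 this (norm_nonneg _) ht
        _ = _ := by ring
    have h3 : 0 < ‖v‖ := norm_pos_iff.2 hv0
    nlinarith
  have hcont : Continuous fun s : ℝ => (ContinuousLinearMap.id ℝ (E d) + s • A).det :=
    ContinuousLinearMap.continuous_det.comp (by fun_prop)
  by_contra hneg
  push Not at hneg
  have h0 : (ContinuousLinearMap.id ℝ (E d) + (0 : ℝ) • A).det = 1 := by
    have : ContinuousLinearMap.id ℝ (E d) + (0 : ℝ) • A = ContinuousLinearMap.id ℝ (E d) := by
      ext v; simp
    rw [this]; exact LinearMap.det_id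
  have := intermediate_value_Icc' ht hcont.continuousOn (f := fun s : ℝ =>
    (ContinuousLinearMap.id ℝ (E d) + s • A).det)
  obtain ⟨s, hs, hs0⟩ := this ⟨hneg, by rw [h0]; exact zero_le_one⟩
  exact hne s hs hs0

/-- If `r` is a retraction of the closed ball onto its boundary, then for small `t` the map
`id + t (r - id)` permutes the open ball, so that its Jacobian determinant has integral the volume
of the ball. -/
theorem lintegral_det_of_retraction (r g : E d → E d) (C : NNReal) (hg : ∀ x, g x = r x - x)
    (hgC : ∀ x ∈ closedBall (0 : E d) 1, ContDiffAt ℝ 1 g x)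
    (hr1 : ∀ x ∈ closedBall (0 : E d) 1, ‖r x‖ = 1)
    (hrs : ∀ x ∈ sphere (0 : E d) 1, r x = x)
    (hC : LipschitzOnWith C g (closedBall (0 : E d) 1))
    (hnorm : ∀ x ∈ ball (0 : E d) 1, ‖fderiv ℝ g x‖ ≤ C)
    (t : ℝ) (ht : 0 ≤ t) (ht1 : t < 1) (htC : t * C < 1) :
    ∫⁻ x in ball (0 : E d) 1, ENNReal.ofReal
        (ContinuousLinearMap.id ℝ (E d) + t • fderiv ℝ g x).det = volume (ball (0 : E d) 1) := by
  have hbc : ball (0 : E d) 1 ⊆ closedBall 0 1 := ball_subset_closedBall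
  set f : E d → E d := fun x => x + t • g x with hf
  have hinj : InjOn f (closedBall (0 : E d) 1) := by
    intro x hx y hy hxy
    have h1 : x - y = t • (g y - g x) := by
      have : x + t • g x = y + t • g y := hxy
      rw [smul_sub, sub_eq_sub_iff_add_eq_add, this, add_comm]
    have h2 : ‖x - y‖ ≤ t * C * ‖x - y‖ := by
      have h3 := hC.dist_le_mul y hy x hx
      rw [dist_eq_norm, dist_eq_norm, norm_sub_rev y x] at h3
      calc ‖x - y‖ = t * ‖g y - g x‖ := by
            conv_lhs => rw [h1]
            rw [norm_smul, Real.norm_of_nonneg ht]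
        _ ≤ t * (C * ‖x - y‖) := mul_le_mul_of_nonneg_left h3 ht
        _ = _ := by ring
    by_contra hne
    have : 0 < ‖x - y‖ := norm_pos_iff.2 (sub_ne_zero.2 hne)
    nlinarith
  have hfd : ∀ x ∈ closedBall (0 : E d) 1, HasStrictFDerivAt f
      (ContinuousLinearMap.id ℝ (E d) + t • fderiv ℝ g x) x := by
    intro x hx
    have := ((hgC x hx).hasStrictFDerivAt one_ne_zero)
    exact (hasStrictFDerivAt_id x).add (this.const_smul t)
  have hmaps : MapsTo f (ball (0 : E d) 1) (ball (0 : E d) 1) := by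
    intro x hx
    have hx' : ‖x‖ < 1 := by simpa using hx
    have h1 : f x = (1 - t) • x + t • r x := by
      simp only [hf, hg, smul_sub, sub_smul, one_smul]; abel
    rw [mem_ball_zero_iff, h1]
    calc ‖(1 - t) • x + t • r x‖ ≤ ‖(1 - t) • x‖ + ‖t • r x‖ := norm_add_le _ _
      _ = (1 - t) * ‖x‖ + t := by
        rw [norm_smul, norm_smul, Real.norm_of_nonneg ht, hr1 x (hbc hx),
          Real.norm_of_nonneg (by linarith), mul_one]
      _ < 1 := by nlinarith
  have hfs : ∀ x ∈ sphere (0 : E d) 1, f x = x := by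
    intro x hx
    simp [hf, hg, hrs x hx]
  have himage : f '' ball (0 : E d) 1 = ball (0 : E d) 1 := by
    refine Subset.antisymm (image_subset_iff.2 hmaps) ?_
    refine IsPreconnected.subset_of_closure_inter_subset
      (convex_ball (0 : E d) 1).isPreconnected ?_ ⟨f 0, hmaps (mem_ball_self one_pos),
        mem_image_of_mem f (mem_ball_self one_pos)⟩ ?_
    · rw [isOpen_iff_mem_nhds]
      rintro _ ⟨x, hx, rfl⟩
      have hdet := det_id_add_smul_pos _ (hnorm x hx) ht htC
      have hsurj : ((ContinuousLinearMap.id ℝ (E d) + t • fderiv ℝ g x : E d →L[ℝ] E d) :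
          E d →ₗ[ℝ] E d).range = ⊤ := LinearMap.range_eq_top.2
        ((LinearMap.equivOfDetNeZero _ hdet.ne').surjective)
      rw [← (hfd x (hbc hx)).map_nhds_eq_of_surj hsurj]
      exact image_mem_map (isOpen_ball.mem_nhds hx)
    · rintro y ⟨hy, hyb⟩
      have hcomp : IsCompact (f '' closedBall (0 : E d) 1) :=
        (isCompact_closedBall _ _).image_of_continuousOn fun x hx =>
          (hfd x hx).continuousAt.continuousWithinAt
      have hy' : y ∈ f '' closedBall (0 : E d) 1 :=
        closure_minimal (image_mono hbc) hcomp.isClosed hy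
      obtain ⟨x, hx, rfl⟩ := hy'
      by_cases hxb : x ∈ ball (0 : E d) 1
      · exact mem_image_of_mem f hxb
      · have hxs : x ∈ sphere (0 : E d) 1 := by
          simp only [mem_closedBall, mem_ball, mem_sphere, not_lt] at *
          exact le_antisymm hx hxb
        rw [hfs x hxs] at hyb
        exact absurd hyb hxb
  have hcv := lintegral_abs_det_fderiv_eq_addHaar_image (volume : Measure (E d))
    (measurableSet_ball (x := (0 : E d)) (ε := 1))
    (fun x hx => (hfd x (hbc hx)).hasFDerivAt.hasFDerivWithinAt) (hinj.mono hbc)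
  rw [himage] at hcv
  rw [← hcv]
  refine setLIntegral_congr_fun measurableSet_ball fun x hx => ?_
  rw [abs_of_pos (det_id_add_smul_pos _ (hnorm x hx) ht htC)]

/-- There is no differentiable retraction of the closed ball onto its boundary sphere. The maps
`f t = id + t (r - id)` permute the open ball for small `t`, so the integral of their Jacobian
determinant is the volume of the ball. This integral is a polynomial in `t`, hence it is the volume
for `t = 1` too; but there the determinant vanishes, since `r` has values in the sphere. -/
theorem no_C1_retraction (r : E d → E d)
    (hr : ∀ x ∈ closedBall (0 : E d) 1, ContDiffAt ℝ 1 r x)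
    (hr1 : ∀ x ∈ closedBall (0 : E d) 1, ‖r x‖ = 1)
    (hrs : ∀ x ∈ sphere (0 : E d) 1, r x = x) : False := by
  set g : E d → E d := fun x => r x - x with hg
  have hgC : ∀ x ∈ closedBall (0 : E d) 1, ContDiffAt ℝ 1 g x := fun x hx =>
    (hr x hx).sub contDiffAt_id
  obtain ⟨C, hC⟩ := ContDiffOn.exists_lipschitzOnWith (s := closedBall (0 : E d) 1) (f := g)
    (fun x hx => (hgC x hx).contDiffWithinAt) one_ne_zero (convex_closedBall _ _)
    (isCompact_closedBall _ _)
  have hbc : ball (0 : E d) 1 ⊆ closedBall 0 1 := ball_subset_closedBall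
  have hnorm : ∀ x ∈ ball (0 : E d) 1, ‖fderiv ℝ g x‖ ≤ C := fun x hx =>
    (((hgC x (hbc hx)).differentiableAt one_ne_zero).hasFDerivAt).le_of_lipschitzOn
      (closedBall_mem_nhds_of_mem hx) hC
  have key := lintegral_det_of_retraction r g C (fun _ => rfl) hgC hr1 hrs hC hnorm
  set V : ℝ := (volume (ball (0 : E d) 1)).toReal with hV
  have hVpos : 0 < V := ENNReal.toReal_pos (measure_ball_pos _ _ one_pos).ne' measure_ball_lt_top.ne
  have hcontd : ∀ t : ℝ, ContinuousOn (fun x =>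
      (ContinuousLinearMap.id ℝ (E d) + t • fderiv ℝ g x).det) (ball (0 : E d) 1) := by
    intro t x hx
    have h1 : ContinuousAt (fderiv ℝ g) x :=
      ((hgC x (hbc hx)).fderiv_right (m := 0) (by norm_num)).continuousAt
    have h2 : Continuous fun A : E d →L[ℝ] E d =>
        (ContinuousLinearMap.id ℝ (E d) + t • A).det :=
      ContinuousLinearMap.continuous_det.comp (by fun_prop)
    exact (ContinuousAt.comp (f := fderiv ℝ g) h2.continuousAt h1).continuousWithinAt
  have hmeas : ∀ t : ℝ, AEStronglyMeasurable (fun x =>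
      (ContinuousLinearMap.id ℝ (E d) + t • fderiv ℝ g x).det)
      (volume.restrict (ball (0 : E d) 1)) := fun t =>
    (hcontd t).aestronglyMeasurable measurableSet_ball
  have hpos : ∀ t : ℝ, 0 ≤ t → t < 1 → t * C < 1 → 0 ≤ᵐ[volume.restrict (ball (0 : E d) 1)]
      (fun x => (ContinuousLinearMap.id ℝ (E d) + t • fderiv ℝ g x).det) := fun t ht _ htC =>
    (ae_restrict_iff' measurableSet_ball).2 (ae_of_all _ fun x hx =>
      (det_id_add_smul_pos _ (hnorm x hx) ht htC).le)
  have hint : ∀ t : ℝ, 0 ≤ t → t < 1 → t * C < 1 →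
      ∫ x in ball (0 : E d) 1, (ContinuousLinearMap.id ℝ (E d) + t • fderiv ℝ g x).det = V := by
    intro t ht ht1 htC
    rw [integral_eq_lintegral_of_nonneg_ae (hpos t ht ht1 htC) (hmeas t), key t ht ht1 htC]
  have hintble : ∀ t : ℝ, 0 ≤ t → t < 1 → t * C < 1 → Integrable (fun x =>
      (ContinuousLinearMap.id ℝ (E d) + t • fderiv ℝ g x).det)
      (volume.restrict (ball (0 : E d) 1)) := by
    intro t ht ht1 htC
    refine ⟨hmeas t, ?_⟩
    rw [hasFiniteIntegral_iff_ofReal (hpos t ht ht1 htC), key t ht ht1 htC]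
    exact measure_ball_lt_top
  set t₀ : ℝ := 1 / ((d + 1) * (C + 1)) with ht₀
  have hC0 : (0 : ℝ) ≤ C := C.2
  have hd0 : (0 : ℝ) ≤ d := Nat.cast_nonneg d
  have ht₀pos : 0 < t₀ := by positivity
  have hnode : ∀ i ∈ Finset.range (d + 1), 0 ≤ t₀ * (i : ℝ) ∧ t₀ * (i : ℝ) < 1 ∧
      t₀ * (i : ℝ) * C < 1 := by
    intro i hi
    have hi' : (i : ℝ) < d + 1 := by exact_mod_cast Finset.mem_range.1 hi
    have h1 : t₀ * (i : ℝ) * (C + 1) < 1 := by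
      have : t₀ * (i : ℝ) * (C + 1) = i / (d + 1) := by
        rw [ht₀]; field_simp
      rw [this, div_lt_one (by positivity)]
      exact hi'
    have h2 : 0 ≤ t₀ * (i : ℝ) := by positivity
    refine ⟨h2, ?_, ?_⟩ <;> nlinarith
  have hzero : ∀ x ∈ ball (0 : E d) 1,
      (ContinuousLinearMap.id ℝ (E d) + (1 : ℝ) • fderiv ℝ g x).det = 0 := by
    intro x hx
    have hdr := (hr x (hbc hx)).differentiableAt one_ne_zero
    have h1 : ContinuousLinearMap.id ℝ (E d) + (1 : ℝ) • fderiv ℝ g x = fderiv ℝ r x := by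
      rw [hg, fderiv_fun_sub hdr differentiableAt_fun_id, fderiv_fun_id, one_smul]
      abel
    rw [h1]
    by_contra hne
    have h2 : HasFDerivAt (fun y => inner ℝ (r y) (r y))
        (0 : E d →L[ℝ] ℝ) x := by
      refine (hasFDerivAt_const (1 : ℝ) x).congr_of_eventuallyEq ?_
      filter_upwards [isOpen_ball.mem_nhds hx] with y hy
      rw [real_inner_self_eq_norm_sq, hr1 y (hbc hy), one_pow]
    have h3 := h2.unique (hdr.hasFDerivAt.inner ℝ hdr.hasFDerivAt)
    obtain ⟨v, hv⟩ := (LinearMap.equivOfDetNeZero _ hne).surjective (r x)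
    have hv' : fderiv ℝ r x v = r x := hv
    have h4 := DFunLike.congr_fun h3 v
    simp [hv', hr1 x (hbc hx)] at h4
    norm_num at h4
  have hsum : ∫ x in ball (0 : E d) 1,
      (ContinuousLinearMap.id ℝ (E d) + (1 : ℝ) • fderiv ℝ g x).det = V := by
    simp_rw [det_id_add_smul_eq_sum _ t₀ ht₀pos.ne' 1]
    rw [integral_finsetSum _ fun i hi => ((hintble _ (hnode i hi).1 (hnode i hi).2.1
      (hnode i hi).2.2).mul_const _)]
    have : ∀ i ∈ Finset.range (d + 1), ∫ x in ball (0 : E d) 1,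
        (ContinuousLinearMap.id ℝ (E d) + (t₀ * i) • fderiv ℝ g x).det *
          (Lagrange.basis (Finset.range (d + 1)) (fun i : ℕ => t₀ * (i : ℝ)) i).eval 1 =
        V * (Lagrange.basis (Finset.range (d + 1)) (fun i : ℕ => t₀ * (i : ℝ)) i).eval 1 := by
      intro i hi
      rw [integral_mul_const, hint _ (hnode i hi).1 (hnode i hi).2.1 (hnode i hi).2.2]
    rw [Finset.sum_congr rfl this, ← Finset.mul_sum, ← Polynomial.eval_finsetSum,
      Lagrange.sum_basis, Polynomial.eval_one, mul_one]
    · intro i _ j _ h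
      exact_mod_cast mul_left_cancel₀ ht₀pos.ne' h
    · exact ⟨0, by simp⟩
  rw [setIntegral_congr_fun measurableSet_ball hzero] at hsum
  simp at hsum
  exact hVpos.ne hsum

end

end

/-! ### Invariance of domain -/

section

open MeasureTheory
open scoped ContDiff

variable {d : ℕ}

theorem exists_contDiff_dist_lt_on_compact (F : C(E d, E d)) {K : Set (E d)} (hK : IsCompact K)
    {ε : ℝ} (hε : 0 < ε) :
    ∃ P : E d → E d, ContDiff ℝ ∞ P ∧ ∀ x ∈ K, dist (P x) (F x) < ε := by
  have : UniformContinuousOn F (cthickening 1 K) :=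
    hK.cthickening.uniformContinuousOn_of_continuous F.continuous.continuousOn
  rcases Metric.uniformContinuousOn_iff.mp this (ε / 2) (half_pos hε) with ⟨δ, hδ, hfδ⟩
  rcases (map_continuous F).exists_contDiff_dist_le_of_forall_mem_ball_dist_le
    (lt_min one_pos hδ) with ⟨g, hgc, hg⟩
  refine ⟨g, hgc, fun x hx ↦ (hg _ _ fun y hy ↦ ?_).trans_lt (half_lt_self hε)⟩
  rw [mem_ball, lt_min_iff] at hy
  exact (hfδ _ (mem_cthickening_of_dist_le _ x _ _ hx hy.1.le) _
    (self_subset_cthickening _ hx) hy.2).le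

theorem exists_continuousMap_eqOn_compact {K : Set (E d)} (hK : IsCompact K) (F : E d → E d)
    (hF : ContinuousOn F K) : ∃ G : C(E d, E d), EqOn G F K := by
  obtain ⟨G, hG⟩ := ContinuousMap.exists_restrict_eq (Y := E d) hK.isClosed
    ⟨K.domRestrict F, hF.domRestrict⟩
  exact ⟨G, fun x hx => DFunLike.congr_fun hG ⟨x, hx⟩⟩

/-- A map of the closed unit ball that is close to the identity has a zero. Otherwise a smooth
approximation `P`, deformed near the sphere to `Q = P + ‖x‖ ^ (2 N) (id - P)` with `N` large, has
no zero either, and `Q / ‖Q‖` is a retraction onto the sphere. -/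
theorem exists_zero_of_near_id (F : E d → E d) (hF : ContinuousOn F (closedBall 0 1))
    (hFid : ∀ x ∈ closedBall (0 : E d) 1, ‖F x - x‖ ≤ 1 / 2) :
    ∃ x ∈ closedBall (0 : E d) 1, F x = 0 := by
  by_contra hno
  push Not at hno
  have hcomp := isCompact_closedBall (0 : E d) 1
  obtain ⟨x₀, hx₀, hmin⟩ := hcomp.exists_isMinOn ⟨0, mem_closedBall_self zero_le_one⟩ hF.norm
  set m := ‖F x₀‖ with hm
  have hmpos : 0 < m := norm_pos_iff.2 (hno x₀ hx₀)
  have hFm : ∀ x ∈ closedBall (0 : E d) 1, m ≤ ‖F x‖ := fun x hx => hmin hx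
  obtain ⟨G, hG⟩ := exists_continuousMap_eqOn_compact hcomp F hF
  obtain ⟨P, hPc, hP⟩ := exists_contDiff_dist_lt_on_compact G hcomp
    (lt_min (half_pos hmpos) (by norm_num : (0 : ℝ) < 1 / 4))
  have hP1 : ∀ x ∈ closedBall (0 : E d) 1, m / 2 < ‖P x‖ := by
    intro x hx
    have h1 := (hP x hx).trans_le (min_le_left _ _)
    rw [hG hx, dist_eq_norm] at h1
    have h2 := norm_sub_norm_le (F x) (F x - P x)
    rw [sub_sub_cancel, norm_sub_rev] at h2
    linarith [hFm x hx]
  have hP2 : ∀ x ∈ closedBall (0 : E d) 1, ‖x - P x‖ ≤ 3 / 4 := by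
    intro x hx
    have h1 := (hP x hx).trans_le (min_le_right _ _)
    rw [hG hx, dist_eq_norm] at h1
    have h2 := norm_add_le (P x - F x) (F x - x)
    rw [sub_add_sub_cancel, norm_sub_rev] at h2
    linarith [hFid x hx]
  obtain ⟨N, hN⟩ := exists_pow_lt_of_lt_one (half_pos hmpos) (by norm_num : (9 / 16 : ℝ) < 1)
  set χ : E d → ℝ := fun x => (‖x‖ ^ 2) ^ N with hχ
  set Q : E d → E d := fun x => P x + χ x • (x - P x) with hQ
  have hQc : ContDiff ℝ 1 Q := by
    have hP1' : ContDiff ℝ 1 P := hPc.of_le (by exact_mod_cast le_top)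
    have : ContDiff ℝ 1 χ := (contDiff_norm_sq ℝ).pow N
    exact hP1'.add (this.smul (contDiff_id.sub hP1'))
  have hQne : ∀ x ∈ closedBall (0 : E d) 1, Q x ≠ 0 := by
    intro x hx h0
    have hx1 : ‖x‖ ≤ 1 := by simpa using hx
    have hχ0 : 0 ≤ χ x := by positivity
    have hχ1 : χ x ≤ 1 := pow_le_one₀ (by positivity) (pow_le_one₀ (norm_nonneg _) hx1)
    by_cases hx2 : ‖x‖ ≤ 3 / 4
    · have h1 : ‖P x‖ ≤ χ x * (3 / 4) := by
        rw [eq_neg_of_add_eq_zero_left h0, norm_neg, norm_smul, Real.norm_of_nonneg hχ0]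
        exact mul_le_mul_of_nonneg_left (hP2 x hx) hχ0
      have h2 : χ x ≤ (9 / 16) ^ N :=
        pow_le_pow_left₀ (by positivity) (by nlinarith [norm_nonneg x]) _
      linarith [hP1 x hx]
    · -- here `Q x = x - (1 - χ) (x - P x)` and `‖x - P x‖ < ‖x‖`
      have h1 : x = (1 - χ x) • (x - P x) := by
        have : x - (1 - χ x) • (x - P x) = Q x := by
          simp only [hQ, sub_smul, one_smul]; abel
        rw [h0] at this
        exact sub_eq_zero.1 this
      have h2 : ‖x‖ ≤ (1 - χ x) * (3 / 4) := by
        calc ‖x‖ = (1 - χ x) * ‖x - P x‖ := by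
              conv_lhs => rw [h1]
              rw [norm_smul, Real.norm_of_nonneg (by linarith)]
          _ ≤ _ := mul_le_mul_of_nonneg_left (hP2 x hx) (by linarith)
      linarith
  refine no_C1_retraction (fun x => ‖Q x‖⁻¹ • Q x) ?_ ?_ ?_
  · intro x hx
    have h1 : ContDiffAt ℝ 1 (fun x => ‖Q x‖) x := hQc.contDiffAt.norm ℝ (hQne x hx)
    exact (h1.inv (norm_ne_zero_iff.2 (hQne x hx))).smul hQc.contDiffAt
  · intro x hx
    rw [norm_smul, norm_inv, norm_norm, inv_mul_cancel₀ (norm_ne_zero_iff.2 (hQne x hx))]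
  · intro x hx
    have hx1 : ‖x‖ = 1 := by simpa using hx
    have : Q x = x := by simp [hQ, hχ, hx1]
    simp only [this, hx1, inv_one, one_smul]

/-- Invariance of domain at one point. If the image of the centre were not interior, the inverse
map (which vanishes there) could be perturbed on the image to a map without zeros; composed with
`f` this contradicts `exists_zero_of_near_id`. -/
theorem mem_interior_image_closedBall (f : E d → E d) (hf : ContinuousOn f (closedBall 0 1))
    (hinj : InjOn f (closedBall 0 1)) : f 0 ∈ interior (f '' closedBall 0 1) := by
  rcases Nat.eq_zero_or_pos d with rfl | hd
  · have : f '' closedBall 0 1 = univ := by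
      ext y
      simp only [mem_univ, iff_true]
      exact ⟨0, by simp, Subsingleton.elim _ _⟩
    rw [this, interior_univ]; trivial
  have : NeZero d := ⟨hd.ne'⟩
  have : Nontrivial (E d) := inferInstance
  have hcomp := isCompact_closedBall (0 : E d) 1
  set K : Set (E d) := f '' closedBall 0 1 with hK
  have hKc : IsCompact K := hcomp.image_of_continuousOn hf
  have h0B : (0 : E d) ∈ closedBall (0 : E d) 1 := mem_closedBall_self zero_le_one
  -- a continuous extension of the inverse map
  obtain ⟨G, hG⟩ : ∃ G : C(E d, E d), ∀ x ∈ closedBall (0 : E d) 1, G (f x) = x := by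
    have : CompactSpace (closedBall (0 : E d) 1) := isCompact_iff_compactSpace.1 hcomp
    have hemb : IsClosedEmbedding ((closedBall (0 : E d) 1).domRestrict f) :=
      hf.domRestrict.isClosedEmbedding (injOn_iff_injective.1 hinj)
    obtain ⟨G, hG⟩ := ContinuousMap.exists_extension (Y := E d) hemb
      ⟨Subtype.val, continuous_subtype_val⟩
    exact ⟨G, fun x hx => DFunLike.congr_fun hG ⟨x, hx⟩⟩
  by_contra hnot
  -- near `f 0` the map `G` is small
  obtain ⟨ε, hε, hGε⟩ : ∃ ε > 0, ∀ y, dist y (f 0) < ε → ‖G y‖ < 1 / 16 := by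
    have := Metric.continuousAt_iff.1 (G.continuous.continuousAt (x := f 0)) (1 / 16) (by norm_num)
    obtain ⟨ε, hε, h⟩ := this
    refine ⟨ε, hε, fun y hy => ?_⟩
    have := h hy
    rwa [hG 0 h0B, dist_zero_right] at this
  obtain ⟨c, hcK, hc⟩ : ∃ c, c ∉ K ∧ dist c (f 0) < ε / 3 := by
    by_contra hall
    push Not at hall
    refine hnot (mem_interior.2 ⟨ball (f 0) (ε / 3), fun y hy => ?_, isOpen_ball,
      mem_ball_self (by positivity)⟩)
    by_contra hy'
    exact absurd (mem_ball.1 hy) (not_lt.2 (hall y hy'))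
  set ρ := ε / 2 with hρ
  have hρpos : 0 < ρ := by positivity
  have hcball : ∀ y, dist y c ≤ ρ → dist y (f 0) < ε := fun y hy => by
    linarith [dist_triangle y c (f 0)]
  -- on the part of `K` outside the ball around `c`, `G` does not vanish
  have hS₁c : IsCompact (K ∩ {y | ρ ≤ dist y c}) :=
    hKc.inter_right (isClosed_le continuous_const (continuous_id.dist continuous_const))
  obtain ⟨m, hmpos, hm⟩ : ∃ m > 0, ∀ y ∈ K, ρ ≤ dist y c → m ≤ ‖G y‖ := by
    rcases (K ∩ {y | ρ ≤ dist y c}).eq_empty_or_nonempty with he | hne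
    · exact ⟨1, one_pos, fun y hy hyc => absurd (he ▸ ⟨hy, hyc⟩ : y ∈ (∅ : Set (E d))) (by simp)⟩
    · obtain ⟨y₀, hy₀, hmin⟩ := hS₁c.exists_isMinOn hne G.continuous.norm.continuousOn
      refine ⟨‖G y₀‖, norm_pos_iff.2 fun h0 => ?_, fun y hy hyc => hmin ⟨hy, hyc⟩⟩
      obtain ⟨⟨x, hx, hxy⟩, hyc⟩ := hy₀
      rw [← hxy, hG x hx] at h0
      subst h0
      have : ρ ≤ dist y₀ c := hyc
      rw [← hxy, dist_comm] at this
      linarith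
  set S : Set (E d) := K ∪ sphere c ρ with hS
  have hSc : IsCompact S := hKc.union (isCompact_sphere c ρ)
  set η := min (m / 2) (1 / 16) with hη
  have hηpos : 0 < η := lt_min (half_pos hmpos) (by norm_num)
  obtain ⟨P, hPc, hP⟩ := exists_contDiff_dist_lt_on_compact G hSc (half_pos hηpos)
  -- a small constant moves `P` off zero on the sphere around `c`
  have hnull : volume (P '' sphere c ρ) = 0 :=
    addHaar_image_eq_zero_of_differentiableOn_of_addHaar_eq_zero volume
      (hPc.differentiable (by norm_num)).differentiableOn (Measure.addHaar_sphere volume c ρ)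
  obtain ⟨w, hwb, hw⟩ : ∃ w ∈ ball (0 : E d) (η / 2), w ∉ P '' sphere c ρ := by
    by_contra hall
    push Not at hall
    have := measure_mono_null (μ := volume) hall hnull
    exact (measure_ball_pos volume (0 : E d) (half_pos hηpos)).ne' this
  set R : E d → E d := fun y => P y - w with hR
  have hRG : ∀ y ∈ S, ‖R y - G y‖ < η := by
    intro y hy
    have h1 := hP y hy
    rw [dist_eq_norm] at h1
    have h2 : ‖w‖ < η / 2 := by simpa using hwb
    calc ‖R y - G y‖ = ‖(P y - G y) - w‖ := by rw [hR]; congr 1; simp only []; abel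
      _ ≤ ‖P y - G y‖ + ‖w‖ := norm_sub_le _ _
      _ < η := by linarith
  -- push the ball around `c` out to its boundary sphere
  set q : E d → E d := fun y => c + (max (ρ / dist y c) 1) • (y - c) with hq
  have hyc : ∀ y ∈ K, 0 < dist y c := fun y hy => dist_pos.2 fun h => hcK (h ▸ hy)
  have hqc : ContinuousOn q K := by
    refine continuousOn_const.add (ContinuousOn.smul (ContinuousOn.sup (continuousOn_const.div
      (continuous_id.dist continuous_const).continuousOn fun y hy => (hyc y hy).ne')
      continuousOn_const) (continuous_id.sub continuous_const).continuousOn)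
  have hq1 : ∀ y ∈ K, ρ ≤ dist y c → q y = y := by
    intro y hy h
    have : max (ρ / dist y c) 1 = 1 := max_eq_right ((div_le_one (hyc y hy)).2 h)
    simp [hq, this]
  have hq2 : ∀ y ∈ K, dist y c < ρ → q y ∈ sphere c ρ := by
    intro y hy h
    have h1 : max (ρ / dist y c) 1 = ρ / dist y c :=
      max_eq_left ((one_le_div (hyc y hy)).2 h.le)
    rw [mem_sphere, hq]
    simp only [h1]
    simp only [dist_eq_norm, add_sub_cancel_left, norm_smul]
    have h3 : 0 < ‖y - c‖ := by rw [← dist_eq_norm]; exact hyc y hy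
    rw [Real.norm_of_nonneg (by positivity), div_mul_cancel₀ _ h3.ne']
  have hηm : η ≤ m / 2 := min_le_left _ _
  have hη16 : η ≤ 1 / 16 := min_le_right _ _
  have hcontF : ContinuousOn (fun x => R (q (f x))) (closedBall 0 1) := by
    have hRc : Continuous R := hPc.continuous.sub continuous_const
    exact hRc.comp_continuousOn (hqc.comp hf (mapsTo_image _ _))
  have hnear : ∀ x ∈ closedBall (0 : E d) 1, ‖R (q (f x)) - x‖ ≤ 1 / 2 := by
    intro x hx
    have hfx : f x ∈ K := mem_image_of_mem f hx
    rcases le_or_gt ρ (dist (f x) c) with h | h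
    · rw [hq1 _ hfx h]
      have h1 := hRG (f x) (Or.inl hfx)
      rw [hG x hx] at h1
      linarith
    · have hs := hq2 _ hfx h
      have h1 := hRG _ (Or.inr hs)
      have h2 := hGε _ (hcball _ (mem_sphere.1 hs).le)
      have h3 := hGε _ (hcball _ h.le)
      rw [hG x hx] at h3
      have h4 : R (q (f x)) - x = (R (q (f x)) - G (q (f x))) + G (q (f x)) - x := by abel
      rw [h4]
      have h5 := norm_sub_le ((R (q (f x)) - G (q (f x))) + G (q (f x))) x
      have h6 := norm_add_le (R (q (f x)) - G (q (f x))) (G (q (f x)))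
      linarith
  obtain ⟨x, hx, hx0⟩ := exists_zero_of_near_id (fun x => R (q (f x))) hcontF hnear
  have hfx : f x ∈ K := mem_image_of_mem f hx
  rcases le_or_gt ρ (dist (f x) c) with h | h
  · rw [hq1 _ hfx h] at hx0
    have h1 := hRG (f x) (Or.inl hfx)
    rw [hx0, zero_sub, norm_neg] at h1
    linarith [hm _ hfx h]
  · exact hw ⟨q (f x), hq2 _ hfx h, sub_eq_zero.1 hx0⟩

/-- Invariance of domain for balls of any centre and radius. -/
theorem mem_interior_image_closedBall' (f : E d → E d) (x₀ : E d) {r : ℝ} (hr : 0 < r)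
    (hf : ContinuousOn f (closedBall x₀ r)) (hinj : InjOn f (closedBall x₀ r)) :
    f x₀ ∈ interior (f '' closedBall x₀ r) := by
  set a : E d → E d := fun x => x₀ + r • x with ha
  have himage : a '' closedBall 0 1 = closedBall x₀ r := by
    rw [ha, ← image_image (fun x => x₀ + x) (fun x => r • x)]
    simp only [image_smul]
    rw [_root_.smul_closedBall _ _ zero_le_one, image_add_left]
    ext z
    simp [dist_eq_norm, Real.norm_of_nonneg hr.le, ← sub_eq_neg_add]
  have hmaps : MapsTo a (closedBall 0 1) (closedBall x₀ r) := by
    rw [← himage]; exact mapsTo_image _ _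
  have := mem_interior_image_closedBall (f ∘ a)
    (hf.comp (by rw [ha]; fun_prop) hmaps)
    (hinj.comp (fun x _ y _ h => smul_right_injective _ hr.ne' (add_left_cancel h)) hmaps)
  rw [image_comp, himage] at this
  simpa [ha] using this

/-- A subset of `ℝ^d` that is homeomorphic to a closed ball is the closure of its interior. -/
theorem subset_closure_interior_of_homeomorph {S : Set (E d)}
    (φ : S ≃ₜ closedBall (0 : E d) 1) : S ⊆ closure (interior S) := by
  obtain ⟨f, hf⟩ := ContinuousMap.exists_restrict_eq (Y := E d)
    (isCompact_closedBall (0 : E d) 1).isClosed ⟨fun x => (φ.symm x : E d),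
      continuous_subtype_val.comp φ.symm.continuous⟩
  have hf' : ∀ x (hx : x ∈ closedBall (0 : E d) 1), f x = φ.symm ⟨x, hx⟩ := fun x hx =>
    DFunLike.congr_fun hf ⟨x, hx⟩
  have hinj : InjOn f (closedBall (0 : E d) 1) := by
    intro x hx y hy h
    rw [hf' x hx, hf' y hy] at h
    exact congrArg Subtype.val (φ.symm.injective (Subtype.ext h))
  have hS : f '' closedBall (0 : E d) 1 = S := by
    ext s
    constructor
    · rintro ⟨x, hx, rfl⟩
      rw [hf' x hx]; exact Subtype.coe_prop _
    · intro hs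
      exact ⟨φ ⟨s, hs⟩, Subtype.coe_prop _, by rw [hf' _ (Subtype.coe_prop _)]; simp⟩
  have hint : f '' ball (0 : E d) 1 ⊆ interior S := by
    rintro _ ⟨x, hx, rfl⟩
    obtain ⟨r, hr, hrs⟩ := Metric.nhds_basis_closedBall.mem_iff.1 (isOpen_ball.mem_nhds hx)
    have hrs' := hrs.trans ball_subset_closedBall
    exact interior_mono (by rw [← hS]; exact image_mono hrs')
      (mem_interior_image_closedBall' f x hr f.continuous.continuousOn (hinj.mono hrs'))
  calc S = f '' closure (ball (0 : E d) 1) := by rw [closure_ball _ one_ne_zero, hS]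
    _ ⊆ closure (f '' ball (0 : E d) 1) := image_closure_subset_closure_image f.continuous
    _ ⊆ _ := closure_mono hint

end

/-! ### Tiles and their distance -/

section

section

variable {d : ℕ}

theorem translateSet_zero (S : Set (E d)) : translateSet S 0 = S := by
  simp [translateSet]

theorem translateSet_translateSet (S : Set (E d)) (x y : E d) :
    translateSet (translateSet S x) y = translateSet S (x + y) := by
  simp only [translateSet, Set.image_image, sub_sub]

theorem mem_translateSet {S : Set (E d)} {x y : E d} : y ∈ translateSet S x ↔ y + x ∈ S := by
  constructor
  · rintro ⟨z, hz, rfl⟩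
    simpa using hz
  · intro h
    exact ⟨y + x, h, by simp⟩

theorem hausdorffEDist_ne_top_of_compact {K K' : Set (E d)} (hK : IsCompact K) (hK' : IsCompact K')
    (h : K.Nonempty) (h' : K'.Nonempty) : hausdorffEDist K K' ≠ ⊤ :=
  hausdorffEDist_ne_top_of_nonempty_of_bounded h h' hK.isBounded hK'.isBounded

theorem exists_dist_le_of_hausdorffDist_le {K K' : Set (E d)} (hK : IsCompact K)
    (hK' : IsCompact K') (h' : K'.Nonempty) {η : ℝ} (hη : hausdorffDist K K' ≤ η) {x : E d}
    (hx : x ∈ K) : ∃ y ∈ K', dist x y ≤ η := by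
  obtain ⟨y, hy, hxy⟩ := hK'.exists_infDist_eq_dist h' x
  refine ⟨y, hy, ?_⟩
  rw [← hxy]
  exact (infDist_le_hausdorffDist_of_mem hx
    (hausdorffEDist_ne_top_of_compact hK hK' ⟨x, hx⟩ h')).trans hη

theorem hausdorffDist_translateSet_le {K K' : Set (E d)} (hK : IsCompact K)
    (hK' : IsCompact K') (h : K.Nonempty) (h' : K'.Nonempty) (x x' : E d) :
    hausdorffDist (translateSet K x) (translateSet K' x') ≤ hausdorffDist K K' + ‖x - x'‖ := by
  refine hausdorffDist_le_of_mem_dist (add_nonneg hausdorffDist_nonneg (norm_nonneg _)) ?_ ?_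
  · rintro _ ⟨z, hz, rfl⟩
    obtain ⟨y, hy, hzy⟩ := exists_dist_le_of_hausdorffDist_le hK hK' h' le_rfl hz
    refine ⟨y - x', mem_image_of_mem _ hy, (dist_sub_sub_le z x y x').trans ?_⟩
    rw [dist_eq_norm x x']; gcongr
  · rintro _ ⟨z, hz, rfl⟩
    rw [hausdorffDist_comm]
    obtain ⟨y, hy, hzy⟩ := exists_dist_le_of_hausdorffDist_le hK' hK h le_rfl hz
    refine ⟨y - x, mem_image_of_mem _ hy, (dist_sub_sub_le z x' y x).trans ?_⟩
    rw [dist_comm x' x, dist_eq_norm x x']; gcongr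

end

variable {d : ℕ} {L : Type*} [MetricSpace L] {P : PrototileSet d L}

/-- A tile is a translate of a prototile. -/
def IsTile (P : PrototileSet d L) (t : Tile d L) : Prop := ∃ l x, t = (P.proto l).translate x

theorem IsTile.translate {t : Tile d L} (h : IsTile P t) (x : E d) : IsTile P (t.translate x) := by
  obtain ⟨l, y, rfl⟩ := h
  exact ⟨l, y + x, translate_translate _ _ _⟩

theorem IsTile.isCompact {t : Tile d L} (h : IsTile P t) : IsCompact t.supp := by
  obtain ⟨l, x, rfl⟩ := h
  exact (P.shape l).isCompact.image (continuous_id.sub continuous_const)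

theorem IsTile.nonempty {t : Tile d L} (h : IsTile P t) : t.supp.Nonempty := by
  obtain ⟨l, x, rfl⟩ := h
  exact (P.shape l).nonempty.image _

theorem IsTile.isConnected {t : Tile d L} (h : IsTile P t) : IsConnected t.supp := by
  obtain ⟨l, x, rfl⟩ := h
  refine IsConnected.image ?_ _ (continuous_id.sub continuous_const).continuousOn
  obtain ⟨φ⟩ := P.homeomorphic_ball l
  have : ConnectedSpace (closedBall (0 : E d) 1) := isConnected_iff_connectedSpace.1
    ((convex_closedBall _ _).isConnected ⟨0, mem_closedBall_self zero_le_one⟩)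
  exact isConnected_iff_connectedSpace.2 (φ.symm.surjective.connectedSpace φ.symm.continuous)

theorem IsTile.subset_closure_interior {t : Tile d L} (h : IsTile P t) :
    t.supp ⊆ closure (interior t.supp) := by
  obtain ⟨l, x, rfl⟩ := h
  obtain ⟨φ⟩ := P.homeomorphic_ball l
  simp only [Tile.translate, translateSet_eq]
  rw [← Homeomorph.image_interior, ← Homeomorph.image_closure]
  exact image_mono (subset_closure_interior_of_homeomorph φ)

theorem IsTile.hausdorffEDist_ne_top {t t' : Tile d L} (h : IsTile P t) (h' : IsTile P t') :
    hausdorffEDist t.supp t'.supp ≠ ⊤ :=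
  hausdorffEDist_ne_top_of_compact h.isCompact h'.isCompact h.nonempty h'.nonempty

omit [MetricSpace L] in
theorem Tile.translate_zero (t : Tile d L) : t.translate 0 = t := by
  ext1
  · exact translateSet_zero _
  · rfl

theorem Tile.translate_injective (x : E d) :
    Function.Injective (fun t : Tile d L => t.translate x) := by
  intro t t' h
  have := congrArg (fun s : Tile d L => s.translate (-x)) h
  simpa only [translate_translate, add_neg_cancel, Tile.translate_zero] using this

theorem tileDist_self (t : Tile d L) : tileDist t t = 0 := by
  simp [tileDist]

theorem tileDist_nonneg (t t' : Tile d L) : 0 ≤ tileDist t t' :=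
  le_max_of_le_right dist_nonneg

theorem tileDist_comm (t t' : Tile d L) : tileDist t t' = tileDist t' t := by
  simp [tileDist, hausdorffDist_comm, dist_comm]

theorem tileDist_triangle {t t' t'' : Tile d L} (h : IsTile P t) (h' : IsTile P t') :
    tileDist t t'' ≤ tileDist t t' + tileDist t' t'' := by
  refine max_le ?_ ?_
  · exact (hausdorffDist_triangle (h.hausdorffEDist_ne_top h')).trans
      (add_le_add (le_max_left _ _) (le_max_left _ _))
  · exact (dist_triangle _ _ _).trans (add_le_add (le_max_right _ _) (le_max_right _ _))

theorem tileDist_translate_le {t t' : Tile d L} (h : IsTile P t) (h' : IsTile P t') (x x' : E d) :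
    tileDist (t.translate x) (t'.translate x') ≤ tileDist t t' + ‖x - x'‖ := by
  refine max_le ?_ ?_
  · exact (hausdorffDist_translateSet_le h.isCompact h'.isCompact h.nonempty h'.nonempty x x').trans
      (add_le_add_left (le_max_left _ _) _)
  · exact (le_max_right _ _).trans (le_add_of_nonneg_right (norm_nonneg _))

theorem eq_of_tileDist_eq_zero {t t' : Tile d L} (h : IsTile P t) (h' : IsTile P t')
    (h0 : tileDist t t' = 0) : t = t' := by
  have h1 : hausdorffDist t.supp t'.supp = 0 :=
    le_antisymm (h0 ▸ le_max_left _ _) hausdorffDist_nonneg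
  have h2 : dist t.label t'.label = 0 := le_antisymm (h0 ▸ le_max_right _ _) dist_nonneg
  ext1
  · exact (h.isCompact.isClosed.hausdorffDist_zero_iff_eq h'.isCompact.isClosed
      (h.hausdorffEDist_ne_top h')).1 h1
  · exact dist_eq_zero.1 h2

/-- If a tile meets a closed ball, then a tile at distance at most `η` meets the ball with the
radius enlarged by `η`. -/
theorem meets_of_tileDist_le {t t' : Tile d L} (h : IsTile P t) (h' : IsTile P t') {η r r' : ℝ}
    (hη : tileDist t t' ≤ η) (hr : r + η ≤ r') (ht : (t.supp ∩ closedBall 0 r).Nonempty) :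
    (t'.supp ∩ closedBall 0 r').Nonempty := by
  obtain ⟨x, hx, hxr⟩ := ht
  obtain ⟨y, hy, hxy⟩ := exists_dist_le_of_hausdorffDist_le h.isCompact h'.isCompact h'.nonempty
    ((le_max_left _ _).trans hη) hx
  refine ⟨y, hy, ?_⟩
  rw [mem_closedBall] at hxr ⊢
  linarith [dist_triangle_left y 0 x]

omit [MetricSpace L] in
theorem meets_translate_iff {t : Tile d L} (x : E d) (r : ℝ) :
    ((t.translate x).supp ∩ closedBall 0 r).Nonempty ↔ (t.supp ∩ closedBall x r).Nonempty := by
  constructor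
  · rintro ⟨_, ⟨y, hy, rfl⟩, hyr⟩
    exact ⟨y, hy, by simpa [dist_eq_norm] using hyr⟩
  · rintro ⟨y, hy, hyr⟩
    exact ⟨y - x, mem_image_of_mem _ hy, by simpa [dist_eq_norm] using hyr⟩

theorem closedBall_subset_closedBall_zero (x : E d) (r : ℝ) :
    closedBall x r ⊆ closedBall 0 (r + ‖x‖) :=
  closedBall_subset_closedBall' (by simp)

/-! ### Tilings -/

namespace Tiling

variable (T : Tiling P)

theorem isTile {t : Tile d L} (ht : t ∈ T.tiles) : IsTile P t := T.isPatch.equiv_proto t ht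

theorem exists_mem_supp (x : E d) : ∃ t ∈ T.tiles, x ∈ t.supp := by
  have : x ∈ patchSupp T.tiles := by rw [T.covers]; trivial
  simpa [patchSupp] using this

variable {T}

theorem eq_of_mem_interior {t t' : Tile d L} (ht : t ∈ T.tiles) (ht' : t' ∈ T.tiles) {x : E d}
    (hx : x ∈ interior t.supp) (hx' : x ∈ t'.supp) : t = t' := by
  by_contra hne
  exact (T.isPatch.boundary t ht t' ht' hne ⟨interior_subset hx, hx'⟩).1.2 hx

theorem eq_of_supp_eq {t t' : Tile d L} (ht : t ∈ T.tiles) (ht' : t' ∈ T.tiles)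
    (h : t.supp = t'.supp) : t = t' := by
  obtain ⟨x, hx⟩ := (T.isTile ht).nonempty
  obtain ⟨y, hy⟩ := closure_nonempty_iff.1 ⟨x, (T.isTile ht).subset_closure_interior hx⟩
  exact eq_of_mem_interior ht ht' hy (h ▸ interior_subset hy)

theorem mem_translate {t : Tile d L} {x : E d} :
    t ∈ (T.translate x).tiles ↔ t.translate (-x) ∈ T.tiles := by
  constructor
  · rintro ⟨s, hs, rfl⟩
    simpa [translate_translate, Tile.translate_zero] using hs
  · intro h
    exact ⟨_, h, by simp [translate_translate, Tile.translate_zero]⟩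

theorem translate_mem_translate {t : Tile d L} (ht : t ∈ T.tiles) (x : E d) :
    t.translate x ∈ (T.translate x).tiles := mem_image_of_mem _ ht

theorem translate_add (x y : E d) : (T.translate x).translate y = T.translate (x + y) := by
  ext t
  simp [mem_translate, translate_translate, add_comm]

theorem translate_zero : T.translate 0 = T := by
  ext t
  simp [mem_translate, Tile.translate_zero]

theorem translate_neg_eq {T T' : Tiling P} {x : E d} (h : T = T'.translate x) :
    T' = T.translate (-x) := by
  rw [h, translate_add, add_neg_cancel, translate_zero]

/-- The tiles of a tiling that meet a connected set form a patch. -/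
theorem isPatch_meeting (T : Tiling P) {C : Set (E d)} (hC : IsConnected C) :
    IsPatch P {t ∈ T.tiles | (t.supp ∩ C).Nonempty} where
  equiv_proto t ht := T.isTile ht.1
  boundary t ht t' ht' := T.isPatch.boundary t ht.1 t' ht'.1
  connected := by
    have hsub : C ⊆ patchSupp {t ∈ T.tiles | (t.supp ∩ C).Nonempty} := by
      intro x hx
      obtain ⟨t, ht, hxt⟩ := T.exists_mem_supp x
      exact mem_biUnion (x := t) ⟨ht, x, hxt, hx⟩ hxt
    obtain ⟨x₀, hx₀⟩ := hC.nonempty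
    refine ⟨⟨x₀, hsub hx₀⟩, isPreconnected_of_forall x₀ fun y hy => ?_⟩
    obtain ⟨t, ht, hyt⟩ := mem_iUnion₂.1 hy
    refine ⟨C ∪ t.supp, union_subset hsub fun z hz => mem_biUnion (x := t) ht hz, Or.inl hx₀,
      Or.inr hyt, ?_⟩
    obtain ⟨z, hz, hzC⟩ := ht.2
    exact hC.isPreconnected.union z hzC hz (T.isTile ht.1).isConnected.isPreconnected

theorem finite_meeting (T : Tiling P) {C : Set (E d)} (hC : Bornology.IsBounded C) :
    {t ∈ T.tiles | (t.supp ∩ C).Nonempty}.Finite := by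
  obtain ⟨r, hr⟩ := hC.subset_closedBall 0
  exact (T.locally_finite r).subset fun t ht => ⟨ht.1, ht.2.mono (inter_subset_inter_right _ hr)⟩

end Tiling

/-! ### The uniform structure of the space of tilings -/

/-- A matching of tiles of two tilings at distance at most `η` in which all tiles take part that
meet the closed ball of radius `R` around the origin. -/
structure Matches (R η : ℝ) (M : Tile d L → Tile d L → Prop) (T T' : Tiling P) : Prop where
  left : ∀ {t t'}, M t t' → t ∈ T.tiles
  right : ∀ {t t'}, M t t' → t' ∈ T'.tiles
  near : ∀ {t t'}, M t t' → tileDist t t' ≤ η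
  inj : ∀ {t s t'}, M t t' → M s t' → t = s
  fn : ∀ {t t' s'}, M t t' → M t s' → t' = s'
  total : ∀ {t}, t ∈ T.tiles → (t.supp ∩ closedBall 0 R).Nonempty → ∃ t', M t t'
  cototal : ∀ {t'}, t' ∈ T'.tiles → (t'.supp ∩ closedBall 0 R).Nonempty → ∃ t, M t t'

/-- The tilings `T` and `T'` agree up to `η` in the ball of radius `R`. In contrast to `AgreeUpTo`
the matched tiles need not form patches, so that this relation is easily composed. -/
def Close (R η : ℝ) (T T' : Tiling P) : Prop := ∃ M, Matches R η M T T'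

theorem Close.refl (R : ℝ) {η : ℝ} (hη : 0 ≤ η) (T : Tiling P) : Close R η T T :=
  ⟨fun t t' => t ∈ T.tiles ∧ t = t',
    { left := fun h => h.1
      right := fun h => h.2 ▸ h.1
      near := fun h => by rw [h.2, tileDist_self]; exact hη
      inj := fun h h' => h.2.trans h'.2.symm
      fn := fun h h' => h.2.symm.trans h'.2
      total := fun h _ => ⟨_, h, rfl⟩
      cototal := fun h _ => ⟨_, h, rfl⟩ }⟩

theorem Matches.symm {R η : ℝ} {M : Tile d L → Tile d L → Prop} {T T' : Tiling P}
    (h : Matches R η M T T') : Matches R η (fun t t' => M t' t) T' T where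
  left := h.right
  right := h.left
  near h' := by rw [tileDist_comm]; exact h.near h'
  inj := h.fn
  fn := h.inj
  total := h.cototal
  cototal := h.total

theorem Close.symm {R η : ℝ} {T T' : Tiling P} (h : Close R η T T') : Close R η T' T := by
  obtain ⟨M, hM⟩ := h
  exact ⟨_, hM.symm⟩

theorem Close.mono {R η R' η' : ℝ} {T T' : Tiling P} (h : Close R η T T') (hR : R' ≤ R)
    (hη : η ≤ η') : Close R' η' T T' := by
  obtain ⟨M, hM⟩ := h
  have hb := closedBall_subset_closedBall (x := (0 : E d)) hR
  exact ⟨M, hM.left, hM.right, fun h => (hM.near h).trans hη, hM.inj, hM.fn,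
    fun h h' => hM.total h (h'.mono (inter_subset_inter_right _ hb)),
    fun h h' => hM.cototal h (h'.mono (inter_subset_inter_right _ hb))⟩

theorem Close.trans {R η R' η' R₀ : ℝ} {T T' T'' : Tiling P} (h : Close R η T T')
    (h' : Close R' η' T' T'') (h1 : R₀ ≤ R) (h2 : R₀ + η ≤ R') (h3 : R₀ ≤ R') (h4 : R₀ + η' ≤ R) :
    Close R₀ (η + η') T T'' := by
  obtain ⟨M, hM⟩ := h
  obtain ⟨N, hN⟩ := h'
  refine ⟨fun t t'' => ∃ t', M t t' ∧ N t' t'', ?_⟩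
  constructor
  · rintro t t'' ⟨t', h, h'⟩
    exact hM.left h
  · rintro t t'' ⟨t', h, h'⟩
    exact hN.right h'
  · rintro t t'' ⟨t', h, h'⟩
    exact (tileDist_triangle (T.isTile (hM.left h)) (T'.isTile (hM.right h))).trans
      (add_le_add (hM.near h) (hN.near h'))
  · rintro t s t'' ⟨t', h, h'⟩ ⟨s', g, g'⟩
    have := hN.inj h' g'
    subst this
    exact hM.inj h g
  · rintro t t'' s'' ⟨t', h, h'⟩ ⟨s', g, g'⟩
    have := hM.fn h g
    subst this
    exact hN.fn h' g'
  · intro t ht hm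
    obtain ⟨t', h⟩ := hM.total ht (hm.mono (inter_subset_inter_right _
      (closedBall_subset_closedBall h1)))
    obtain ⟨t'', h'⟩ := hN.total (hM.right h)
      (meets_of_tileDist_le (T.isTile ht) (T'.isTile (hM.right h)) (hM.near h) h2 hm)
    exact ⟨t'', t', h, h'⟩
  · intro t'' ht hm
    obtain ⟨t', h⟩ := hN.cototal ht (hm.mono (inter_subset_inter_right _
      (closedBall_subset_closedBall h3)))
    obtain ⟨t, h'⟩ := hM.cototal (hN.left h) (meets_of_tileDist_le (T''.isTile ht)
      (T'.isTile (hN.left h)) (by rw [tileDist_comm]; exact hN.near h) h4 hm)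
    exact ⟨t, t', h', h⟩

theorem Close.translate {R η R₀ : ℝ} {T T' : Tiling P} (h : Close R η T T') (x x' : E d)
    (hx : R₀ + ‖x‖ ≤ R) (hx' : R₀ + ‖x'‖ ≤ R) :
    Close R₀ (η + ‖x - x'‖) (T.translate x) (T'.translate x') := by
  obtain ⟨M, hM⟩ := h
  refine ⟨fun t t' => M (t.translate (-x)) (t'.translate (-x')), ?_⟩
  constructor
  · intro t t' h
    exact Tiling.mem_translate.2 (hM.left h)
  · intro t t' h
    exact Tiling.mem_translate.2 (hM.right h)
  · intro t t' h
    have := tileDist_translate_le (T.isTile (hM.left h)) (T'.isTile (hM.right h)) x x'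
    simp only [translate_translate, neg_add_cancel, Tile.translate_zero] at this
    linarith [hM.near h]
  · intro t s t' h h'
    exact Tile.translate_injective _ (hM.inj h h')
  · intro t s t' h h'
    exact Tile.translate_injective _ (hM.fn h h')
  · intro t ht hm
    have hm' : ((t.translate (-x)).supp ∩ closedBall 0 R).Nonempty := by
      refine (meets_translate_iff (-x) R).2 (hm.mono (inter_subset_inter_right _ ?_))
      exact closedBall_subset_closedBall' (by simpa using hx)
    obtain ⟨t', h⟩ := hM.total (Tiling.mem_translate.1 ht) hm'
    exact ⟨t'.translate x', by simpa [translate_translate, Tile.translate_zero] using h⟩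
  · intro t' ht hm
    have hm' : ((t'.translate (-x')).supp ∩ closedBall 0 R).Nonempty := by
      refine (meets_translate_iff (-x') R).2 (hm.mono (inter_subset_inter_right _ ?_))
      exact closedBall_subset_closedBall' (by simpa using hx')
    obtain ⟨t, h⟩ := hM.cototal (Tiling.mem_translate.1 ht) hm'
    exact ⟨t.translate x, by simpa [translate_translate, Tile.translate_zero] using h⟩

theorem Tiling.eq_of_close {T T' : Tiling P} (h : ∀ ε > 0, Close (1 / ε) ε T T') : T = T' := by
  have key : ∀ (T T' : Tiling P), (∀ ε > 0, Close (1 / ε) ε T T') → T.tiles ⊆ T'.tiles := by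
    intro T T' h t ht
    obtain ⟨x, hx⟩ := (T.isTile ht).nonempty
    set r := ‖x‖ + 1 with hr
    have hfin := T'.locally_finite (r + 1)
    -- tiles of `T'` arbitrarily close to `t`, all from one finite set
    have h1 : ∀ ε > 0, ∃ t' ∈ {t' ∈ T'.tiles | (t'.supp ∩ closedBall 0 (r + 1)).Nonempty},
        tileDist t t' ≤ ε := by
      intro ε hε
      have hr0 : 0 < r := by positivity
      obtain ⟨M, hM⟩ := h (min ε (min 1 (1 / r))) (by positivity)
      have hmr : (t.supp ∩ closedBall 0 r).Nonempty := ⟨x, hx, by simp [hr]⟩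
      obtain ⟨t', ht'⟩ := hM.total ht (hmr.mono (inter_subset_inter_right _
        (closedBall_subset_closedBall (by
          rw [le_div_iff₀ (by positivity)]
          calc r * min ε (min 1 (1 / r)) ≤ r * (1 / r) := by
                gcongr; exact (min_le_right _ _).trans (min_le_right _ _)
            _ = 1 := by field_simp))))
      have hn := hM.near ht'
      refine ⟨t', ⟨hM.right ht', meets_of_tileDist_le (T.isTile ht) (T'.isTile (hM.right ht')) hn
        ?_ hmr⟩, hn.trans (min_le_left _ _)⟩
      linarith [min_le_left (1 : ℝ) (1 / r), min_le_right ε (min 1 (1 / r))]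
    by_contra hnot
    obtain ⟨t₁, ht₁, -⟩ := h1 1 one_pos
    obtain ⟨t₀, ht₀, hmin⟩ := hfin.exists_minimalFor (tileDist t) _ ⟨t₁, ht₁⟩
    have hpos : 0 < tileDist t t₀ := lt_of_le_of_ne (tileDist_nonneg _ _) fun h0 => hnot
      (eq_of_tileDist_eq_zero (T.isTile ht) (T'.isTile ht₀.1) h0.symm ▸ ht₀.1)
    obtain ⟨t', ht', hle⟩ := h1 _ (half_pos hpos)
    have := hmin ht' (hle.trans (by linarith))
    linarith
  ext1
  exact Subset.antisymm (key _ _ h) (key _ _ fun ε hε => (h ε hε).symm)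

/-- The set of pairs of tilings that agree up to `ε` in the ball of radius `1 / ε`. -/
def closeSet (P : PrototileSet d L) (ε : ℝ) : Set (Tiling P × Tiling P) :=
  {p | Close (1 / ε) ε p.1 p.2}

theorem closeSet_mono {ε ε' : ℝ} (hε : 0 < ε) (h : ε ≤ ε') : closeSet P ε ⊆ closeSet P ε' :=
  fun _ hp => Close.mono hp (one_div_le_one_div_of_le hε h) h

/-- The uniform structure generated by the relations `Close`. -/
def tilingCore (P : PrototileSet d L) : UniformSpace.Core (Tiling P) :=
  UniformSpace.Core.mkOfBasis
    { sets := closeSet P '' Ioi 0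
      nonempty := ⟨_, 1, mem_Ioi.2 one_pos, rfl⟩
      inter_sets := by
        rintro _ _ ⟨ε, hε, rfl⟩ ⟨ε', hε', rfl⟩
        rw [mem_Ioi] at hε hε'
        exact ⟨_, ⟨min ε ε', lt_min hε hε', rfl⟩, subset_inter
          (closeSet_mono (lt_min hε hε') (min_le_left _ _))
          (closeSet_mono (lt_min hε hε') (min_le_right _ _))⟩ }
    (by
      rintro _ ⟨ε, hε, rfl⟩ T
      exact Close.refl _ (le_of_lt hε) T)
    (by
      rintro _ ⟨ε, hε, rfl⟩
      exact ⟨_, ⟨ε, hε, rfl⟩, fun p hp => Close.symm hp⟩)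
    (by
      rintro _ ⟨ε, hε, rfl⟩
      rw [mem_Ioi] at hε
      have hδ : 0 < min (ε / 2) (1 / ε) := by positivity
      refine ⟨_, ⟨min (ε / 2) (1 / ε), hδ, rfl⟩, ?_⟩
      rintro ⟨T, T''⟩ ⟨T', h, h'⟩
      have h1 : 2 * (1 / ε) ≤ 1 / min (ε / 2) (1 / ε) := by
        rw [le_div_iff₀ hδ]
        calc 2 * (1 / ε) * min (ε / 2) (1 / ε) ≤ 2 * (1 / ε) * (ε / 2) := by
              gcongr; exact min_le_left _ _
          _ = 1 := by field_simp
      have h2 : min (ε / 2) (1 / ε) ≤ 1 / ε := min_le_right _ _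
      have h3 : min (ε / 2) (1 / ε) ≤ ε / 2 := min_le_left _ _
      have h4 : 0 < 1 / ε := by positivity
      exact (Close.trans (R₀ := 1 / ε) h h' (by linarith) (by linarith) (by linarith)
        (by linarith)).mono le_rfl (by linarith))

theorem mem_tilingCore {s : Set (Tiling P × Tiling P)} :
    s ∈ (tilingCore P).uniformity ↔ ∃ ε > 0, closeSet P ε ⊆ s := by
  refine (FilterBasis.mem_filter_iff _).trans ?_
  constructor
  · rintro ⟨_, ⟨ε, hε, rfl⟩, h⟩
    exact ⟨ε, hε, h⟩
  · rintro ⟨ε, hε, h⟩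
    exact ⟨_, ⟨ε, hε, rfl⟩, h⟩

end

/-! ### The topology of the tiling distance -/

section

variable {d : ℕ} {L : Type*} [MetricSpace L] {P : PrototileSet d L}

theorem exists_equiv_of_biUnique {α : Type*} {A B : Set α} (N : α → α → Prop)
    (h1 : ∀ a ∈ A, ∃ b ∈ B, N a b) (h2 : ∀ b ∈ B, ∃ a ∈ A, N a b)
    (h3 : ∀ a a' b, N a b → N a' b → a = a') (h4 : ∀ a b b', N a b → N a b' → b = b') :
    ∃ e : A ≃ B, ∀ a : A, N a (e a) := by
  choose f hfB hf using h1
  refine ⟨Equiv.ofBijective (fun a : A => ⟨f a a.2, hfB a a.2⟩) ⟨?_, ?_⟩, fun a => hf a a.2⟩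
  · intro a a' h
    have h' : f a a.2 = f a' a'.2 := congrArg Subtype.val h
    exact Subtype.ext (h3 _ _ _ (hf a a.2) (h' ▸ hf a' a'.2))
  · rintro ⟨b, hb⟩
    obtain ⟨a, ha, hab⟩ := h2 b hb
    exact ⟨⟨a, ha⟩, Subtype.ext (h4 _ _ _ (hf a ha) hab)⟩

theorem tilingDist_le_one (T T' : Tiling P) : tilingDist T T' ≤ 1 :=
  csInf_le ⟨0, by rintro x (⟨h, -⟩ | rfl); exacts [h.le, zero_le_one]⟩ (Or.inr rfl)

theorem tilingDist_le_of_agreeUpTo {T T' : Tiling P} {ε : ℝ} (h0 : 0 < ε) (h1 : ε ≤ 1)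
    (h : AgreeUpTo ε T T') : tilingDist T T' ≤ ε :=
  csInf_le ⟨0, by rintro x (⟨h, -⟩ | rfl); exacts [h.le, zero_le_one]⟩ (Or.inl ⟨h0, h1, h⟩)

theorem exists_agreeUpTo_of_tilingDist_lt {T T' : Tiling P} {ε : ℝ} (h1 : ε ≤ 1)
    (h : tilingDist T T' < ε) : ∃ ε', 0 < ε' ∧ ε' < ε ∧ AgreeUpTo ε' T T' := by
  obtain ⟨ε', h', hε'⟩ := exists_lt_of_csInf_lt
    (s := {ε : ℝ | 0 < ε ∧ ε ≤ 1 ∧ AgreeUpTo ε T T'} ∪ {1}) ⟨1, Or.inr rfl⟩ h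
  rcases h' with ⟨h0, -, hA⟩ | rfl
  · exact ⟨ε', h0, hε', hA⟩
  · exact absurd hε' (not_lt.2 h1)

/-- The patches in the definition of `AgreeUpTo` contain all tiles that meet a smaller ball,
because a tile is the closure of its interior. -/
theorem AgreeUpTo.close {T T' : Tiling P} {ε R : ℝ} (hR : R < 1 / ε) (h : AgreeUpTo ε T T') :
    Close R ε T T' := by
  obtain ⟨A, B, hA, hB, -, -, -, -, hcA, hcB, e, he⟩ := h
  have key : ∀ (T : Tiling P) (A : Set (Tile d L)), A ⊆ T.tiles →
      closedBall 0 (1 / ε) ⊆ patchSupp A → ∀ t ∈ T.tiles,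
      (t.supp ∩ closedBall 0 R).Nonempty → t ∈ A := by
    intro T A hA hcA t ht hm
    obtain ⟨x, hx, hxR⟩ := hm
    have hxb : x ∈ ball (0 : E d) (1 / ε) := closedBall_subset_ball hR hxR
    obtain ⟨y, hyb, hyi⟩ := mem_closure_iff.1 ((T.isTile ht).subset_closure_interior hx) _
      isOpen_ball hxb
    obtain ⟨s, hs, hys⟩ := mem_iUnion₂.1 (hcA (ball_subset_closedBall hyb))
    rwa [Tiling.eq_of_mem_interior ht (hA hs) hyi hys]
  refine ⟨fun t t' => ∃ h : t ∈ A, (e ⟨t, h⟩ : Tile d L) = t', ?_⟩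
  constructor
  · rintro t t' ⟨h, -⟩
    exact hA h
  · rintro t t' ⟨h, rfl⟩
    exact hB (Subtype.coe_prop _)
  · rintro t t' ⟨h, rfl⟩
    exact he ⟨t, h⟩
  · rintro t s t' ⟨h, rfl⟩ ⟨h', h''⟩
    exact (congrArg Subtype.val (e.injective (Subtype.ext h''))).symm
  · rintro t t' s' ⟨h, rfl⟩ ⟨h', rfl⟩
    rfl
  · intro t ht hm
    exact ⟨_, key T A hA hcA t ht hm, rfl⟩
  · intro t' ht hm
    refine ⟨e.symm ⟨t', key T' B hB hcB t' ht hm⟩, Subtype.coe_prop _, by simp⟩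

theorem infDist_le_iff_of_isCompact {K : Set (E d)} (hK : IsCompact K) (hne : K.Nonempty)
    {c : E d} {ρ : ℝ} : infDist c K ≤ ρ ↔ (K ∩ closedBall c ρ).Nonempty := by
  constructor
  · intro h
    obtain ⟨y, hy, hcy⟩ := hK.exists_infDist_eq_dist hne c
    exact ⟨y, hy, by rw [mem_closedBall, dist_comm, ← hcy]; exact h⟩
  · rintro ⟨y, hy, hcy⟩
    exact (infDist_le_dist_of_mem hy).trans (by rwa [dist_comm])

/-- If `A` and `B` are close to `T₀` and `z` is close to `z₀`, where `‖z₀‖ < ε`, then `A` and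
`B - z` are at distance less than `ε`. The patches needed for this consist of the tiles that
correspond to the tiles of `T₀` meeting one of the balls of radius `ρ` around `0` and `z₀`. Here `ρ`
differs from the distances of the tiles of `T₀` from `0` and `z₀`, so that the corresponding tiles
of `A` and `B` are those which meet the same balls, and therefore form patches. -/
theorem exists_tilingDist_translate_lt (T₀ : Tiling P) {z₀ : E d} {ε : ℝ} (hz₀ : ‖z₀‖ < ε) :
    ∃ δ > 0, ∀ (A B : Tiling P) (z : E d), Close (1 / δ) δ T₀ A → Close (1 / δ) δ T₀ B →
      ‖z - z₀‖ < δ → tilingDist A (B.translate z) < ε := by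
  rcases lt_or_ge 1 ε with hε1 | hε1
  · exact ⟨1, one_pos, fun A B z _ _ _ => (tilingDist_le_one _ _).trans_lt hε1⟩
  obtain ⟨ε₁, hε₁, hε₁ε⟩ := exists_between hz₀
  have hε₁0 : 0 < ε₁ := (norm_nonneg _).trans_lt hε₁
  have hz₀1 : ‖z₀‖ < 1 := hz₀.trans_le hε1
  -- the smaller of the distances of a tile from `0` and `z₀`
  set m : Tile d L → ℝ := fun t => min (infDist 0 t.supp) (infDist z₀ t.supp) with hm
  have hm_iff : ∀ {t : Tile d L} (ρ : ℝ), IsTile P t →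
      (m t ≤ ρ ↔ (t.supp ∩ (closedBall 0 ρ ∪ closedBall z₀ ρ)).Nonempty) := by
    intro t ρ ht
    rw [inter_union_distrib_left, union_nonempty, ← infDist_le_iff_of_isCompact ht.isCompact
      ht.nonempty, ← infDist_le_iff_of_isCompact ht.isCompact ht.nonempty, hm, min_le_iff]
  have hm_near : ∀ {t t' : Tile d L}, IsTile P t → IsTile P t' → m t ≤ m t' + tileDist t t' := by
    intro t t' ht ht'
    have hH : hausdorffDist t'.supp t.supp ≤ tileDist t t' := by
      rw [hausdorffDist_comm]; exact le_max_left _ _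
    have h1 := infDist_le_infDist_add_hausdorffDist (x := (0 : E d)) (ht'.hausdorffEDist_ne_top ht)
    have h2 := infDist_le_infDist_add_hausdorffDist (x := z₀) (ht'.hausdorffEDist_ne_top ht)
    rw [← min_add_add_right]
    exact min_le_min (by linarith) (by linarith)
  set R := 1 / ε₁ + 5 with hR
  have hR0 : 0 < 1 / ε₁ := by positivity
  obtain ⟨ρ, hρ, hρm⟩ := (Ioo_infinite (by linarith : 1 / ε₁ + 1 < 1 / ε₁ + 2)).exists_notMem_finite
    ((T₀.locally_finite R).image m)
  obtain ⟨η, hη, hηm⟩ : ∃ η > 0, ∀ t ∈ T₀.tiles, (t.supp ∩ closedBall 0 R).Nonempty →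
      η < |m t - ρ| := by
    have hnh := (((T₀.locally_finite R).image m).isClosed.isOpen_compl).mem_nhds hρm
    obtain ⟨η, hη, h⟩ := Metric.nhds_basis_closedBall.mem_iff.1 hnh
    refine ⟨η, hη, fun t ht htR => ?_⟩
    by_contra hle
    push Not at hle
    exact h (mem_closedBall.2 (by rwa [Real.dist_eq])) (mem_image_of_mem m ⟨ht, htR⟩)
  set δ := min (min η ((ε₁ - ‖z₀‖) / 3)) (min 1 (1 / R)) with hδ
  have hR1 : 0 < R := by positivity
  have hδ0 : 0 < δ := lt_min (lt_min hη (by linarith)) (lt_min one_pos (by positivity))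
  have hδη : δ ≤ η := (min_le_left _ _).trans (min_le_left _ _)
  have hδε : δ ≤ (ε₁ - ‖z₀‖) / 3 := (min_le_left _ _).trans (min_le_right _ _)
  have hδ1 : δ ≤ 1 := (min_le_right _ _).trans (min_le_left _ _)
  have hδR : R ≤ 1 / δ := by
    rw [le_one_div hR1 hδ0]
    exact (min_le_right _ _).trans (min_le_right _ _)
  refine ⟨δ, hδ0, fun A B z hA hB hz => ?_⟩
  obtain ⟨hρ1, hρ2⟩ := hρ
  set C : Set (E d) := closedBall 0 ρ ∪ closedBall z₀ ρ with hC
  have hCconn : IsConnected C := by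
    have hρ0 : 0 ≤ ρ := by linarith
    refine IsConnected.union ⟨0, mem_closedBall_self hρ0, ?_⟩
      ((convex_closedBall _ _).isConnected ⟨_, mem_closedBall_self hρ0⟩)
      ((convex_closedBall _ _).isConnected ⟨_, mem_closedBall_self hρ0⟩)
    rw [mem_closedBall, dist_zero_left]; linarith
  have hCbdd : Bornology.IsBounded C := isBounded_closedBall.union isBounded_closedBall
  have hCcover : ∀ (T : Tiling P) (x : E d), x ∈ C →
      x ∈ patchSupp {t ∈ T.tiles | (t.supp ∩ C).Nonempty} := by
    intro T x hx
    obtain ⟨t, ht, hxt⟩ := T.exists_mem_supp x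
    exact mem_biUnion (x := t) ⟨ht, x, hxt, hx⟩ hxt
  -- a tile that is close to `0` or `z₀` meets the ball of radius `R`
  have hmR : ∀ {t : Tile d L}, IsTile P t → m t ≤ ρ + 1 →
      (t.supp ∩ closedBall 0 R).Nonempty := by
    intro t ht h
    obtain ⟨x, hx, hxC⟩ := (hm_iff _ ht).1 h
    refine ⟨x, hx, ?_⟩
    rcases hxC with hxC | hxC
    · exact closedBall_subset_closedBall (by linarith) hxC
    · exact closedBall_subset_closedBall' (by rw [dist_zero_right]; linarith) hxC
  -- corresponding tiles lie on the same side of the gap at `ρ`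
  have hgap : ∀ {A : Tiling P} {M}, Matches (1 / δ) δ M T₀ A → ∀ {t a}, M t a →
      (m t ≤ ρ ↔ m a ≤ ρ) := by
    intro A M hM t a hta
    have ht := T₀.isTile (hM.left hta)
    have ha := A.isTile (hM.right hta)
    have h1 := hm_near ht ha
    have h2 := hm_near ha ht
    rw [tileDist_comm] at h2
    have h3 := hM.near hta
    constructor
    · intro h
      have := hηm t (hM.left hta) (hmR ht (by linarith))
      rw [abs_of_nonpos (by linarith)] at this
      linarith
    · intro h
      by_contra hlt
      push Not at hlt
      have := hηm t (hM.left hta) (hmR ht (by linarith))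
      rw [abs_of_pos (by linarith)] at this
      linarith
  obtain ⟨M, hM⟩ := hA
  obtain ⟨N, hN⟩ := hB
  have hbR := closedBall_subset_closedBall (x := (0 : E d)) hδR
  refine (tilingDist_le_of_agreeUpTo hε₁0 (by linarith) ?_).trans_lt hε₁ε
  refine ⟨{t ∈ A.tiles | (t.supp ∩ C).Nonempty},
    translatePatch {t ∈ B.tiles | (t.supp ∩ C).Nonempty} z, fun t ht => ht.1,
    image_mono fun t ht => ht.1, A.finite_meeting hCbdd, (B.finite_meeting hCbdd).image _,
    A.isPatch_meeting hCconn, (B.isPatch_meeting hCconn).translate z, ?_, ?_, ?_⟩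
  · exact fun x hx => hCcover A x (Or.inl (closedBall_subset_closedBall (by linarith) hx))
  · intro x hx
    rw [patchSupp_translatePatch, mem_translateSet]
    refine hCcover B _ (Or.inr ?_)
    rw [mem_closedBall_zero_iff] at hx
    rw [mem_closedBall, dist_eq_norm, add_sub_assoc]
    linarith [norm_add_le x (z - z₀)]
  · have hequiv : ∃ e : {t ∈ A.tiles | (t.supp ∩ C).Nonempty} ≃
        translatePatch {t ∈ B.tiles | (t.supp ∩ C).Nonempty} z, ∀ a : {t ∈ A.tiles |
          (t.supp ∩ C).Nonempty}, ∃ t b, M t a ∧ N t b ∧ b.translate z = e a := by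
      refine exists_equiv_of_biUnique (fun a b' => ∃ t b, M t a ∧ N t b ∧ b.translate z = b')
        ?_ ?_ ?_ ?_
      · rintro a ⟨ha, haC⟩
        have hma := (hm_iff ρ (A.isTile ha)).2 haC
        obtain ⟨t, hta⟩ := hM.cototal ha ((hmR (A.isTile ha) (by linarith)).mono
          (inter_subset_inter_right _ hbR))
        have hmt := (hgap hM hta).2 hma
        have ht := hM.left hta
        obtain ⟨b, htb⟩ := hN.total ht ((hmR (T₀.isTile ht) (by linarith)).mono
          (inter_subset_inter_right _ hbR))
        have hmb := (hgap hN htb).1 hmt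
        exact ⟨_, mem_image_of_mem _ ⟨hN.right htb, (hm_iff ρ (B.isTile (hN.right htb))).1 hmb⟩,
          t, b, hta, htb, rfl⟩
      · rintro _ ⟨b, ⟨hb, hbC⟩, rfl⟩
        have hmb := (hm_iff ρ (B.isTile hb)).2 hbC
        obtain ⟨t, htb⟩ := hN.cototal hb ((hmR (B.isTile hb) (by linarith)).mono
          (inter_subset_inter_right _ hbR))
        have hmt := (hgap hN htb).2 hmb
        have ht := hN.left htb
        obtain ⟨a, hta⟩ := hM.total ht ((hmR (T₀.isTile ht) (by linarith)).mono
          (inter_subset_inter_right _ hbR))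
        have hma := (hgap hM hta).1 hmt
        exact ⟨a, ⟨hM.right hta, (hm_iff ρ (A.isTile (hM.right hta))).1 hma⟩, t, b, hta, htb, rfl⟩
      · rintro a a' b' ⟨t, b, hta, htb, hb⟩ ⟨s, c, hsa, hsc, hc⟩
        have := Tile.translate_injective z (hb.trans hc.symm)
        subst this
        have := hN.inj htb hsc
        subst this
        exact hM.fn hta hsa
      · rintro a b' b'' ⟨t, b, hta, htb, rfl⟩ ⟨s, c, hsa, hsc, rfl⟩
        have := hM.inj hta hsa
        subst this
        rw [hN.fn htb hsc]
    obtain ⟨e, he⟩ := hequiv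
    refine ⟨e, fun a => ?_⟩
    obtain ⟨t, b, hta, htb, hb⟩ := he a
    rw [← hb]
    have ha := A.isTile (hM.right hta)
    have ht := T₀.isTile (hM.left hta)
    have hb := B.isTile (hN.right htb)
    have h1 := tileDist_translate_le ha hb 0 z
    rw [Tile.translate_zero, zero_sub, norm_neg] at h1
    have h2 := tileDist_triangle (t'' := b) ha ht
    rw [tileDist_comm (a : Tile d L) t] at h2
    have h3 := norm_add_le (z - z₀) z₀
    rw [sub_add_cancel] at h3
    linarith [hM.near hta, hN.near htb]

/-- The topology of the tiling distance is induced by the uniform structure of the relations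
`Close`. -/
theorem tilingTopology_eq :
    (inferInstance : TopologicalSpace (Tiling P)) = (tilingCore P).toTopologicalSpace := by
  ext U
  change (∀ T ∈ U, ∃ ε > 0, ∀ T', tilingDist T T' < ε → T' ∈ U) ↔
    ∀ T ∈ U, U ∈ comap (Prod.mk T) (tilingCore P).uniformity
  refine forall₂_congr fun T _ => ?_
  rw [mem_comap]
  constructor
  · rintro ⟨ε, hε, h⟩
    obtain ⟨δ, hδ, hδε⟩ := exists_tilingDist_translate_lt T (z₀ := 0) (by simpa using hε)
    refine ⟨_, mem_tilingCore.2 ⟨δ, hδ, Subset.rfl⟩, fun T' hT' => h T' ?_⟩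
    have := hδε T T' 0 (Close.refl _ hδ.le T) hT' (by simpa using hδ)
    rwa [Tiling.translate_zero] at this
  · rintro ⟨s, hs, hsU⟩
    obtain ⟨ε, hε, hεs⟩ := mem_tilingCore.1 hs
    refine ⟨min ε 1, by positivity, fun T' hT' => hsU (hεs ?_)⟩
    obtain ⟨ε', h0, hε', hA⟩ := exists_agreeUpTo_of_tilingDist_lt (min_le_right _ _) hT'
    have hε'ε : ε' < ε := hε'.trans_le (min_le_left _ _)
    exact (hA.close (one_div_lt_one_div_of_lt h0 hε'ε)).mono le_rfl hε'ε.le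

instance : UniformSpace (Tiling P) :=
  UniformSpace.ofCoreEq (tilingCore P) inferInstance tilingTopology_eq

theorem hasBasis_uniformity_tiling :
    (𝓤 (Tiling P)).HasBasis (fun ε : ℝ => 0 < ε) (closeSet P) :=
  ⟨fun _ => mem_tilingCore⟩

theorem hasBasis_nhds_tiling (T : Tiling P) :
    (𝓝 T).HasBasis (fun ε : ℝ => 0 < ε) (fun ε => {T' | Close (1 / ε) ε T T'}) :=
  nhds_basis_uniformity' hasBasis_uniformity_tiling

instance : T2Space (Tiling P) := by
  have : T0Space (Tiling P) := by
    rw [t0Space_iff_uniformity]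
    exact fun T T' h => Tiling.eq_of_close fun ε hε =>
      h _ (hasBasis_uniformity_tiling.mem_of_mem hε)
  infer_instance

theorem Tiling.continuous_translate :
    Continuous fun p : Tiling P × E d => p.1.translate p.2 := by
  rw [continuous_iff_continuousAt]
  rintro ⟨T, x⟩
  rw [ContinuousAt, (hasBasis_nhds_tiling _).tendsto_right_iff]
  intro ε hε
  set δ := min (min (ε / 2) 1) (1 / (1 / ε + ‖x‖ + 1)) with hδ
  have hr : 0 < 1 / ε + ‖x‖ + 1 := by positivity
  have hδ0 : 0 < δ := by positivity
  have h1 : ∀ᶠ p : Tiling P × E d in 𝓝 (T, x), Close (1 / δ) δ T p.1 :=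
    (continuous_fst.tendsto (T, x)).eventually ((hasBasis_nhds_tiling T).mem_of_mem hδ0)
  have h2 : ∀ᶠ p : Tiling P × E d in 𝓝 (T, x), ‖x - p.2‖ < δ := by
    filter_upwards [(continuous_snd.tendsto (T, x)).eventually (ball_mem_nhds x hδ0)] with p hp
    rw [← dist_eq_norm, dist_comm]; exact hp
  filter_upwards [h1, h2] with p hp1 hp2
  have hδε : δ ≤ ε / 2 := (min_le_left _ _).trans (min_le_left _ _)
  have hδ1 : δ ≤ 1 := (min_le_left _ _).trans (min_le_right _ _)
  have hδr : 1 / ε + ‖x‖ + 1 ≤ 1 / δ := by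
    rw [le_one_div hr hδ0]; exact min_le_right _ _
  have h3 : ‖p.2‖ ≤ ‖x‖ + ‖x - p.2‖ := by
    have := norm_sub_le x (x - p.2); rwa [sub_sub_cancel] at this
  exact (hp1.translate (R₀ := 1 / ε) x p.2 (by linarith) (by linarith)).mono le_rfl (by linarith)

/-- Translations by vectors shorter than `ε` move a tiling by less than `ε`, also after a small
perturbation of the tiling. -/
theorem eventually_tilingDist_translate_lt (T₀ : Tiling P) {z₀ : E d} {ε : ℝ} (hz₀ : ‖z₀‖ < ε) :
    ∀ᶠ p : (Tiling P × Tiling P) × E d in 𝓝 ((T₀, T₀), z₀),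
      tilingDist p.1.1 (p.1.2.translate p.2) < ε := by
  obtain ⟨δ, hδ, h⟩ := exists_tilingDist_translate_lt T₀ hz₀
  have hb := (hasBasis_nhds_tiling T₀).mem_of_mem hδ
  have h1 : ∀ᶠ p : (Tiling P × Tiling P) × E d in 𝓝 ((T₀, T₀), z₀), Close (1 / δ) δ T₀ p.1.1 :=
    ((continuous_fst.comp continuous_fst).tendsto ((T₀, T₀), z₀)).eventually hb
  have h2 : ∀ᶠ p : (Tiling P × Tiling P) × E d in 𝓝 ((T₀, T₀), z₀), Close (1 / δ) δ T₀ p.1.2 :=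
    ((continuous_snd.comp continuous_fst).tendsto ((T₀, T₀), z₀)).eventually hb
  have h3 := (continuous_snd.tendsto ((T₀, T₀), z₀)).eventually (ball_mem_nhds z₀ hδ)
  filter_upwards [h1, h2, h3] with p hp1 hp2 hp3
  exact h _ _ _ hp1 hp2 (by rwa [← dist_eq_norm])

end

/-! ### Continuous actions of Euclidean space and their lifts -/

section

variable {d : ℕ}

/-- The periods of every point form a discrete group. -/
def HasDiscretePeriods (d : ℕ) (X : Type*) [AddAction (E d) X] : Prop :=
  ∀ x : X, ∃ r > 0, ∀ v : E d, v +ᵥ x = x → ‖v‖ < r → v = 0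

/-- Locally, connected sets lie in orbits, and the displacement along the orbit is the difference of
the values of a continuous function. -/
def HasLocalCocycles (d : ℕ) (X : Type*) [TopologicalSpace X] [AddAction (E d) X] : Prop :=
  ∀ x₀ : X, ∃ N ∈ 𝓝 x₀, ∃ c : X → E d, ContinuousOn c N ∧
    ∀ C ⊆ N, IsPreconnected C → ∀ x ∈ C, ∀ y ∈ C, y = (c x - c y) +ᵥ x

theorem vadd_comm' {X : Type*} [AddAction (E d) X] (v w : E d) (x : X) :
    v +ᵥ (w +ᵥ x) = w +ᵥ (v +ᵥ x) := by
  rw [vadd_vadd, vadd_vadd, add_comm]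

theorem HasDiscretePeriods.isDiscrete {X : Type*} [AddAction (E d) X]
    (h : HasDiscretePeriods d X) (x : X) :
    IsDiscrete (AddAction.stabilizer (E d) x : Set (E d)) := by
  obtain ⟨r, hr, h⟩ := h x
  refine ⟨discreteTopology_of_isOpen_singleton_zero ?_⟩
  have : ({0} : Set (AddAction.stabilizer (E d) x)) =
      {v : AddAction.stabilizer (E d) x | ‖(v : E d)‖ < r} := by
    ext v
    simp only [mem_singleton_iff, mem_ofPred_eq]
    refine ⟨?_, fun hv => Subtype.ext (h v v.2 hv)⟩
    rintro rfl
    simpa using hr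
  rw [this]
  exact isOpen_lt (by fun_prop) continuous_const

/-- A map from `ℝ^d` that moves locally along orbits moves along one orbit, by a continuous
displacement: it induces a continuous map to the quotient of `ℝ^d` by the period group, which lifts
to the covering space `ℝ^d`. -/
theorem exists_lift {X : Type*} [AddAction (E d) X] (hX : HasDiscretePeriods d X) (γ : E d → X)
    (hloc : ∀ v₀, ∃ h : E d → E d, ContinuousAt h v₀ ∧ ∀ᶠ v in 𝓝 v₀, γ v = h v +ᵥ γ v₀) :
    ∃ H : E d → E d, Continuous H ∧ H 0 = 0 ∧ ∀ v, γ v = H v +ᵥ γ 0 := by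
  have horb : ∀ v, ∃ w : E d, γ v = w +ᵥ γ 0 := by
    have hclopen : IsClopen {v | ∃ w : E d, γ v = w +ᵥ γ 0} := by
      constructor
      · rw [← isOpen_compl_iff, isOpen_iff_mem_nhds]
        intro v₀ hv₀
        obtain ⟨h, -, hh⟩ := hloc v₀
        filter_upwards [hh] with v hv
        rintro ⟨w, hw⟩
        exact hv₀ ⟨-h v + w, by rw [← vadd_vadd, ← hw, hv, neg_vadd_vadd]⟩
      · rw [isOpen_iff_mem_nhds]
        rintro v₀ ⟨w, hw⟩
        obtain ⟨h, -, hh⟩ := hloc v₀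
        filter_upwards [hh] with v hv
        exact ⟨h v + w, by rw [hv, hw, vadd_vadd]⟩
    have := hclopen.eq_univ ⟨0, 0, by simp⟩
    intro v
    exact (this ▸ mem_univ v : v ∈ {v | ∃ w : E d, γ v = w +ᵥ γ 0})
  choose w hw using horb
  set S := AddAction.stabilizer (E d) (γ 0) with hS
  have hmk : ∀ a b : E d, a +ᵥ γ 0 = b +ᵥ γ 0 → (a : E d ⧸ S) = b := by
    intro a b hab
    rw [QuotientAddGroup.eq, hS, AddAction.mem_stabilizer_iff, ← vadd_vadd, ← hab, neg_vadd_vadd]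
  have hcont : Continuous fun v => (w v : E d ⧸ S) := by
    rw [continuous_iff_continuousAt]
    intro v₀
    obtain ⟨h, hc, hh⟩ := hloc v₀
    have h1 : ContinuousAt (fun v => ((h v + w v₀ : E d) : E d ⧸ S)) v₀ :=
      (continuous_quotient_mk'.continuousAt).comp (hc.add continuousAt_const)
    refine h1.congr ?_
    filter_upwards [hh] with v hv
    exact hmk _ _ (by rw [← vadd_vadd, ← hw, ← hv, hw])
  have hcov : IsCoveringMap (QuotientAddGroup.mk (s := S)) :=
    (AddSubgroup.isAddQuotientCoveringMap S (hX.isDiscrete (γ 0))).isCoveringMap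
  obtain ⟨H, ⟨hH0, hH⟩, -⟩ := hcov.existsUnique_continuousMap_lifts ⟨_, hcont⟩ (0 : E d) (0 : E d)
    (hmk _ _ (by rw [zero_vadd, ← hw]))
  refine ⟨H, H.continuous, hH0, fun v => ?_⟩
  have h1 : ((H v : E d) : E d ⧸ S) = (w v : E d ⧸ S) := congrFun hH v
  rw [QuotientAddGroup.eq, hS, AddAction.mem_stabilizer_iff] at h1
  rw [hw v]
  conv_rhs => rw [← h1]
  rw [vadd_vadd]
  congr 1
  abel

theorem eq_zero_of_periods {X : Type*} [AddAction (E d) X] (hX : HasDiscretePeriods d X) (x : X)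
    {u : E d → E d} (hu : Continuous u) (hu0 : u 0 = 0) (hux : ∀ v, u v +ᵥ x = x) (v : E d) :
    u v = 0 := by
  obtain ⟨r, hr, h⟩ := hX x
  have h1 : {v | u v = 0} = {v | ‖u v‖ < r} := by
    ext v
    refine ⟨fun hv => ?_, fun hv => h _ (hux v) hv⟩
    rw [mem_ofPred_eq] at *
    rwa [hv, norm_zero]
  have hclopen : IsClopen {v | u v = 0} :=
    ⟨isClosed_eq hu continuous_const, h1 ▸ isOpen_lt hu.norm continuous_const⟩
  exact (hclopen.eq_univ ⟨0, hu0⟩ ▸ mem_univ v : v ∈ {v | u v = 0})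

variable {X Y : Type*} [TopologicalSpace X] [AddAction (E d) X] [TopologicalSpace Y]
  [AddAction (E d) Y]

/-- A homeomorphism onto a space in which small connected sets lie in orbits maps orbits into
orbits. -/
theorem exists_displacement [ContinuousVAdd (E d) Y] (hX : HasDiscretePeriods d X)
    (hXc : HasLocalCocycles d X) (ψ : Y ≃ₜ X) (y : Y) : ∃ H : E d → E d, Continuous H ∧ H 0 = 0 ∧
      ∀ v, ψ (v +ᵥ y) = H v +ᵥ ψ y := by
  have hγ : Continuous fun v : E d => ψ (v +ᵥ y) :=
    ψ.continuous.comp (continuous_id.vadd continuous_const)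
  obtain ⟨H, hH, hH0, h⟩ := exists_lift hX (fun v => ψ (v +ᵥ y)) (fun v₀ => by
    obtain ⟨N, hN, c, hc, hC⟩ := hXc (ψ (v₀ +ᵥ y))
    refine ⟨fun v => c (ψ (v₀ +ᵥ y)) - c (ψ (v +ᵥ y)), ?_, ?_⟩
    · exact continuousAt_const.sub
        (ContinuousAt.comp (f := fun v : E d => ψ (v +ᵥ y)) (hc.continuousAt hN) hγ.continuousAt)
    · obtain ⟨r, hr, hrN⟩ := Metric.mem_nhds_iff.1 (hγ.continuousAt hN)
      filter_upwards [ball_mem_nhds v₀ hr] with v hv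
      exact hC _ (image_subset_iff.2 hrN) ((convex_ball v₀ r).isPreconnected.image _
        hγ.continuousOn) _ (mem_image_of_mem _ (mem_ball_self hr)) _ (mem_image_of_mem _ hv))
  exact ⟨H, hH, hH0, by simpa using h⟩

/-- If a homeomorphism maps orbits into orbits by continuous displacements, then so does its
inverse: by invariance of domain the displacement is open. -/
theorem exists_displacement_symm (hY : HasDiscretePeriods d Y)
    (ψ : Y ≃ₜ X) (h : ∀ y, ∃ H : E d → E d, Continuous H ∧ H 0 = 0 ∧
      ∀ v, ψ (v +ᵥ y) = H v +ᵥ ψ y) (x : X) :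
    ∃ K : E d → E d, Continuous K ∧ K 0 = 0 ∧ ∀ v, ψ.symm (v +ᵥ x) = K v +ᵥ ψ.symm x := by
  obtain ⟨K, hK, hK0, hK'⟩ := exists_lift hY (fun v => ψ.symm (v +ᵥ x)) (fun w₀ => by
    set y := ψ.symm (w₀ +ᵥ x) with hy
    obtain ⟨H, hH, hH0, hHy⟩ := h y
    obtain ⟨r, hr, hry⟩ := hY y
    have hinj : InjOn H (closedBall 0 (r / 3)) := by
      intro u hu v hv huv
      have h1 : u +ᵥ y = v +ᵥ y := ψ.injective (by rw [hHy, hHy, huv])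
      have h2 : (-v + u) +ᵥ y = y := by rw [← vadd_vadd, h1, neg_vadd_vadd]
      have h3 : ‖-v + u‖ < r := by
        rw [mem_closedBall_zero_iff] at hu hv
        have := norm_add_le (-v) u
        rw [norm_neg] at this
        linarith
      have := hry _ h2 h3
      rw [neg_add_eq_zero] at this
      exact this.symm
    have hnhds : ∀ s : ℝ, 0 < s → s ≤ r / 3 → H '' closedBall 0 s ∈ 𝓝 (0 : E d) := by
      intro s hs hsr
      have := mem_interior_image_closedBall' H 0 hs hH.continuousOn
        (hinj.mono (closedBall_subset_closedBall hsr))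
      rw [hH0] at this
      exact mem_interior_iff_mem_nhds.1 this
    set k := Function.invFunOn H (closedBall 0 (r / 3)) with hk
    have hkH : ∀ u ∈ closedBall (0 : E d) (r / 3), k (H u) = u := fun u hu =>
      hinj.leftInvOn_invFunOn hu
    have hk0 : k 0 = 0 := by
      have := hkH 0 (mem_closedBall_self (by positivity))
      rwa [hH0] at this
    have hkc : ContinuousAt k 0 := by
      rw [ContinuousAt, hk0, Metric.nhds_basis_closedBall.tendsto_right_iff]
      intro ε hε
      have hs : 0 < min ε (r / 3) := by positivity
      filter_upwards [hnhds _ hs (min_le_right _ _)] with w hw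
      obtain ⟨u, hu, rfl⟩ := hw
      rw [hkH u (closedBall_subset_closedBall (min_le_right _ _) hu)]
      exact closedBall_subset_closedBall (min_le_left _ _) hu
    have hsub : ContinuousAt (fun w : E d => w - w₀) w₀ := by fun_prop
    refine ⟨fun w => k (w - w₀), ?_, ?_⟩
    · exact ContinuousAt.comp (f := fun w : E d => w - w₀) (by rwa [sub_self]) hsub
    · have h1 : H '' closedBall 0 (r / 3) ∈ 𝓝 ((fun w : E d => w - w₀) w₀) := by
        simp only [sub_self]
        exact hnhds _ (by positivity) le_rfl
      filter_upwards [hsub h1] with w hw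
      obtain ⟨u, hu, huw⟩ := hw
      simp only at huw
      rw [← huw, hkH u hu, Homeomorph.symm_apply_eq, hHy, huw, hy, Homeomorph.apply_symm_apply,
        vadd_vadd, sub_add_cancel])
  exact ⟨K, hK, hK0, by simpa using hK'⟩

/-- A homeomorphism onto a space in which small connected sets lie in orbits is an orbit
equivalence, given on each orbit by a homeomorphism of `ℝ^d`. -/
theorem exists_homeomorph_displacement [ContinuousVAdd (E d) Y] (hX : HasDiscretePeriods d X)
    (hXc : HasLocalCocycles d X) (hY : HasDiscretePeriods d Y) (ψ : Y ≃ₜ X) (y : Y) :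
    ∃ H : E d ≃ₜ E d, H 0 = 0 ∧ ∀ v, ψ (v +ᵥ y) = H v +ᵥ ψ y := by
  obtain ⟨H, hH, hH0, hHy⟩ := exists_displacement hX hXc ψ y
  obtain ⟨K, hK, hK0, hKx⟩ := exists_displacement_symm hY ψ (exists_displacement hX hXc ψ) (ψ y)
  rw [ψ.symm_apply_apply] at hKx
  have h1 : ∀ v, K (H v) - v = 0 := by
    refine eq_zero_of_periods hY y (by fun_prop) (by simp [hH0, hK0]) fun v => ?_
    have h2 : v +ᵥ y = K (H v) +ᵥ y := by
      rw [← hKx, ← hHy, ψ.symm_apply_apply]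
    rw [sub_eq_neg_add, ← vadd_vadd, ← h2, neg_vadd_vadd]
  have h2 : ∀ w, H (K w) - w = 0 := by
    refine eq_zero_of_periods hX (ψ y) (by fun_prop) (by simp [hH0, hK0]) fun w => ?_
    have h3 : w +ᵥ ψ y = H (K w) +ᵥ ψ y := by
      rw [← hHy, ← hKx, ψ.apply_symm_apply]
    rw [sub_eq_neg_add, ← vadd_vadd, ← h3, neg_vadd_vadd]
  exact ⟨⟨⟨H, K, fun v => sub_eq_zero.1 (h1 v), fun w => sub_eq_zero.1 (h2 w)⟩, hH, hK⟩, hH0, hHy⟩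

end

/-! ### Strong expansivity at all scales -/

section

variable {d : ℕ}

theorem norm_le_sum_abs (v : E d) : ‖v‖ ≤ ∑ i, |v i| := by
  have h := (EuclideanSpace.basisFun (Fin d) ℝ).sum_repr v
  calc ‖v‖ = ‖∑ i, v i • EuclideanSpace.basisFun (Fin d) ℝ i‖ := by
        conv_lhs => rw [← h]
        simp
    _ ≤ ∑ i, ‖v i • EuclideanSpace.basisFun (Fin d) ℝ i‖ := norm_sum_le _ _
    _ = ∑ i, |v i| := by simp [norm_smul]

theorem norm_le_card_mul {v : E d} {c : ℝ} (h : ∀ i, |v i| ≤ c) : ‖v‖ ≤ d * c := by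
  refine (norm_le_sum_abs v).trans ((Finset.sum_le_sum fun i _ => h i).trans ?_)
  simp

theorem abs_apply_le_norm (v : E d) (i : Fin d) : |v i| ≤ ‖v‖ := by
  simpa using PiLp.norm_apply_le v i

/-- The linear map with given images of the standard basis vectors. -/
noncomputable def ofColumns (p : Fin d → E d) : E d →ₗ[ℝ] E d where
  toFun v := ∑ i, v i • p i
  map_add' v w := by simp [add_smul, Finset.sum_add_distrib]
  map_smul' c v := by simp [mul_smul, Finset.smul_sum]

theorem ofColumns_apply (p : Fin d → E d) (v : E d) : ofColumns p v = ∑ i, v i • p i := rfl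

theorem continuous_ofColumns : Continuous fun q : (Fin d → E d) × E d => ofColumns q.1 q.2 := by
  simp only [ofColumns_apply]
  fun_prop

/-- Columns close to a large multiple of the standard basis are linearly independent. -/
theorem ofColumns_injective {p : Fin d → E d} {R : ℝ} (hR : 0 ≤ R)
    (hp : ∀ i, ‖p i - (d * R + 1) • EuclideanSpace.basisFun (Fin d) ℝ i‖ ≤ R) :
    Function.Injective (ofColumns p) := by
  rw [← LinearMap.ker_eq_bot, LinearMap.ker_eq_bot']
  intro v hv
  have h := (EuclideanSpace.basisFun (Fin d) ℝ).sum_repr v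
  have h1 : (d * R + 1) • v =
      -∑ i, v i • (p i - (d * R + 1) • EuclideanSpace.basisFun (Fin d) ℝ i) := by
    simp only [smul_sub, Finset.sum_sub_distrib]
    rw [← ofColumns_apply, hv, zero_sub, neg_neg]
    conv_lhs => rw [← h, Finset.smul_sum]
    refine Finset.sum_congr rfl fun i _ => ?_
    rw [smul_comm]
    simp
  have h2 : (d * R + 1) * ‖v‖ ≤ d * R * ‖v‖ := by
    calc (d * R + 1) * ‖v‖ = ‖(d * R + 1) • v‖ := by
          rw [norm_smul, Real.norm_of_nonneg (by positivity)]
      _ ≤ ∑ i : Fin d, ‖v i • (p i - (d * R + 1) • EuclideanSpace.basisFun (Fin d) ℝ i)‖ := by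
          rw [h1, norm_neg]; exact norm_sum_le _ _
      _ ≤ ∑ i : Fin d, ‖v‖ * R := by
          refine Finset.sum_le_sum fun i _ => ?_
          rw [norm_smul]
          exact mul_le_mul (abs_apply_le_norm v i) (hp i) (norm_nonneg _) (norm_nonneg _)
      _ = d * R * ‖v‖ := by simp; ring
  have h3 : ‖v‖ ≤ 0 := by nlinarith
  exact norm_le_zero_iff.1 h3

/-- The homeomorphism of `ℝ^d` given by an injective linear endomorphism. -/
noncomputable def homeomorphOfInjective (A : E d →ₗ[ℝ] E d) (hA : Function.Injective A) :
    E d ≃ₜ E d :=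
  (LinearEquiv.ofInjectiveEndo A hA).toContinuousLinearEquiv.toHomeomorph

theorem homeomorphOfInjective_apply (A : E d →ₗ[ℝ] E d) (hA : Function.Injective A) (v : E d) :
    homeomorphOfInjective A hA v = A v := rfl

/-- A subgroup that has, in every direction, an element of bounded length with a component bounded
below is relatively dense. -/
theorem exists_mem_norm_sub_le (S : AddSubgroup (E d)) {b c : ℝ} (hc : 0 < c)
    (hS : ∀ u : E d, ‖u‖ = 1 → ∃ p ∈ S, ‖p‖ ≤ b ∧ c ≤ inner ℝ p u) (w : E d) :
    ∃ p ∈ S, ‖p - w‖ ≤ (b ^ 2 + 1) / (2 * c) := by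
  have key : ∀ n : ℕ, ∀ w : E d, ‖w‖ ^ 2 ≤ n → ∃ p ∈ S, ‖p - w‖ ≤ (b ^ 2 + 1) / (2 * c) := by
    intro n
    induction n with
    | zero =>
      intro w hw
      refine ⟨0, S.zero_mem, ?_⟩
      have : ‖w‖ = 0 := by
        have : ‖w‖ ^ 2 = 0 := le_antisymm (by exact_mod_cast hw) (sq_nonneg _)
        exact pow_eq_zero_iff two_ne_zero |>.1 this
      rw [zero_sub, norm_neg, this]
      positivity
    | succ n ih =>
      intro w hw
      rcases le_or_gt ‖w‖ ((b ^ 2 + 1) / (2 * c)) with h | h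
      · exact ⟨0, S.zero_mem, by rwa [zero_sub, norm_neg]⟩
      have hw0 : 0 < ‖w‖ := lt_of_le_of_lt (by positivity) h
      -- subtracting a period in the direction of `w` makes `w` shorter
      obtain ⟨p, hp, hpb, hpc⟩ := hS (‖w‖⁻¹ • w) (by
        rw [norm_smul, norm_inv, norm_norm, inv_mul_cancel₀ hw0.ne'])
      rw [inner_smul_right, le_inv_mul_iff₀ hw0] at hpc
      have h1 : ‖w - p‖ ^ 2 ≤ n := by
        rw [norm_sub_sq_real, real_inner_comm]
        rw [div_lt_iff₀ (by positivity)] at h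
        have h2 : ‖p‖ ^ 2 ≤ b ^ 2 := pow_le_pow_left₀ (norm_nonneg _) hpb 2
        push_cast at hw
        nlinarith
      obtain ⟨p', hp', h'⟩ := ih _ h1
      refine ⟨p' + p, S.add_mem hp' hp, ?_⟩
      convert h' using 2
      abel
  obtain ⟨n, hn⟩ := exists_nat_ge (‖w‖ ^ 2)
  exact key n w hn

theorem stabilizer_vadd_mem {X : Type*} [AddAction (E d) X] (x : X) (w : E d) {v : E d} :
    v +ᵥ (w +ᵥ x) = w +ᵥ x ↔ v +ᵥ x = x := by
  rw [vadd_comm']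
  exact vadd_left_cancel_iff w

variable {X : Type*} [UniformSpace X] [AddAction (E d) X]

/-- The orbits of `x` and `y`, followed at different speeds, stay in `D`. -/
def Shadows (D : Set (X × X)) (x y : X) : Prop :=
  ∃ h : E d ≃ₜ E d, h 0 = 0 ∧ ∀ v : E d, (v +ᵥ x, h v +ᵥ y) ∈ D

theorem exists_entourage_forall_vadd_mem [CompactSpace X] {ε : ℝ} {D : Set (X × X)}
    (hD : ∀ z₀ : E d, ‖z₀‖ < ε → ∀ x : X, ∀ᶠ p : (X × X) × E d in 𝓝 ((x, x), z₀),
      (p.1.1, p.2 +ᵥ p.1.2) ∈ D) {s : ℝ} (hs : s < ε) :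
    ∃ V ∈ 𝓤 X, ∀ a b : X, (a, b) ∈ V → ∀ z : E d, ‖z‖ ≤ s → (a, z +ᵥ b) ∈ D := by
  set O : Set ((X × X) × E d) := interior {p | (p.1.1, p.2 +ᵥ p.1.2) ∈ D} with hO
  have hdiag : IsCompact (diagonal X) := isCompact_diagonal
  obtain ⟨u, v, hu, -, hdu, hbv, huv⟩ := generalized_tube_lemma hdiag
    (isCompact_closedBall (0 : E d) s) (n := O) isOpen_interior (by
      rintro ⟨⟨x, y⟩, z⟩ ⟨hxy, hz⟩
      have hxy' : x = y := hxy
      subst hxy'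
      exact mem_interior_iff_mem_nhds.2 (hD z ((mem_closedBall_zero_iff.1 hz).trans_lt hs) x))
  refine ⟨u, ?_, fun a b hab z hz => ?_⟩
  · rw [← nhdsSet_diagonal_eq_uniformity]
    exact hu.mem_nhdsSet.2 hdu
  · have : ((a, b), z) ∈ O := huv ⟨hab, hbv (mem_closedBall_zero_iff.2 hz)⟩
    exact (interior_subset this : _)

variable [T2Space X] [ContinuousVAdd (E d) X]

/-- Two points with relatively dense periods that are close shadow each other, since there is a
linear map between their period lattices which is close to the identity. This is the form of that
argument for a filter: `x` is the limit of points `f q` with uniformly relatively dense periods. -/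
theorem eventually_shadows {ι : Type*} (𝒰 : Ultrafilter ι) (f : ι → X) (x : X)
    (hf : Tendsto f 𝒰 (𝓝 x)) {D : Set (X × X)} (hD : D ∈ 𝓤 X) {R : ℝ} (hR : 0 ≤ R)
    (hper : ∀ᶠ q in 𝒰, ∀ w : E d, ∃ p : E d, p +ᵥ f q = f q ∧ ‖p - w‖ ≤ R) :
    ∀ᶠ q in 𝒰, Shadows (d := d) D x (f q) := by
  set e : Fin d → E d := fun i => (d * R + 1) • EuclideanSpace.basisFun (Fin d) ℝ i with he
  -- periods of `f q` close to the vectors `e i`, and their limits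
  have hex : ∀ q : ι, ∃ p : Fin d → E d,
      (∀ w : E d, ∃ p : E d, p +ᵥ f q = f q ∧ ‖p - w‖ ≤ R) →
        ∀ i, p i +ᵥ f q = f q ∧ ‖p i - e i‖ ≤ R := by
    intro q
    by_cases h : ∀ w : E d, ∃ p : E d, p +ᵥ f q = f q ∧ ‖p - w‖ ≤ R
    · choose p hp using fun i => h (e i)
      exact ⟨p, fun _ => hp⟩
    · exact ⟨0, fun h' => absurd h' h⟩
  choose p hp using hex
  have hp' : ∀ᶠ q in 𝒰, ∀ i, p q i +ᵥ f q = f q ∧ ‖p q i - e i‖ ≤ R := hper.mono fun q => hp q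
  have hK : IsCompact (Set.pi univ fun i => closedBall (e i) R) :=
    isCompact_univ_pi fun i => isCompact_closedBall _ _
  obtain ⟨p₀, hp₀, hlim⟩ := hK.ultrafilter_le_nhds (𝒰.map p) (by
    rw [le_principal_iff]
    change p ⁻¹' _ ∈ 𝒰
    filter_upwards [hp'] with q hq i _
    rw [mem_closedBall, dist_eq_norm]
    exact (hq i).2)
  have hlim' : Tendsto p 𝒰 (𝓝 p₀) := hlim
  have hp₀x : ∀ i, p₀ i +ᵥ x = x := by
    intro i
    have h1 : Tendsto (fun q => p q i +ᵥ f q) 𝒰 (𝓝 (p₀ i +ᵥ x)) :=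
      ((tendsto_pi_nhds.1 hlim' i)).vadd hf
    exact tendsto_nhds_unique h1 (hf.congr' (hp'.mono fun q hq => ((hq i).1).symm))
  have hinj₀ : Function.Injective (ofColumns p₀) := ofColumns_injective hR fun i => by
    rw [← dist_eq_norm]; exact hp₀ i trivial
  -- integral combinations of periods are periods
  have hint : ∀ (p : Fin d → E d) (y : X), (∀ i, p i +ᵥ y = y) → ∀ v : E d,
      ofColumns p v +ᵥ y = ofColumns p (WithLp.toLp 2 fun i => Int.fract (v i)) +ᵥ y := by
    intro p y hpy v
    have hv : v = WithLp.toLp 2 (fun i => Int.fract (v i)) +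
        WithLp.toLp 2 (fun i => ((⌊v i⌋ : ℤ) : ℝ)) := by
      ext i; simp
    conv_lhs => rw [hv]
    rw [map_add, ← vadd_vadd]
    congr 1
    have hmem : ofColumns p (WithLp.toLp 2 fun i => ((⌊v i⌋ : ℤ) : ℝ)) ∈
        AddAction.stabilizer (E d) y := by
      rw [ofColumns_apply]
      refine AddSubgroup.sum_mem _ fun i _ => ?_
      have : ((⌊v i⌋ : ℤ) : ℝ) • p i = ⌊v i⌋ • p i :=
        Int.cast_smul_eq_zsmul ℝ _ _
      simp only [this]
      exact AddSubgroup.zsmul_mem _ (hpy i) _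
    exact hmem
  have hclose : ∀ᶠ z : (Fin d → E d) × X in 𝓝 (p₀, x), ∀ v ∈ closedBall (0 : E d) d,
      (ofColumns p₀ v +ᵥ x, ofColumns z.1 v +ᵥ z.2) ∈ D := by
    refine (isCompact_closedBall (0 : E d) d).eventually_forall_of_forall_eventually fun v _ => ?_
    have hc : Continuous fun z : ((Fin d → E d) × X) × E d =>
        (ofColumns p₀ z.2 +ᵥ x, ofColumns z.1.1 z.2 +ᵥ z.1.2) := by
      refine Continuous.prodMk ?_ ?_
      · exact (continuous_ofColumns.comp (continuous_const.prodMk continuous_snd)).vadd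
          continuous_const
      · exact (continuous_ofColumns.comp ((continuous_fst.comp continuous_fst).prodMk
          continuous_snd)).vadd (continuous_snd.comp continuous_fst)
    exact (hc.tendsto ((p₀, x), v)).eventually (nhds_le_uniformity _ hD)
  filter_upwards [(hlim'.prodMk_nhds hf).eventually hclose, hp'] with q hq hpq
  have hinj : Function.Injective (ofColumns (p q)) := ofColumns_injective hR fun i => (hpq i).2
  refine ⟨(homeomorphOfInjective _ hinj₀).symm.trans (homeomorphOfInjective _ hinj), ?_,
    fun v => ?_⟩
  · have h0 : (homeomorphOfInjective _ hinj₀).symm 0 = 0 := by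
      rw [Homeomorph.symm_apply_eq, homeomorphOfInjective_apply, map_zero]
    rw [Homeomorph.trans_apply, h0, homeomorphOfInjective_apply, map_zero]
  · obtain ⟨w, rfl⟩ := (homeomorphOfInjective _ hinj₀).surjective v
    rw [Homeomorph.trans_apply, Homeomorph.symm_apply_apply, homeomorphOfInjective_apply,
      homeomorphOfInjective_apply, hint p₀ x hp₀x w, hint (p q) (f q) (fun i => (hpq i).1) w]
    refine hq _ ?_
    rw [mem_closedBall_zero_iff]
    have := norm_le_card_mul (v := WithLp.toLp 2 fun i => Int.fract (w i)) (c := 1) fun i => by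
      simp only
      rw [abs_of_nonneg (Int.fract_nonneg _)]
      exact (Int.fract_lt_one _).le
    simpa using this

/-- The constant in strong expansivity can be made as small as one likes, if the closeness of the
orbits is adapted. Suppose that `x` and `y` shadow each other very closely, but `x = v + y` only for
vectors `v` of length at least `r`. For all vectors `z` that are a little shorter than `ε`, strong
expansivity applies to `x` and `z + y`, so `x = v + y` for some `v` in the ball of radius `ε` around
`z`. This yields periods of bounded length in every direction, and hence relatively dense periods.
Any two such points that are close shadow each other, so they lie in the same orbit and have the
same periods. In the limit one gets a period close to `v`, a contradiction. -/
theorem exists_entourage_of_stronglyExpansive [CompactSpace X] {ε : ℝ} (hε : 0 < ε)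
    {D : Set (X × X)}
    (hD : ∀ z₀ : E d, ‖z₀‖ < ε → ∀ x : X, ∀ᶠ p : (X × X) × E d in 𝓝 ((x, x), z₀),
      (p.1.1, p.2 +ᵥ p.1.2) ∈ D)
    (hexp : ∀ x y : X, Shadows (d := d) D x y → ∃ v : E d, ‖v‖ < ε ∧ x = v +ᵥ y)
    {r : ℝ} (hr : 0 < r) :
    ∃ V ∈ 𝓤 X, ∀ x y : X, Shadows (d := d) V x y → ∃ v : E d, ‖v‖ < r ∧ x = v +ᵥ y := by
  by_contra hcon
  push Not at hcon
  -- a filter on the pairs which violate the claim for smaller and smaller entourages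
  set B : Set (X × X) → Set (X × X) := fun V =>
    {q | Shadows (d := d) V q.1 q.2 ∧ ∀ v : E d, ‖v‖ < r → q.1 ≠ v +ᵥ q.2} with hB
  have hBmono : Monotone B := fun V W hVW q hq =>
    ⟨by obtain ⟨h, h0, hh⟩ := hq.1; exact ⟨h, h0, fun v => hVW (hh v)⟩, hq.2⟩
  have hne : ((𝓤 X).lift' B).NeBot := by
    rw [lift'_neBot_iff hBmono]
    intro V hV
    obtain ⟨x, y, hs, hxy⟩ := hcon V hV
    exact ⟨(x, y), hs, hxy⟩
  set 𝒰 := Ultrafilter.of ((𝓤 X).lift' B) with h𝒰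
  have hBmem : ∀ V ∈ 𝓤 X, ∀ᶠ q in 𝒰, q ∈ B V := fun V hV =>
    Ultrafilter.of_le _ (mem_lift' hV)
  set κ := min (ε / 2) (r ^ 2 / (4 * ε)) with hκ
  have hκ0 : 0 < κ := by positivity
  have hκ1 : κ ≤ ε / 2 := min_le_left _ _
  have hκ2 : κ * (4 * ε) ≤ r ^ 2 := by
    rw [← le_div_iff₀ (by positivity)]; exact min_le_right _ _
  obtain ⟨V, hV, hVD⟩ := exists_entourage_forall_vadd_mem hD (by linarith : ε - κ < ε)
  -- strong expansivity for `x` and `z + y`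
  have hz : ∀ q ∈ B V, ∀ z : E d, ‖z‖ ≤ ε - κ → ∃ v : E d, ‖v - z‖ < ε ∧ q.1 = v +ᵥ q.2 := by
    rintro ⟨x, y⟩ ⟨⟨h, h0, hh⟩, -⟩ z hz
    obtain ⟨v, hv, hxv⟩ := hexp x (z +ᵥ y) ⟨h, h0, fun v => by
      rw [vadd_comm']; exact hVD _ _ (hh v) z hz⟩
    exact ⟨v + z, by rwa [add_sub_cancel_right], by rw [← vadd_vadd]; exact hxv⟩
  have hdir : ∀ q ∈ B V, ∀ u : E d, ‖u‖ = 1 → ∃ v : E d, ‖v‖ ≤ 2 * ε ∧ q.1 = v +ᵥ q.2 ∧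
      r ^ 2 / (4 * ε) ≤ inner ℝ v u := by
    intro q hq u hu
    have hnz : ‖(ε - κ) • u‖ = ε - κ := by
      rw [norm_smul, hu, mul_one, Real.norm_of_nonneg (by linarith)]
    obtain ⟨v, hv, hqv⟩ := hz q hq ((ε - κ) • u) hnz.le
    have h1 : ‖v‖ ≤ 2 * ε := by
      have := norm_add_le (v - (ε - κ) • u) ((ε - κ) • u)
      rw [sub_add_cancel] at this
      linarith
    have h2 : r ≤ ‖v‖ := by
      by_contra hlt
      exact hq.2 v (not_le.1 hlt) hqv
    have h3 : ‖v - (ε - κ) • u‖ ^ 2 ≤ ε ^ 2 := pow_le_pow_left₀ (norm_nonneg _) hv.le 2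
    rw [norm_sub_sq_real, hnz, inner_smul_right] at h3
    have h4 : r ^ 2 ≤ ‖v‖ ^ 2 := pow_le_pow_left₀ hr.le h2 2
    have h5 : r ^ 2 / 2 ≤ 2 * (ε - κ) * inner ℝ v u := by nlinarith
    refine ⟨v, h1, hqv, ?_⟩
    have h6 : 0 ≤ inner ℝ v u := by
      by_contra hneg
      push Not at hneg
      have : 0 < r ^ 2 := by positivity
      nlinarith
    rw [div_le_iff₀ (by positivity)]
    nlinarith
  set b := 4 * ε
  set c := 2 * (r ^ 2 / (4 * ε)) with hc
  have hc0 : 0 < c := by positivity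
  set R := (b ^ 2 + 1) / (2 * c) with hR
  have hper : ∀ q ∈ B V, ∀ w : E d, ∃ p : E d, p +ᵥ q.1 = q.1 ∧ ‖p - w‖ ≤ R := by
    intro q hq w
    refine exists_mem_norm_sub_le (AddAction.stabilizer (E d) q.1) hc0 (fun u hu => ?_) w
    obtain ⟨v, hv, hqv, hvu⟩ := hdir q hq u hu
    obtain ⟨v', hv', hqv', hvu'⟩ := hdir q hq (-u) (by rwa [norm_neg])
    rw [inner_neg_right] at hvu'
    refine ⟨v - v', ?_, (norm_sub_le _ _).trans (by linarith), ?_⟩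
    · rw [AddAction.mem_stabilizer_iff, hqv, stabilizer_vadd_mem, sub_eq_neg_add, ← vadd_vadd,
        ← hqv, hqv', neg_vadd_vadd]
    · rw [inner_sub_left]
      linarith
  -- the limits of the two points agree
  obtain ⟨x, -, hx⟩ := isCompact_univ.ultrafilter_le_nhds (𝒰.map Prod.fst) (by simp)
  have hx1 : Tendsto (Prod.fst : X × X → X) 𝒰 (𝓝 x) := hx
  have hx2 : Tendsto (Prod.snd : X × X → X) 𝒰 (𝓝 x) := by
    have : Tendsto (fun q : X × X => (q.1, q.2)) 𝒰 (𝓤 X) := fun W hW => by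
      filter_upwards [hBmem W hW] with q hq
      obtain ⟨h, h0, hh⟩ := hq.1
      simpa [h0] using hh 0
    exact hx1.congr_uniformity this
  obtain ⟨V₁, hV₁, hV₁D⟩ := exists_entourage_forall_vadd_mem hD hε
  have hD𝓤 : D ∈ 𝓤 X := mem_of_superset hV₁ fun q hq => by
    simpa using hV₁D q.1 q.2 hq 0 (by simp)
  have hshadow := eventually_shadows 𝒰 Prod.fst x hx1 hD𝓤 (R := R) (by positivity)
    ((hBmem V hV).mono fun q hq => hper q hq)
  -- the displacements converge to a period
  have hex : ∀ q : X × X, ∃ v : E d, q ∈ B V → ‖v‖ ≤ ε ∧ q.1 = v +ᵥ q.2 := by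
    intro q
    by_cases hq : q ∈ B V
    · obtain ⟨v, hv, hqv⟩ := hz q hq 0 (by rw [norm_zero]; linarith)
      exact ⟨v, fun _ => ⟨by rw [sub_zero] at hv; exact hv.le, hqv⟩⟩
    · exact ⟨0, fun h => absurd h hq⟩
  choose v hv using hex
  obtain ⟨v₀, -, hv₀⟩ := (isCompact_closedBall (0 : E d) ε).ultrafilter_le_nhds (𝒰.map v) (by
    rw [le_principal_iff]
    change v ⁻¹' _ ∈ 𝒰
    filter_upwards [hBmem V hV] with q hq
    exact mem_closedBall_zero_iff.2 (hv q hq).1)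
  have hvlim : Tendsto v 𝒰 (𝓝 v₀) := hv₀
  have hv₀x : v₀ +ᵥ x = x := tendsto_nhds_unique (hvlim.vadd hx2)
    (hx1.congr' ((hBmem V hV).mono fun q hq => (hv q hq).2))
  have hsmall : ∀ᶠ q in 𝒰, ‖v q - v₀‖ < r := by
    filter_upwards [hvlim.eventually (ball_mem_nhds v₀ hr)] with q hq
    rw [← dist_eq_norm]; exact hq
  obtain ⟨q, hq, hqs, hqv⟩ := ((hBmem V hV).and (hshadow.and hsmall)).exists
  obtain ⟨w, -, hxw⟩ := hexp _ _ hqs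
  rw [hxw, stabilizer_vadd_mem, (hv q hq).2, stabilizer_vadd_mem] at hv₀x
  refine hq.2 (v q - v₀) hqv ?_
  rw [sub_eq_add_neg, ← vadd_vadd, neg_vadd_eq_iff.2 hv₀x.symm]
  exact (hv q hq).2

end

/-! ### Control points and local product structure -/

section

section

variable {d : ℕ}

/-- The corner of a set: the vector of the suprema of the coordinates. For compact sets it commutes
with translations and is Lipschitz for the Hausdorff distance. -/
noncomputable def corner (K : Set (E d)) : E d :=
  WithLp.toLp 2 fun i => sSup ((fun x : E d => x i) '' K)

theorem corner_apply (K : Set (E d)) (i : Fin d) : corner K i = sSup ((fun x : E d => x i) '' K) :=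
  rfl

theorem continuous_coord (i : Fin d) : Continuous fun x : E d => x i := by fun_prop

theorem corner_translateSet {K : Set (E d)} (hK : IsCompact K) (hne : K.Nonempty) (x : E d) :
    corner (translateSet K x) = corner K - x := by
  ext i
  rw [PiLp.sub_apply, corner_apply, corner_apply, translateSet, image_image]
  have hbdd := (hK.image (continuous_coord i)).bddAbove
  have := Monotone.map_csSup_of_continuousAt (f := fun y : ℝ => y - x i)
    (by fun_prop : ContinuousAt (fun y : ℝ => y - x i) _)
    (fun a b h => sub_le_sub_right h _) (hne.image (fun x : E d => x i)) hbdd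
  rw [this, image_image]
  rfl

theorem corner_apply_le {K K' : Set (E d)} (hK : IsCompact K) (hK' : IsCompact K')
    (hne : K.Nonempty) (hne' : K'.Nonempty) (i : Fin d) :
    corner K i ≤ corner K' i + hausdorffDist K K' := by
  rw [corner_apply, corner_apply]
  refine csSup_le (hne.image _) ?_
  rintro _ ⟨x, hx, rfl⟩
  obtain ⟨y, hy, hxy⟩ := exists_dist_le_of_hausdorffDist_le hK hK' hne' le_rfl hx
  have h1 : y i ≤ sSup ((fun x : E d => x i) '' K') :=
    le_csSup (hK'.image (continuous_coord i)).bddAbove (mem_image_of_mem _ hy)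
  have h2 := abs_apply_le_norm (x - y) i
  rw [PiLp.sub_apply, ← dist_eq_norm] at h2
  linarith [le_abs_self (x i - y i)]

theorem norm_corner_sub_le {K K' : Set (E d)} (hK : IsCompact K) (hK' : IsCompact K')
    (hne : K.Nonempty) (hne' : K'.Nonempty) :
    ‖corner K - corner K'‖ ≤ d * hausdorffDist K K' := by
  refine norm_le_card_mul fun i => ?_
  rw [PiLp.sub_apply, abs_sub_le_iff]
  have h1 := corner_apply_le hK hK' hne hne' i
  have h2 := corner_apply_le hK' hK hne' hne i
  rw [hausdorffDist_comm] at h2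
  constructor <;> linarith

end

variable {d : ℕ} {L : Type*} [MetricSpace L] {P : PrototileSet d L}

/-- The control point of a tile: the translation that carries it to its prototile, read off from the
corners of the supports. -/
noncomputable def control (P : PrototileSet d L) (t : Tile d L) : E d :=
  corner t.supp - corner (P.shape t.label : Set (E d))

theorem IsTile.translate_control {t : Tile d L} (h : IsTile P t) :
    t.translate (control P t) = P.proto t.label := by
  obtain ⟨l, x, rfl⟩ := h
  have : control P ((P.proto l).translate x) = -x := by
    have := corner_translateSet (P.shape l).isCompact (P.shape l).nonempty x
    simp only [control, Tile.translate, PrototileSet.proto, this]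
    abel
  rw [this, translate_translate, add_neg_cancel, Tile.translate_zero]
  rfl

theorem IsTile.exists_control_near {t : Tile d L} (h : IsTile P t) {ε : ℝ} (hε : 0 < ε) :
    ∃ η > 0, ∀ t', IsTile P t' → tileDist t t' < η → ‖control P t - control P t'‖ < ε := by
  obtain ⟨δ, hδ, hδε⟩ := Metric.continuousAt_iff.1
    (P.continuous_shape.continuousAt (x := t.label)) (ε / (2 * (d + 1))) (by positivity)
  refine ⟨min δ (ε / (2 * (d + 1))), by positivity, fun t' h' ht => ?_⟩
  have h1 : dist t'.label t.label < δ := by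
    rw [dist_comm]
    exact (le_max_right _ _).trans_lt (ht.trans_le (min_le_left _ _))
  have h2 := hδε h1
  rw [NonemptyCompacts.dist_eq, hausdorffDist_comm] at h2
  have h3 : hausdorffDist t.supp t'.supp < ε / (2 * (d + 1)) :=
    (le_max_left _ _).trans_lt (ht.trans_le (min_le_right _ _))
  have h4 := norm_corner_sub_le h.isCompact h'.isCompact h.nonempty h'.nonempty
  have h5 := norm_corner_sub_le (P.shape t.label).isCompact (P.shape t'.label).isCompact
    (P.shape t.label).nonempty (P.shape t'.label).nonempty
  have h6 : control P t - control P t' = (corner t.supp - corner t'.supp) -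
      (corner (P.shape t.label : Set (E d)) - corner (P.shape t'.label : Set (E d))) := by
    simp only [control]; abel
  have hd : (0 : ℝ) ≤ d := Nat.cast_nonneg d
  have h7 : (d : ℝ) * (ε / (2 * (d + 1))) < ε / 2 := by
    have : (d : ℝ) * (ε / (2 * (d + 1))) = ε / 2 * (d / (d + 1)) := by field_simp
    rw [this]
    exact mul_lt_of_lt_one_right (half_pos hε) ((div_lt_one (by positivity)).2 (by linarith))
  rw [h6]
  calc _ ≤ _ := norm_sub_le _ _
    _ ≤ d * hausdorffDist t.supp t'.supp + d * hausdorffDist (P.shape t.label : Set (E d))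
        (P.shape t'.label) := add_le_add h4 h5
    _ ≤ d * (ε / (2 * (d + 1))) + d * (ε / (2 * (d + 1))) := by gcongr
    _ < ε := by linarith

theorem IsTile.eq_zero_of_translate_eq {t : Tile d L} (h : IsTile P t) {v : E d}
    (hv : translateSet t.supp v = t.supp) : v = 0 := by
  have := corner_translateSet h.isCompact h.nonempty v
  rw [hv] at this
  exact sub_eq_self.1 this.symm

/-- A tile of a tiling has positive distance from all other tiles of the tiling. -/
theorem Tiling.exists_isolated (T : Tiling P) {t₀ : Tile d L} (ht₀ : t₀ ∈ T.tiles) :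
    ∃ σ, 0 < σ ∧ σ ≤ 1 ∧ ∀ t ∈ T.tiles, tileDist t₀ t < σ → t = t₀ := by
  obtain ⟨x, hx⟩ := (T.isTile ht₀).nonempty
  have hm : (t₀.supp ∩ closedBall 0 ‖x‖).Nonempty := ⟨x, hx, by simp⟩
  have hfin := ((T.locally_finite (‖x‖ + 1)).subset (sdiff_subset (t := {t₀}))).image (tileDist t₀)
  have h0 : (0 : ℝ) ∉ tileDist t₀ '' ({t ∈ T.tiles | (t.supp ∩ closedBall 0 (‖x‖ + 1)).Nonempty}
      \ {t₀}) := by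
    rintro ⟨t, ⟨ht, hne⟩, h0⟩
    exact hne (eq_of_tileDist_eq_zero (T.isTile ht₀) (T.isTile ht.1) h0).symm
  obtain ⟨σ, hσ, h⟩ := Metric.nhds_basis_ball.mem_iff.1 (hfin.isClosed.isOpen_compl.mem_nhds h0)
  refine ⟨min σ 1, by positivity, min_le_right _ _, fun t ht hlt => ?_⟩
  by_contra hne
  refine h (mem_ball_zero_iff.2 ?_) (mem_image_of_mem _ ⟨⟨ht, ?_⟩, hne⟩)
  · rw [Real.norm_of_nonneg (tileDist_nonneg _ _)]
    exact hlt.trans_le (min_le_left _ _)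
  · exact meets_of_tileDist_le (T.isTile ht₀) (T.isTile ht) (hlt.le.trans (min_le_right _ _))
      le_rfl hm

/-- A tile of a tiling can be followed continuously to the nearby tilings. -/
theorem Tiling.exists_local_section (T₀ : Tiling P) {t₀ : Tile d L} (ht₀ : t₀ ∈ T₀.tiles) :
    ∃ N ∈ 𝓝 T₀, ∃ s : Tiling P → Tile d L, (∀ T ∈ N, s T ∈ T.tiles) ∧
      ∀ T ∈ N, ∀ ε > 0, ∀ᶠ T' in 𝓝[N] T, tileDist (s T) (s T') < ε := by
  obtain ⟨σ, hσ, hσ1, hiso⟩ := T₀.exists_isolated ht₀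
  obtain ⟨x, hx⟩ := (T₀.isTile ht₀).nonempty
  have ht₀' := T₀.isTile ht₀
  have hm : (t₀.supp ∩ closedBall 0 ‖x‖).Nonempty := ⟨x, hx, by simp⟩
  set δ := min (σ / 4) (1 / (‖x‖ + 1)) with hδ
  have hδ0 : 0 < δ := by positivity
  have hδσ : δ ≤ σ / 4 := min_le_left _ _
  have hδr : ‖x‖ + 1 ≤ 1 / δ := by
    rw [le_one_div (by positivity) hδ0]; exact min_le_right _ _
  set N : Set (Tiling P) := {T | Close (1 / δ) δ T₀ T} with hN
  have hmr : ∀ {T : Tiling P} {t}, t ∈ T.tiles → tileDist t₀ t ≤ σ / 2 →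
      (t.supp ∩ closedBall 0 (‖x‖ + 1)).Nonempty := fun ht h =>
    meets_of_tileDist_le ht₀' (Tiling.isTile _ ht) (h.trans (by linarith : σ / 2 ≤ 1)) le_rfl hm
  have huniq : ∀ T ∈ N, ∃ t ∈ T.tiles, tileDist t₀ t ≤ δ ∧
      ∀ t' ∈ T.tiles, tileDist t₀ t' ≤ σ / 2 → t' = t := by
    rintro T ⟨M, hM⟩
    obtain ⟨t, ht⟩ := hM.total ht₀ (hm.mono (inter_subset_inter_right _
      (closedBall_subset_closedBall (by linarith))))
    refine ⟨t, hM.right ht, hM.near ht, fun t' ht' h => ?_⟩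
    obtain ⟨t₁, ht₁⟩ := hM.cototal ht' ((hmr ht' h).mono (inter_subset_inter_right _
      (closedBall_subset_closedBall hδr)))
    have h1 := hM.near ht₁
    have h2 := tileDist_triangle (t'' := t₁) ht₀' (T.isTile ht')
    rw [tileDist_comm t' t₁] at h2
    have h3 := hiso t₁ (hM.left ht₁) (by linarith)
    subst h3
    exact hM.fn ht₁ ht
  have hex : ∀ T : Tiling P, ∃ t, T ∈ N → t ∈ T.tiles ∧ tileDist t₀ t ≤ δ ∧
      ∀ t' ∈ T.tiles, tileDist t₀ t' ≤ σ / 2 → t' = t := by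
    intro T
    by_cases hT : T ∈ N
    · obtain ⟨t, ht⟩ := huniq T hT
      exact ⟨t, fun _ => ht⟩
    · exact ⟨t₀, fun h => absurd h hT⟩
  choose s hs using hex
  refine ⟨N, (hasBasis_nhds_tiling T₀).mem_of_mem hδ0, s, fun T hT => (hs T hT).1,
    fun T hT ε hε => ?_⟩
  have hη0 : 0 < min (min (ε / 2) (σ / 4)) δ := by positivity
  set η := min (min (ε / 2) (σ / 4)) δ with hη
  filter_upwards [mem_nhdsWithin_of_mem_nhds ((hasBasis_nhds_tiling T).mem_of_mem hη0),
    self_mem_nhdsWithin] with T' hT' hT'N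
  obtain ⟨M, hM⟩ := hT'
  obtain ⟨h1, h2, -⟩ := hs T hT
  have hηδ : 1 / δ ≤ 1 / η := one_div_le_one_div_of_le hη0 (min_le_right _ _)
  obtain ⟨t', ht'⟩ := hM.total h1 ((hmr h1 (by linarith)).mono (inter_subset_inter_right _
    (closedBall_subset_closedBall (by linarith))))
  have h3 := hM.near ht'
  have h4 : η ≤ σ / 4 := (min_le_left _ _).trans (min_le_right _ _)
  have h5 : η ≤ ε / 2 := (min_le_left _ _).trans (min_le_left _ _)
  have h6 := tileDist_triangle (t'' := t') ht₀' (T.isTile h1)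
  rw [← (hs T' hT'N).2.2 t' (hM.right ht') (by linarith)]
  linarith

instance : AddAction (E d) (Tiling P) where
  vadd v T := T.translate v
  zero_vadd _ := Tiling.translate_zero
  add_vadd v w T := by
    change T.translate (v + w) = (T.translate w).translate v
    rw [Tiling.translate_add, add_comm]

theorem Tiling.vadd_def (v : E d) (T : Tiling P) : v +ᵥ T = T.translate v := rfl

instance : ContinuousVAdd (E d) (Tiling P) :=
  ⟨Tiling.continuous_translate.comp continuous_swap⟩

theorem Tiling.hasDiscretePeriods : HasDiscretePeriods d (Tiling P) := by
  intro T
  obtain ⟨t, ht, -⟩ := T.exists_mem_supp 0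
  obtain ⟨σ, hσ, -, hiso⟩ := T.exists_isolated ht
  refine ⟨σ, hσ, fun v hv hvσ => ?_⟩
  have h1 : t.translate v ∈ T.tiles := by
    have h := Tiling.translate_mem_translate ht v
    rwa [← Tiling.vadd_def, hv] at h
  have h2 := tileDist_translate_le (T.isTile ht) (T.isTile ht) 0 v
  rw [tileDist_self, Tile.translate_zero, zero_sub, norm_neg, zero_add] at h2
  exact (T.isTile ht).eq_zero_of_translate_eq
    (congrArg Tile.supp (hiso _ h1 (h2.trans_lt hvσ)))

/-- Translation acts on a tiling space. -/
abbrev IsTilingSpace.addAction {Ω : Set (Tiling P)} (hΩ : IsTilingSpace Ω) : AddAction (E d) Ω where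
  vadd v T := ⟨v +ᵥ (T : Tiling P), hΩ.translate_mem T T.2 v⟩
  zero_vadd T := Subtype.ext (zero_vadd _ (T : Tiling P))
  add_vadd v w T := Subtype.ext (add_vadd v w (T : Tiling P))

theorem IsTilingSpace.continuousVAdd {Ω : Set (Tiling P)} (hΩ : IsTilingSpace Ω) :
    letI := hΩ.addAction
    ContinuousVAdd (E d) Ω := by
  let := hΩ.addAction
  exact ⟨Continuous.subtype_mk (continuous_fst.vadd (continuous_subtype_val.comp continuous_snd)) _⟩

theorem IsTilingSpace.hasDiscretePeriods {Ω : Set (Tiling P)} (hΩ : IsTilingSpace Ω) :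
    letI := hΩ.addAction
    HasDiscretePeriods d Ω := by
  let := hΩ.addAction
  intro T
  obtain ⟨r, hr, h⟩ := Tiling.hasDiscretePeriods (T : Tiling P)
  exact ⟨r, hr, fun v hv => h v (congrArg Subtype.val hv)⟩

/-- Moving the control point of a tile to the origin maps a small connected set of tilings into
the transversal. If the transversal is totally disconnected, the image is a point. -/
theorem IsTilingSpace.hasLocalCocycles {Ω : Set (Tiling P)} (hΩ : IsTilingSpace Ω)
    (hdisc : IsTotallyDisconnected (transversal Ω)) :
    letI := hΩ.addAction
    HasLocalCocycles d Ω := by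
  let := hΩ.addAction
  intro T₀
  obtain ⟨t₀, ht₀, -⟩ := (T₀ : Tiling P).exists_mem_supp 0
  obtain ⟨N, hN, s, hs, hsc⟩ := (T₀ : Tiling P).exists_local_section ht₀
  have hc : ContinuousOn (fun T => control P (s T)) N := by
    intro T hT
    rw [ContinuousWithinAt, Metric.tendsto_nhds]
    intro ε hε
    obtain ⟨η, hη, h⟩ := (T.isTile (hs T hT)).exists_control_near hε
    filter_upwards [hsc T hT η hη, self_mem_nhdsWithin] with T' hT' hT'N
    rw [dist_comm, dist_eq_norm]
    exact h _ (T'.isTile (hs T' hT'N)) hT'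
  refine ⟨Subtype.val ⁻¹' N, continuous_subtype_val.continuousAt hN,
    fun T => control P (s T), hc.comp continuous_subtype_val.continuousOn (fun T hT => hT), ?_⟩
  intro C hC hCpre T hT T' hT'
  set τ : Ω → Tiling P := fun T => (T : Tiling P).translate (control P (s T)) with hτ
  have hτc : ContinuousOn τ C := by
    refine Tiling.continuous_translate.comp_continuousOn
      (continuous_subtype_val.continuousOn.prodMk ?_)
    exact (hc.comp continuous_subtype_val.continuousOn (fun T hT => hT)).mono hC
  have hτmem : τ '' C ⊆ transversal Ω := by
    rintro _ ⟨S, hS, rfl⟩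
    refine ⟨hΩ.translate_mem _ S.2 _, (s S).label, ?_⟩
    rw [← ((S : Tiling P).isTile (hs S (hC hS))).translate_control]
    exact Tiling.translate_mem_translate (hs S (hC hS)) _
  have h := hdisc _ hτmem (hCpre.image τ hτc) (mem_image_of_mem τ hT) (mem_image_of_mem τ hT')
  refine Subtype.ext ?_
  change (T' : Tiling P) = (T : Tiling P).translate _
  rw [sub_eq_add_neg, ← Tiling.translate_add]
  exact Tiling.translate_neg_eq h

end

/-! ### Shapes up to translation -/

section

section

variable {d : ℕ}

theorem translateSet_injective (x : E d) :
    Function.Injective fun K : Set (E d) => translateSet K x :=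
  image_injective.2 sub_left_injective

theorem isCompact_translateSet {K : Set (E d)} (hK : IsCompact K) (x : E d) :
    IsCompact (translateSet K x) :=
  hK.image (continuous_id.sub continuous_const)

theorem nonempty_translateSet {K : Set (E d)} (hK : K.Nonempty) (x : E d) :
    (translateSet K x).Nonempty :=
  hK.image _

theorem interior_translateSet (K : Set (E d)) (x : E d) :
    interior (translateSet K x) = translateSet (interior K) x :=
  ((Homeomorph.subRight x).image_interior K).symm

/-- The translate of a set whose corner is the origin. -/
noncomputable def normalize (K : Set (E d)) : Set (E d) := translateSet K (corner K)

theorem normalize_translateSet {K : Set (E d)} (hK : IsCompact K) (hne : K.Nonempty) (x : E d) :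
    normalize (translateSet K x) = normalize K := by
  rw [normalize, corner_translateSet hK hne, translateSet_translateSet, normalize,
    add_sub_cancel]

theorem hausdorffDist_normalize_le {K K' : Set (E d)} (hK : IsCompact K) (hK' : IsCompact K')
    (hne : K.Nonempty) (hne' : K'.Nonempty) :
    hausdorffDist (normalize K) (normalize K') ≤ (1 + d) * hausdorffDist K K' := by
  have h1 := hausdorffDist_translateSet_le hK hK' hne hne' (corner K) (corner K')
  have h2 := norm_corner_sub_le hK hK' hne hne'
  rw [normalize, normalize]
  linarith

/-- A point of a set, chosen compatibly with translations. -/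
noncomputable def anchor (K : Set (E d)) : E d :=
  corner K + Classical.epsilon fun x => x ∈ normalize K

theorem anchor_mem {K : Set (E d)} (hne : K.Nonempty) : anchor K ∈ K := by
  have h : Classical.epsilon (fun x => x ∈ normalize K) ∈ normalize K :=
    Classical.epsilon_spec (nonempty_translateSet hne _)
  rw [normalize, mem_translateSet, add_comm] at h
  exact h

theorem anchor_translateSet {K : Set (E d)} (hK : IsCompact K) (hne : K.Nonempty) (x : E d) :
    anchor (translateSet K x) = anchor K - x := by
  rw [anchor, anchor, normalize_translateSet hK hne, corner_translateSet hK hne]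
  abel

/-- The translate of a set whose anchor is the origin. It represents the set up to translation. -/
noncomputable def shapeOf (K : Set (E d)) : Set (E d) := translateSet K (anchor K)

theorem shapeOf_translateSet {K : Set (E d)} (hK : IsCompact K) (hne : K.Nonempty) (x : E d) :
    shapeOf (translateSet K x) = shapeOf K := by
  rw [shapeOf, anchor_translateSet hK hne, translateSet_translateSet, shapeOf, add_sub_cancel]

theorem zero_mem_shapeOf {K : Set (E d)} (hne : K.Nonempty) : (0 : E d) ∈ shapeOf K := by
  rw [shapeOf, mem_translateSet, zero_add]
  exact anchor_mem hne

theorem translateSet_shapeOf (K : Set (E d)) : translateSet (shapeOf K) (-anchor K) = K := by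
  rw [shapeOf, translateSet_translateSet, add_neg_cancel, translateSet_zero]

theorem anchor_shapeOf {K : Set (E d)} (hK : IsCompact K) (hne : K.Nonempty) :
    anchor (shapeOf K) = 0 := by
  rw [shapeOf, anchor_translateSet hK hne, sub_self]

theorem normalize_shapeOf {K : Set (E d)} (hK : IsCompact K) (hne : K.Nonempty) :
    normalize (shapeOf K) = normalize K :=
  normalize_translateSet hK hne _

theorem shapeOf_eq_of_normalize_eq {K K' : Set (E d)} (h : normalize K = normalize K') :
    shapeOf K = shapeOf K' := by
  have key : ∀ K : Set (E d), shapeOf K =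
      translateSet (normalize K) (Classical.epsilon fun x => x ∈ normalize K) := fun K => by
    rw [shapeOf, anchor, normalize, translateSet_translateSet]
  rw [key, key, h]

theorem normalize_eq_of_hausdorffDist_eq_zero {K K' : Set (E d)} (hK : IsCompact K)
    (hK' : IsCompact K') (hne : K.Nonempty) (hne' : K'.Nonempty)
    (h : hausdorffDist (normalize K) (normalize K') = 0) : normalize K = normalize K' :=
  ((isCompact_translateSet hK _).isClosed.hausdorffDist_zero_iff_eq
    (isCompact_translateSet hK' _).isClosed (hausdorffEDist_ne_top_of_compact
      (isCompact_translateSet hK _) (isCompact_translateSet hK' _) (nonempty_translateSet hne _)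
      (nonempty_translateSet hne' _))).1 h

theorem eq_translateSet_of_shapeOf_eq {K K' : Set (E d)} (hK : IsCompact K) (hne : K.Nonempty)
    (h : shapeOf K = shapeOf K') : K' = translateSet K (corner K - corner K') := by
  have h1 : K' = translateSet K (anchor K - anchor K') := by
    conv_lhs => rw [← translateSet_shapeOf K', ← h, shapeOf, translateSet_translateSet,
      ← sub_eq_add_neg]
  have h2 : corner K' = corner K - (anchor K - anchor K') := by
    conv_lhs => rw [h1]
    exact corner_translateSet hK hne _
  rw [h2, sub_sub_cancel]
  exact h1

/-- Finitely many shapes have positive mutual distances. -/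
theorem exists_shapeOf_eq {𝒮 : Set (Set (E d))} (hfin : 𝒮.Finite)
    (h𝒮 : ∀ S ∈ 𝒮, IsCompact S ∧ S.Nonempty) :
    ∃ σ > 0, ∀ K K' : Set (E d), IsCompact K → IsCompact K' → K.Nonempty → K'.Nonempty →
      shapeOf K ∈ 𝒮 → shapeOf K' ∈ 𝒮 → hausdorffDist K K' < σ → shapeOf K = shapeOf K' := by
  have h0 : (0 : ℝ) ∉ (fun p : Set (E d) × Set (E d) => hausdorffDist (normalize p.1)
      (normalize p.2)) '' {p | p ∈ 𝒮 ×ˢ 𝒮 ∧ normalize p.1 ≠ normalize p.2} := by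
    rintro ⟨⟨S, S'⟩, ⟨⟨hS, hS'⟩, hne⟩, h⟩
    exact hne (normalize_eq_of_hausdorffDist_eq_zero (h𝒮 S hS).1 (h𝒮 S' hS').1 (h𝒮 S hS).2
      (h𝒮 S' hS').2 h)
  obtain ⟨σ, hσ, h⟩ := Metric.nhds_basis_ball.mem_iff.1
    ((((hfin.prod hfin).subset fun p hp => hp.1).image _).isClosed.isOpen_compl.mem_nhds h0)
  refine ⟨σ / (1 + d), by positivity, fun K K' hK hK' hne hne' hS hS' hlt => ?_⟩
  refine shapeOf_eq_of_normalize_eq ?_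
  by_contra hneq
  refine h (mem_ball_zero_iff.2 ?_) ⟨(shapeOf K, shapeOf K'), ⟨⟨hS, hS'⟩, ?_⟩, rfl⟩
  · dsimp only
    rw [normalize_shapeOf hK hne, normalize_shapeOf hK' hne',
      Real.norm_of_nonneg hausdorffDist_nonneg]
    refine (hausdorffDist_normalize_le hK hK' hne hne').trans_lt ?_
    rwa [lt_div_iff₀' (by positivity)] at hlt
  · rwa [normalize_shapeOf hK hne, normalize_shapeOf hK' hne']

/-- A limit of sets with finitely many shapes has one of these shapes. -/
theorem shapeOf_mem_of_forall_exists {𝒮 : Set (Set (E d))} (hfin : 𝒮.Finite)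
    {K : Set (E d)} (hK : IsCompact K) (hne : K.Nonempty)
    (h : ∀ ε > 0, ∃ K', IsCompact K' ∧ K'.Nonempty ∧ shapeOf K' ∈ 𝒮 ∧ hausdorffDist K K' < ε) :
    shapeOf K ∈ 𝒮 := by
  have h0 : (0 : ℝ) ∈ (fun S : Set (E d) => hausdorffDist (normalize K) (normalize S)) ''
      {S | S ∈ 𝒮 ∧ ∃ K', IsCompact K' ∧ K'.Nonempty ∧ shapeOf K' = S} := by
    rw [← (((hfin.subset fun p hp => hp.1).image _).isClosed (X := ℝ)).closure_eq,
      Metric.mem_closure_iff]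
    intro ε hε
    obtain ⟨K', hK', hne', hS, hlt⟩ := h (ε / (1 + d)) (by positivity)
    refine ⟨_, mem_image_of_mem _ ⟨hS, K', hK', hne', rfl⟩, ?_⟩
    rw [dist_zero_left, Real.norm_of_nonneg hausdorffDist_nonneg, normalize_shapeOf hK' hne']
    refine (hausdorffDist_normalize_le hK hK' hne hne').trans_lt ?_
    rwa [lt_div_iff₀' (by positivity)] at hlt
  obtain ⟨_, ⟨hS, K', hK', hne', rfl⟩, h0⟩ := h0
  dsimp only at h0
  rw [normalize_shapeOf hK' hne'] at h0
  rwa [shapeOf_eq_of_normalize_eq (normalize_eq_of_hausdorffDist_eq_zero hK hK' hne hne' h0)]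

theorem exists_ball_subset_of_finite {𝒮 : Set (Set (E d))} (hfin : 𝒮.Finite)
    (h𝒮 : ∀ S ∈ 𝒮, (interior S).Nonempty) : ∃ δ > 0, ∀ S ∈ 𝒮, ∃ c, ball c δ ⊆ S := by
  have h : ∀ S, ∃ δ > 0, S ∈ 𝒮 → ∃ c, ball c δ ⊆ S := by
    intro S
    by_cases hS : S ∈ 𝒮
    · obtain ⟨c, hc⟩ := h𝒮 S hS
      obtain ⟨δ, hδ, hb⟩ := Metric.mem_nhds_iff.1 (mem_interior_iff_mem_nhds.1 hc)
      exact ⟨δ, hδ, fun _ => ⟨c, hb⟩⟩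
    · exact ⟨1, one_pos, fun h => absurd h hS⟩
  choose δ hδ h using h
  rcases 𝒮.eq_empty_or_nonempty with rfl | hne
  · exact ⟨1, one_pos, fun S hS => absurd hS (notMem_empty S)⟩
  obtain ⟨S₀, hS₀, hmin⟩ := exists_min_image 𝒮 δ hfin hne
  exact ⟨δ S₀, hδ S₀, fun S hS => (h S hS).imp fun c hc => (ball_subset_ball (hmin S hS)).trans hc⟩

theorem mem_translateSet_of_ball_subset {K : Set (E d)} {c a : E d} {δ : ℝ} (h : ball c δ ⊆ K)
    (ha : ‖a‖ < δ) : c ∈ translateSet K a := by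
  rw [mem_translateSet]
  exact h (by simpa [mem_ball, dist_eq_norm] using ha)

end

section

variable {d : ℕ} {L : Type*} [MetricSpace L] {P : PrototileSet d L}

theorem IsTile.interior_nonempty {t : Tile d L} (h : IsTile P t) : (interior t.supp).Nonempty := by
  obtain ⟨x, hx⟩ := h.nonempty
  exact closure_nonempty_iff.1 ⟨x, h.subset_closure_interior hx⟩

/-- The shapes of the tiles of a family of tilings. -/
def shapes (Ω : Set (Tiling P)) : Set (Set (E d)) :=
  {S | ∃ T ∈ Ω, ∃ t ∈ T.tiles, shapeOf t.supp = S}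

theorem exists_isTile_of_mem_shapes {Ω : Set (Tiling P)} {S : Set (E d)} (hS : S ∈ shapes Ω) :
    ∃ t, IsTile P t ∧ shapeOf t.supp = t.supp ∧ t.supp = S := by
  obtain ⟨T, -, t, ht, rfl⟩ := hS
  have h := T.isTile ht
  exact ⟨t.translate (anchor t.supp), h.translate _,
    shapeOf_translateSet h.isCompact h.nonempty _, rfl⟩

/-- Two tiles of the given finitely many shapes that are close overlap. -/
theorem exists_mem_interior_of_hausdorffDist_lt {Ω : Set (Tiling P)} (hfin : (shapes Ω).Finite) :
    ∃ σ > 0, ∀ t t' : Tile d L, IsTile P t → IsTile P t' → shapeOf t.supp ∈ shapes Ω →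
      shapeOf t'.supp ∈ shapes Ω → hausdorffDist t.supp t'.supp < σ →
      ∃ x, x ∈ interior t.supp ∧ x ∈ t'.supp := by
  have hS : ∀ S ∈ shapes Ω, IsCompact S ∧ S.Nonempty ∧ (interior S).Nonempty := by
    intro S hS
    obtain ⟨t, ht, -, rfl⟩ := exists_isTile_of_mem_shapes hS
    exact ⟨ht.isCompact, ht.nonempty, ht.interior_nonempty⟩
  obtain ⟨σ, hσ, h⟩ := exists_shapeOf_eq hfin fun S h => ⟨(hS S h).1, (hS S h).2.1⟩
  obtain ⟨δ, hδ, hb⟩ := exists_ball_subset_of_finite hfin fun S h => (hS S h).2.2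
  refine ⟨min σ (δ / (1 + d)), by positivity, fun t t' ht ht' hm hm' hlt => ?_⟩
  have h1 := h _ _ ht.isCompact ht'.isCompact ht.nonempty ht'.nonempty hm hm'
    (hlt.trans_le (min_le_left _ _))
  have h2 := eq_translateSet_of_shapeOf_eq ht.isCompact ht.nonempty h1
  obtain ⟨c, hc⟩ := hb _ hm
  have hc' : ball (c + anchor t.supp) δ ⊆ t.supp := by
    intro x hx
    have : x - anchor t.supp ∈ shapeOf t.supp := hc (by
      rw [mem_ball, dist_eq_norm] at hx ⊢
      convert hx using 2
      abel)
    rw [shapeOf, mem_translateSet, sub_add_cancel] at this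
    exact this
  refine ⟨c + anchor t.supp, interior_maximal hc' isOpen_ball (mem_ball_self hδ), ?_⟩
  rw [h2]
  refine mem_translateSet_of_ball_subset hc' ?_
  have h3 := norm_corner_sub_le ht.isCompact ht'.isCompact ht.nonempty ht'.nonempty
  have h4 := hlt.trans_le (min_le_right _ _)
  rw [lt_div_iff₀' (by positivity)] at h4
  have h5 : (0 : ℝ) ≤ hausdorffDist t.supp t'.supp := hausdorffDist_nonneg
  linarith

theorem Tiling.exists_neighbour (hd : 1 ≤ d) (T : Tiling P) {t : Tile d L} (ht : t ∈ T.tiles) :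
    ∃ t' ∈ T.tiles, t' ≠ t ∧ (t.supp ∩ t'.supp).Nonempty := by
  have ht' := T.isTile ht
  have hNT : Nontrivial (E d) := by
    have : Nonempty (Fin d) := ⟨⟨0, hd⟩⟩
    exact Module.nontrivial_of_finrank_pos (R := ℝ) (by rw [finrank_euclideanSpace_fin]; exact hd)
  have huniv : t.supp ≠ univ := fun h => noncompact_univ (E d) (h ▸ ht'.isCompact)
  obtain ⟨x, hx⟩ := nonempty_frontier_iff.2 ⟨ht'.nonempty, huniv⟩
  have hfin : ({s ∈ T.tiles | (s.supp ∩ closedBall x 1).Nonempty} \ {t}).Finite :=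
    (T.finite_meeting isBounded_closedBall).sdiff
  have hcl : IsClosed (⋃ s ∈ {s ∈ T.tiles | (s.supp ∩ closedBall x 1).Nonempty} \ {t}, s.supp) :=
    hfin.isClosed_biUnion fun s hs => (T.isTile hs.1.1).isCompact.isClosed
  by_cases hxC : x ∈ ⋃ s ∈ {s ∈ T.tiles | (s.supp ∩ closedBall x 1).Nonempty} \ {t}, s.supp
  · obtain ⟨s, hs, hxs⟩ := mem_iUnion₂.1 hxC
    exact ⟨s, hs.1.1, hs.2, x, ht'.isCompact.isClosed.frontier_subset hx, hxs⟩
  · refine absurd (mem_interior_iff_mem_nhds.2 ?_) hx.2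
    filter_upwards [hcl.isOpen_compl.mem_nhds hxC, closedBall_mem_nhds x one_pos] with y hy hyx
    obtain ⟨s, hs, hys⟩ := T.exists_mem_supp y
    by_cases hst : s = t
    · exact hst ▸ hys
    · exact absurd (mem_iUnion₂.2 ⟨s, ⟨⟨hs, y, hys, hyx⟩, hst⟩, hys⟩) hy

theorem Tiling.isPatch_pair (T : Tiling P) {t t' : Tile d L} (ht : t ∈ T.tiles) (ht' : t' ∈ T.tiles)
    (h : (t.supp ∩ t'.supp).Nonempty) : IsPatch P {t, t'} where
  equiv_proto s hs := T.isTile (by rcases hs with rfl | rfl <;> assumption)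
  boundary s hs s' hs' := T.isPatch.boundary s (by rcases hs with rfl | rfl <;> assumption) s'
    (by rcases hs' with rfl | rfl <;> assumption)
  connected := by
    have : patchSupp {t, t'} = t.supp ∪ t'.supp := by simp [patchSupp]
    rw [this]
    exact (T.isTile ht).isConnected.union h (T.isTile ht').isConnected

/-- If the tilings have finitely many pairs of adjacent supports up to translation, then they have
finitely many shapes, since every tile has a neighbour. -/
theorem HasFinitelyManyTwoTileShapes.finite_shapes (hd : 1 ≤ d) {Ω : Set (Tiling P)}
    (h : HasFinitelyManyTwoTileShapes Ω) : (shapes Ω).Finite := by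
  obtain ⟨F, hF, h⟩ := h
  have hfin : (shapeOf '' ⋃₀ {B | B ∈ F ∧ B.Finite}).Finite :=
    ((hF.subset fun B hB => hB.1).sUnion fun B hB => hB.2).image _
  refine hfin.subset ?_
  rintro _ ⟨T, hT, t, ht, rfl⟩
  obtain ⟨t', ht', hne, hm⟩ := T.exists_neighbour hd ht
  obtain ⟨B, hB, x, hx⟩ := h {t, t'} ⟨encard_pair hne.symm, T.isPatch_pair ht ht' hm, T, hT, by
    rintro s (rfl | rfl) <;> assumption⟩
  have hBfin : B.Finite := by
    refine Finite.of_finite_image (f := fun S => translateSet S x) ?_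
      (translateSet_injective x).injOn
    rw [← hx]
    exact (toFinite _).image _
  obtain ⟨S, hS, hSt⟩ : t.supp ∈ (fun S => translateSet S x) '' B :=
    hx ▸ mem_image_of_mem _ (by simp)
  have hS' : S = translateSet t.supp (-x) := by
    rw [← hSt, translateSet_translateSet, add_neg_cancel, translateSet_zero]
  refine ⟨S, ⟨B, ⟨hB, hBfin⟩, hS⟩, ?_⟩
  rw [hS', shapeOf_translateSet (T.isTile ht).isCompact (T.isTile ht).nonempty]

end

end

/-! ### Compactness of tiling spaces with finitely many shapes -/

section

variable {d : ℕ} {L : Type*} [MetricSpace L] {P : PrototileSet d L}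

theorem inter_subset_frontier_of_disjoint_interior {K K' : Set (E d)}
    (hK : K ⊆ closure (interior K))
    (hK' : K' ⊆ closure (interior K')) (h : Disjoint (interior K) (interior K')) :
    K ∩ K' ⊆ frontier K ∩ frontier K' := by
  have key : ∀ {K K' : Set (E d)}, K' ⊆ closure (interior K') →
      Disjoint (interior K) (interior K') → K ∩ K' ⊆ frontier K := fun hK' h x hx =>
    ⟨subset_closure hx.1, fun hxi => disjoint_left.1
      (h.closure_right isOpen_interior) hxi (hK' hx.2)⟩
  exact fun x hx => ⟨key hK' h hx, key hK h.symm hx.symm⟩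

/-- By compactness of the label space, the prototiles lie in one ball. -/
theorem PrototileSet.exists_norm_le [CompactSpace L] (P : PrototileSet d L) :
    ∃ D : ℝ, 0 ≤ D ∧ ∀ l, ∀ x ∈ P.shape l, ‖x‖ ≤ D := by
  obtain ⟨D, hD⟩ := (isCompact_range P.continuous_shape).isBounded.subset_closedBall
    ({0} : TopologicalSpace.NonemptyCompacts (E d))
  refine ⟨max D 0, le_max_right _ _, fun l x hx => ?_⟩
  have h := hD (mem_range_self l)
  rw [mem_closedBall, NonemptyCompacts.dist_eq] at h
  obtain ⟨y, hy, hxy⟩ := exists_dist_le_of_hausdorffDist_le (P.shape l).isCompact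
    (TopologicalSpace.NonemptyCompacts.isCompact _) (TopologicalSpace.NonemptyCompacts.nonempty _)
    h hx
  have : y = 0 := by simpa using hy
  rw [this, dist_zero_right] at hxy
  exact hxy.trans (le_max_left _ _)

/-- Tiles that meet a bounded region have a limit along every ultrafilter. -/
theorem exists_limit_tile [CompactSpace L] {ι : Type*} (𝔉 : Ultrafilter ι) {s : ι → Tile d L}
    {c : E d} {r : ℝ} (hs : ∀ᶠ i in (𝔉 : Filter ι), IsTile P (s i) ∧
      ((s i).supp ∩ closedBall c r).Nonempty) :
    ∃ t, IsTile P t ∧ (t.supp ∩ closedBall c r).Nonempty ∧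
      ∀ ε > 0, ∀ᶠ i in (𝔉 : Filter ι), tileDist t (s i) < ε := by
  obtain ⟨D, hD0, hD⟩ := P.exists_norm_le
  have hp : ∀ i, ∃ p : L × E d, (IsTile P (s i) ∧ ((s i).supp ∩ closedBall c r).Nonempty) →
      s i = (P.proto p.1).translate p.2 ∧ ‖p.2‖ ≤ r + ‖c‖ + D := by
    intro i
    by_cases h : IsTile P (s i) ∧ ((s i).supp ∩ closedBall c r).Nonempty
    · obtain ⟨⟨l, x, hlx⟩, h2⟩ := h
      refine ⟨(l, x), fun _ => ⟨hlx, ?_⟩⟩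
      rw [hlx] at h2
      obtain ⟨_, ⟨y, hy, rfl⟩, hyc⟩ := h2
      have h3 := closedBall_subset_closedBall_zero c r hyc
      rw [mem_closedBall_zero_iff] at h3
      calc ‖x‖ = ‖y - (y - x)‖ := by rw [sub_sub_cancel]
        _ ≤ ‖y‖ + ‖y - x‖ := norm_sub_le _ _
        _ ≤ r + ‖c‖ + D := by linarith [hD l y hy]
    · exact ⟨((s i).label, 0), fun h' => absurd h' h⟩
  choose p hp using hp
  have hcpt : IsCompact ((univ : Set L) ×ˢ closedBall (0 : E d) (r + ‖c‖ + D)) :=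
    isCompact_univ.prod (isCompact_closedBall _ _)
  obtain ⟨⟨l, x⟩, -, hlim⟩ := hcpt.ultrafilter_le_nhds (𝔉.map p) (by
    rw [le_principal_iff, Ultrafilter.coe_map, mem_map]
    filter_upwards [hs] with i hi
    exact ⟨trivial, mem_closedBall_zero_iff.2 (hp i hi).2⟩)
  have hlim' : Tendsto p 𝔉 (𝓝 (l, x)) := hlim
  have hε : ∀ ε > 0, ∀ᶠ i in (𝔉 : Filter ι), tileDist ((P.proto l).translate x) (s i) < ε := by
    intro ε hε
    have h1 : Tendsto (fun i => max (dist (P.shape l) (P.shape (p i).1)) (dist l (p i).1) +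
        ‖x - (p i).2‖) 𝔉 (𝓝 0) := by
      have hc : Continuous fun q : L × E d =>
          max (dist (P.shape l) (P.shape q.1)) (dist l q.1) + ‖x - q.2‖ := by
        have := P.continuous_shape
        fun_prop
      have := (hc.tendsto (l, x)).comp hlim'
      simpa [Function.comp_def] using this
    filter_upwards [hs, h1.eventually_lt_const hε] with i hi hlt
    rw [(hp i hi).1]
    refine (tileDist_translate_le ⟨l, 0, (Tile.translate_zero _).symm⟩
      ⟨(p i).1, 0, (Tile.translate_zero _).symm⟩ _ _).trans_lt ?_
    exact hlt
  refine ⟨(P.proto l).translate x, ⟨l, x, rfl⟩, ?_, hε⟩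
  have ht : IsTile P ((P.proto l).translate x) := ⟨l, x, rfl⟩
  rw [← infDist_le_iff_of_isCompact ht.isCompact ht.nonempty]
  refine le_of_forall_pos_le_add fun ε hε0 => ?_
  obtain ⟨i, hi, hlt⟩ := (hs.and (hε ε hε0)).exists
  have h1 := hi.1
  obtain ⟨z, hz, hzc⟩ := hi.2
  obtain ⟨y, hy, hzy⟩ := exists_dist_le_of_hausdorffDist_le h1.isCompact ht.isCompact ht.nonempty
    (η := ε) (by rw [hausdorffDist_comm]; exact (le_max_left _ _).trans hlt.le) hz
  calc _ ≤ dist c y := infDist_le_dist_of_mem hy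
    _ ≤ dist c z + dist z y := dist_triangle _ _ _
    _ ≤ r + ε := add_le_add (by rwa [dist_comm]) hzy

/-- The tiles that are limits of tiles along a filter on the space of tilings. -/
def limitTiles (𝔉 : Filter (Tiling P)) : Set (Tile d L) :=
  {t | IsTile P t ∧ ∀ ε > 0, ∀ᶠ T in 𝔉, ∃ s ∈ (T : Tiling P).tiles, tileDist t s < ε}

theorem exists_mem_limitTiles [CompactSpace L] {𝔉 : Ultrafilter (Tiling P)}
    {s : Tiling P → Tile d L} {c : E d} {r : ℝ}
    (hs : ∀ᶠ T in (𝔉 : Filter (Tiling P)), s T ∈ T.tiles ∧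
      ((s T).supp ∩ closedBall c r).Nonempty) :
    ∃ t ∈ limitTiles (𝔉 : Filter (Tiling P)), (t.supp ∩ closedBall c r).Nonempty ∧
      ∀ ε > 0, ∀ᶠ T in (𝔉 : Filter (Tiling P)), tileDist t (s T) < ε := by
  obtain ⟨t, ht, hm, hε⟩ := exists_limit_tile (P := P) 𝔉
    (hs.mono fun T hT => ⟨T.isTile hT.1, hT.2⟩)
  refine ⟨t, ⟨ht, fun ε hε0 => ?_⟩, hm, hε⟩
  filter_upwards [hs, hε ε hε0] with T hT hlt
  exact ⟨s T, hT.1, hlt⟩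

variable {Ω : Set (Tiling P)} {𝔉 : Ultrafilter (Tiling P)}

theorem shapeOf_mem_shapes_of_mem_limitTiles (hfin : (shapes Ω).Finite)
    (hΩ : Ω ∈ (𝔉 : Filter (Tiling P))) {t : Tile d L}
    (ht : t ∈ limitTiles (𝔉 : Filter (Tiling P))) : shapeOf t.supp ∈ shapes Ω := by
  refine shapeOf_mem_of_forall_exists hfin ht.1.isCompact ht.1.nonempty fun ε hε => ?_
  obtain ⟨T, ⟨s, hs, hlt⟩, hT⟩ := ((ht.2 ε hε).and hΩ).exists
  exact ⟨s.supp, (T.isTile hs).isCompact, (T.isTile hs).nonempty, ⟨T, hT, s, hs, rfl⟩,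
    (le_max_left _ _).trans_lt hlt⟩

/-- Limit tiles that overlap are equal, since nearby tiles of the same shapes overlap. -/
theorem eq_of_mem_limitTiles (hfin : (shapes Ω).Finite) (hΩ : Ω ∈ (𝔉 : Filter (Tiling P)))
    {t t' : Tile d L} (ht : t ∈ limitTiles (𝔉 : Filter (Tiling P)))
    (ht' : t' ∈ limitTiles (𝔉 : Filter (Tiling P))) {x : E d} (hx : x ∈ interior t.supp)
    (hx' : x ∈ interior t'.supp) : t = t' := by
  have hS := shapeOf_mem_shapes_of_mem_limitTiles hfin hΩ ht
  have hS' := shapeOf_mem_shapes_of_mem_limitTiles hfin hΩ ht'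
  obtain ⟨σ, hσ, hrig⟩ := exists_shapeOf_eq hfin fun S hS => by
    obtain ⟨t, ht, -, rfl⟩ := exists_isTile_of_mem_shapes hS
    exact ⟨ht.isCompact, ht.nonempty⟩
  obtain ⟨δ, hδ, hb⟩ := Metric.mem_nhds_iff.1
    ((isOpen_interior.inter isOpen_interior).mem_nhds ⟨hx, hx'⟩)
  refine eq_of_tileDist_eq_zero ht.1 ht'.1 (le_antisymm ?_ (tileDist_nonneg _ _))
  refine le_of_forall_pos_le_add fun ε hε => ?_
  have hη : 0 < min (min σ (ε / 2)) (δ / (1 + d)) := by positivity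
  obtain ⟨T, ⟨⟨s, hs, hts⟩, ⟨s', hs', hts'⟩⟩, hT⟩ :=
    (((ht.2 _ hη).and (ht'.2 _ hη)).and hΩ).exists
  have key : ∀ {t s : Tile d L}, IsTile P t → s ∈ T.tiles → shapeOf t.supp ∈ shapes Ω →
      ball x δ ⊆ interior t.supp → tileDist t s < min (min σ (ε / 2)) (δ / (1 + d)) →
      x ∈ interior s.supp := by
    intro t s ht hs hS hb hlt
    have hs' := T.isTile hs
    have hlt' := (le_max_left _ _).trans_lt hlt
    have h1 := hrig _ _ ht.isCompact hs'.isCompact ht.nonempty hs'.nonempty hS ⟨T, hT, s, hs, rfl⟩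
      (hlt'.trans_le ((min_le_left _ _).trans (min_le_left _ _)))
    rw [eq_translateSet_of_shapeOf_eq ht.isCompact ht.nonempty h1, interior_translateSet]
    refine mem_translateSet_of_ball_subset hb ?_
    have h3 := norm_corner_sub_le ht.isCompact hs'.isCompact ht.nonempty hs'.nonempty
    have h4 := hlt'.trans_le (min_le_right _ _)
    rw [lt_div_iff₀' (by positivity)] at h4
    have h5 : (0 : ℝ) ≤ hausdorffDist t.supp s.supp := hausdorffDist_nonneg
    linarith
  have hss : s = s' := Tiling.eq_of_mem_interior hs hs'
    (key ht.1 hs hS (fun y hy => (hb hy).1) hts)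
    (interior_subset (key ht'.1 hs' hS' (fun y hy => (hb hy).2) hts'))
  subst hss
  have h1 := tileDist_triangle (t'' := t') ht.1 (T.isTile hs)
  rw [tileDist_comm s t'] at h1
  have h2 : min (min σ (ε / 2)) (δ / (1 + d)) ≤ ε / 2 := (min_le_left _ _).trans (min_le_right _ _)
  linarith

/-- The limit tiles form a tiling. -/
theorem exists_tiling_limitTiles [CompactSpace L] (hfin : (shapes Ω).Finite)
    (hΩ : Ω ∈ (𝔉 : Filter (Tiling P))) :
    ∃ T : Tiling P, T.tiles = limitTiles (𝔉 : Filter (Tiling P)) := by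
  have hcov : patchSupp (limitTiles (𝔉 : Filter (Tiling P))) = univ := by
    refine eq_univ_of_forall fun x => ?_
    choose s hs hsx using fun T : Tiling P => T.exists_mem_supp x
    obtain ⟨t, ht, ⟨y, hy, hyx⟩, -⟩ := exists_mem_limitTiles (𝔉 := 𝔉) (s := s) (c := x) (r := 0)
      (Eventually.of_forall fun T => ⟨hs T, x, hsx T, by simp⟩)
    rw [closedBall_zero, mem_singleton_iff] at hyx
    exact mem_iUnion₂.2 ⟨t, ht, hyx ▸ hy⟩
  have hbd : ∀ t ∈ limitTiles (𝔉 : Filter (Tiling P)), ∀ t' ∈ limitTiles (𝔉 : Filter (Tiling P)),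
      t ≠ t' → t.supp ∩ t'.supp ⊆ frontier t.supp ∩ frontier t'.supp := fun t ht t' ht' hne =>
    inter_subset_frontier_of_disjoint_interior ht.1.subset_closure_interior
      ht'.1.subset_closure_interior
      (disjoint_left.2 fun x hx hx' => hne (eq_of_mem_limitTiles hfin hΩ ht ht' hx hx'))
  refine ⟨⟨limitTiles (𝔉 : Filter (Tiling P)), ⟨fun t ht => ht.1, hbd, ?_⟩, hcov, fun r => ?_⟩, rfl⟩
  · rw [hcov]
    exact isConnected_univ
  -- an infinite set of tiles meeting a ball would contain tiles of the same shape that are close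
  obtain ⟨σ, hσ, hsep⟩ := exists_mem_interior_of_hausdorffDist_lt hfin
  obtain ⟨D, hD0, hD⟩ := P.exists_norm_le
  have hbdd : ∀ t, IsTile P t → (t.supp ∩ closedBall 0 r).Nonempty →
      anchor t.supp ∈ closedBall (0 : E d) (r + (D + D)) := by
    rintro t ht ⟨y, hy, hyr⟩
    have h1 := anchor_mem ht.nonempty
    generalize anchor t.supp = z at h1
    obtain ⟨l, v, rfl⟩ := ht
    obtain ⟨z, hz, rfl⟩ := h1
    obtain ⟨y, hy, rfl⟩ := hy
    rw [mem_closedBall_zero_iff] at hyr ⊢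
    calc ‖z - v‖ = ‖(y - v) + (z - y)‖ := by congr 1; abel
      _ ≤ ‖y - v‖ + ‖z - y‖ := norm_add_le _ _
      _ ≤ r + (D + D) := add_le_add hyr ((norm_sub_le _ _).trans
        (add_le_add (hD l z hz) (hD l y hy)))
  obtain ⟨N, hN, hcovN⟩ := Metric.totallyBounded_iff.1
    (isCompact_closedBall (0 : E d) (r + (D + D))).totallyBounded (σ / 2) (half_pos hσ)
  have hch : ∀ t : Tile d L, ∃ y, IsTile P t → (t.supp ∩ closedBall 0 r).Nonempty →
      y ∈ N ∧ anchor t.supp ∈ ball y (σ / 2) := by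
    intro t
    by_cases h : IsTile P t ∧ (t.supp ∩ closedBall 0 r).Nonempty
    · obtain ⟨y, hy, hya⟩ := mem_iUnion₂.1 (hcovN (hbdd t h.1 h.2))
      exact ⟨y, fun _ _ => ⟨hy, hya⟩⟩
    · exact ⟨0, fun h1 h2 => absurd ⟨h1, h2⟩ h⟩
  choose y hy using hch
  refine Finite.of_injOn (f := fun t => (shapeOf t.supp, y t)) (t := shapes Ω ×ˢ N) ?_ ?_
    (hfin.prod hN)
  · intro t ht
    exact ⟨shapeOf_mem_shapes_of_mem_limitTiles hfin hΩ ht.1, (hy t ht.1.1 ht.2).1⟩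
  · intro t ht t' ht' heq
    have hS := shapeOf_mem_shapes_of_mem_limitTiles hfin hΩ ht.1
    obtain ⟨heq1, heq2⟩ := Prod.mk.inj heq
    have h1 := (hy t ht.1.1 ht.2).2
    have h2 := (hy t' ht'.1.1 ht'.2).2
    rw [← heq2] at h2
    have h3 : ‖anchor t.supp - anchor t'.supp‖ < σ := by
      rw [← dist_eq_norm]
      linarith [dist_triangle_right (anchor t.supp) (anchor t'.supp) (y t), mem_ball.1 h1,
        mem_ball.1 h2]
    have h4 : hausdorffDist t.supp t'.supp < σ := by
      have hK : IsCompact (shapeOf t.supp) := isCompact_translateSet ht.1.1.isCompact _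
      have hne : (shapeOf t.supp).Nonempty := nonempty_translateSet ht.1.1.nonempty _
      have := hausdorffDist_translateSet_le hK hK hne hne (-anchor t.supp) (-anchor t'.supp)
      rw [hausdorffDist_self_zero, zero_add, neg_sub_neg, norm_sub_rev, translateSet_shapeOf,
        heq1, translateSet_shapeOf] at this
      exact this.trans_lt h3
    obtain ⟨x, hx, hx'⟩ := hsep t t' ht.1.1 ht'.1.1 hS (heq1 ▸ hS) h4
    by_contra hne
    exact (hbd t ht.1 t' ht'.1 hne ⟨interior_subset hx, hx'⟩).1.2 hx

/-- A tiling space with finitely many shapes is compact. -/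
theorem IsTilingSpace.isCompact [CompactSpace L] (hΩ : IsTilingSpace Ω) (hfin : (shapes Ω).Finite) :
    IsCompact Ω := by
  rw [isCompact_iff_ultrafilter_le_nhds]
  intro 𝔉 h𝔉
  rw [le_principal_iff] at h𝔉
  obtain ⟨T, hT⟩ := exists_tiling_limitTiles hfin h𝔉
  have hle : (𝔉 : Filter (Tiling P)) ≤ 𝓝 T := by
    obtain ⟨σ, hσ, hsep⟩ := exists_mem_interior_of_hausdorffDist_lt hfin
    rw [(hasBasis_nhds_tiling T).ge_iff]
    intro ε hε
    have hη : 0 < min ε (σ / 2) := by positivity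
    set η := min ε (σ / 2) with hηdef
    have hησ : η ≤ σ / 2 := min_le_right _ _
    have htot : ∀ᶠ S in (𝔉 : Filter (Tiling P)), ∀ t ∈ {t ∈ T.tiles |
        (t.supp ∩ closedBall 0 (1 / ε)).Nonempty}, ∃ s ∈ S.tiles, tileDist t s < η := by
      rw [eventually_all_finite (T.locally_finite _)]
      intro t ht
      exact (hT ▸ ht.1 : t ∈ limitTiles (𝔉 : Filter (Tiling P))).2 η hη
    have hcot : ∀ᶠ S in (𝔉 : Filter (Tiling P)), ∀ s ∈ S.tiles,
        (s.supp ∩ closedBall 0 (1 / ε)).Nonempty → ∃ t ∈ T.tiles, tileDist t s < η := by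
      by_contra hcon
      rw [← Ultrafilter.eventually_not] at hcon
      have hch : ∀ S : Tiling P, ∃ s, (¬ ∀ s ∈ S.tiles, (s.supp ∩ closedBall 0 (1 / ε)).Nonempty →
          ∃ t ∈ T.tiles, tileDist t s < η) → s ∈ S.tiles ∧
          (s.supp ∩ closedBall 0 (1 / ε)).Nonempty ∧ ∀ t ∈ T.tiles, ¬ tileDist t s < η := by
        intro S
        by_cases h : ∀ s ∈ S.tiles, (s.supp ∩ closedBall 0 (1 / ε)).Nonempty →
          ∃ t ∈ T.tiles, tileDist t s < η
        · obtain ⟨t, ht, -⟩ := S.exists_mem_supp 0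
          exact ⟨t, fun h' => absurd h h'⟩
        · push Not at h
          obtain ⟨s, h1, h2, h3⟩ := h
          exact ⟨s, fun _ => ⟨h1, h2, fun t ht => not_lt.2 (h3 t ht)⟩⟩
      choose s hs using hch
      obtain ⟨t, ht, -, hlim⟩ := exists_mem_limitTiles (𝔉 := 𝔉) (s := s)
        (hcon.mono fun S hS => ⟨(hs S hS).1, (hs S hS).2.1⟩)
      obtain ⟨S, h1, h2⟩ := ((hlim η hη).and hcon).exists
      exact (hs S h2).2.2 t (hT ▸ ht) h1
    filter_upwards [htot, hcot, h𝔉] with S h1 h2 hS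
    refine ⟨fun t s => t ∈ T.tiles ∧ s ∈ S.tiles ∧ tileDist t s < η, ?_⟩
    constructor
    · exact fun h => h.1
    · exact fun h => h.2.1
    · exact fun h => h.2.2.le.trans (min_le_left _ _)
    · intro t t' s h h'
      have hd := tileDist_triangle (t'' := t') (T.isTile h.1) (S.isTile h.2.1)
      rw [tileDist_comm s t'] at hd
      have hlt : hausdorffDist t.supp t'.supp < σ :=
        (le_max_left _ _).trans_lt (by linarith [h.2.2, h'.2.2] : tileDist t t' < σ)
      obtain ⟨x, hx, hx'⟩ := hsep t t' (T.isTile h.1) (T.isTile h'.1)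
        (shapeOf_mem_shapes_of_mem_limitTiles hfin h𝔉 (hT ▸ h.1))
        (shapeOf_mem_shapes_of_mem_limitTiles hfin h𝔉 (hT ▸ h'.1)) hlt
      exact Tiling.eq_of_mem_interior h.1 h'.1 hx hx'
    · intro t s s' h h'
      have hd := tileDist_triangle (t'' := s') (S.isTile h.2.1) (T.isTile h.1)
      rw [tileDist_comm s t] at hd
      have hlt : hausdorffDist s.supp s'.supp < σ :=
        (le_max_left _ _).trans_lt (by linarith [h.2.2, h'.2.2] : tileDist s s' < σ)
      obtain ⟨x, hx, hx'⟩ := hsep s s' (S.isTile h.2.1) (S.isTile h'.2.1)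
        ⟨S, hS, s, h.2.1, rfl⟩ ⟨S, hS, s', h'.2.1, rfl⟩ hlt
      exact Tiling.eq_of_mem_interior h.2.1 h'.2.1 hx hx'
    · intro t ht hm
      obtain ⟨s, hs, hlt⟩ := h1 t ⟨ht, hm⟩
      exact ⟨s, ht, hs, hlt⟩
    · intro s hs hm
      obtain ⟨t, ht, hlt⟩ := h2 s hs hm
      exact ⟨t, ht, hs, hlt⟩
  exact ⟨T, isClosed_iff_ultrafilter.1 hΩ.isClosed T 𝔉 hle h𝔉, hle⟩

end

/-! ### Finite colourings of totally disconnected sets -/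

section

theorem exists_isClopen_subset {Z : Type*} [TopologicalSpace Z] [CompactSpace Z] [T2Space Z]
    {z : Z} {N U : Set Z} (hN : N ∈ 𝓝 z) (hNd : IsTotallyDisconnected N) (hU : U ∈ 𝓝 z) :
    ∃ C, IsClopen C ∧ z ∈ C ∧ C ⊆ U := by
  obtain ⟨K, hK, hKNU, hKc⟩ := local_compact_nhds (inter_mem hN hU)
  have : CompactSpace K := isCompact_iff_compactSpace.1 hKc
  have : TotallyDisconnectedSpace K := totallyDisconnectedSpace_subtype_iff.2
    fun C hC => hNd C (hC.trans fun x hx => (hKNU hx).1)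
  have hzK : z ∈ interior K := mem_interior_iff_mem_nhds.2 hK
  obtain ⟨V, hV, hzV, hVK⟩ := compact_exists_isClopen_in_isOpen (X := K)
    (isOpen_interior.preimage continuous_subtype_val : IsOpen (Subtype.val ⁻¹' interior K))
    (x := ⟨z, interior_subset hzK⟩) hzK
  refine ⟨Subtype.val '' V, ⟨?_, ?_⟩, ⟨_, hzV, rfl⟩, ?_⟩
  · exact hKc.isClosed.isClosedEmbedding_subtypeVal.isClosedMap _ hV.1
  · obtain ⟨O, hO, rfl⟩ := isOpen_induced_iff.1 hV.2
    have : (Subtype.val : K → Z) '' (Subtype.val ⁻¹' O) = O ∩ interior K := by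
      ext x
      constructor
      · rintro ⟨y, hy, rfl⟩
        exact ⟨hy, hVK hy⟩
      · rintro ⟨hxO, hxK⟩
        exact ⟨⟨x, interior_subset hxK⟩, hxO, rfl⟩
    rw [this]
    exact hO.inter isOpen_interior
  · rintro _ ⟨y, -, rfl⟩
    exact (hKNU y.2).2

/-- A locally totally disconnected compact set has a locally constant colouring with finitely many
colours that refines a given cover by neighbourhoods. -/
theorem exists_colouring {Y : Type*} [TopologicalSpace Y] [T2Space Y] {Ξ : Set Y}
    (hΞ : IsCompact Ξ) (h : ∀ z ∈ Ξ, ∃ N ∈ 𝓝 z, IsTotallyDisconnected (N ∩ Ξ)) (U : Y → Set Y)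
    (hU : ∀ z ∈ Ξ, U z ∈ 𝓝[Ξ] z) :
    ∃ (K : Type) (_ : Finite K) (κ : Y → K), (∀ z ∈ Ξ, ∀ᶠ w in 𝓝 z, w ∈ Ξ → κ w = κ z) ∧
      ∀ z ∈ Ξ, ∀ w ∈ Ξ, κ z = κ w → ∃ x ∈ Ξ, z ∈ U x ∧ w ∈ U x := by
  have : CompactSpace Ξ := isCompact_iff_compactSpace.1 hΞ
  have hC : ∀ z : Ξ, ∃ C : Set Ξ, IsClopen C ∧ z ∈ C ∧ C ⊆ Subtype.val ⁻¹' U z := by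
    intro z
    obtain ⟨N, hN, hNd⟩ := h z z.2
    refine exists_isClopen_subset (N := Subtype.val ⁻¹' N)
      (continuous_subtype_val.continuousAt hN) ?_ (preimage_coe_mem_nhds_subtype.2 (hU z z.2))
    intro A hA hApre x hx y hy
    exact Subtype.ext (hNd (Subtype.val '' A) (by
      rintro _ ⟨a, ha, rfl⟩
      exact ⟨hA ha, a.2⟩) (hApre.image _ continuous_subtype_val.continuousOn)
      (mem_image_of_mem _ hx) (mem_image_of_mem _ hy))
  choose C hCc hCz hCU using hC
  obtain ⟨t, ht⟩ := isCompact_univ.elim_finite_subcover C (fun z => (hCc z).2)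
    (fun z _ => mem_iUnion.2 ⟨z, hCz z⟩)
  -- the colour of a point records which members of the finite cover contain it
  refine ⟨Fin (Nat.card (Set t)), inferInstance,
    fun y => Finite.equivFin (Set t) {i | y ∈ Subtype.val '' C i}, ?_, ?_⟩
  · intro z hz
    have hev : ∀ᶠ w : Ξ in 𝓝 ⟨z, hz⟩, ∀ i : t, (w ∈ C i ↔ (⟨z, hz⟩ : Ξ) ∈ C i) := by
      rw [eventually_all]
      intro i
      by_cases hi : (⟨z, hz⟩ : Ξ) ∈ C i
      · filter_upwards [(hCc i).2.mem_nhds hi] with w hw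
        exact iff_of_true hw hi
      · filter_upwards [(hCc i).1.isOpen_compl.mem_nhds hi] with w hw
        exact iff_of_false hw hi
    rw [nhds_subtype_eq_comap, eventually_comap] at hev
    filter_upwards [hev] with w hw hwΞ
    refine congrArg _ (Set.ext fun i => ?_)
    have := hw ⟨w, hwΞ⟩ rfl i
    simpa [hwΞ, hz] using this
  · intro z hz w hw hzw
    have heq := (Finite.equivFin (Set t)).injective hzw
    obtain ⟨i, hi, hzi⟩ := mem_iUnion₂.1 (ht (mem_univ (⟨z, hz⟩ : Ξ)))
    have h1 : (⟨i, hi⟩ : t) ∈ {i : t | z ∈ Subtype.val '' C i} := ⟨_, hzi, rfl⟩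
    rw [heq] at h1
    obtain ⟨w', hw', rfl⟩ := h1
    exact ⟨i, i.2, hCU i hzi, hCU i hw'⟩

/-! ### Coded tilings -/

section

variable {d : ℕ} {L : Type*} [MetricSpace L] {P : PrototileSet d L}

/-- The labels of the coded tiles: a shape and a colour. -/
structure CodeLabel (Ω : Set (Tiling P)) (K : Type) : Type where
  shape : shapes Ω
  colour : K

theorem CodeLabel.finite {Ω : Set (Tiling P)} (hfin : (shapes Ω).Finite) (K : Type) [Finite K] :
    Finite (CodeLabel Ω K) := by
  have := hfin.to_subtype
  exact Finite.of_injective (fun l : CodeLabel Ω K => (l.shape, l.colour)) (by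
    rintro ⟨a, b⟩ ⟨a', b'⟩ h
    simpa using h)

variable {Ω : Set (Tiling P)} {K : Type}

/-- The prototiles of the coded tilings: the shapes, in all colours. -/
noncomputable def codePrototiles (Ω : Set (Tiling P)) (K : Type) [MetricSpace (CodeLabel Ω K)]
    [Finite (CodeLabel Ω K)] : PrototileSet d (CodeLabel Ω K) where
  shape l := ⟨⟨l.shape, by
    obtain ⟨t, ht, -, h⟩ := exists_isTile_of_mem_shapes l.shape.2
    exact h ▸ ht.isCompact⟩, by
    obtain ⟨t, ht, -, h⟩ := exists_isTile_of_mem_shapes l.shape.2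
    exact (h ▸ ht.nonempty : (l.shape : Set (E d)).Nonempty)⟩
  homeomorphic_ball l := by
    obtain ⟨_, ⟨l, x, rfl⟩, -, h⟩ := exists_isTile_of_mem_shapes l.shape.2
    obtain ⟨φ⟩ := P.homeomorphic_ball l
    exact ⟨(Homeomorph.setCongr h.symm).trans
      (((Homeomorph.subRight x).image (P.shape l : Set (E d))).symm.trans φ)⟩
  control_mem l := by
    obtain ⟨t, ht, h', h⟩ := exists_isTile_of_mem_shapes l.shape.2
    have := zero_mem_shapeOf ht.nonempty
    rw [h', h] at this
    exact this
  continuous_shape := continuous_of_discreteTopology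

/-- The tiles of the coded tiling: the supports of the tiles of `T`, labelled by their shape and by
the colour of the translate of `T` that has the anchor of the support at the origin. -/
def codeTiles (κ : Tiling P → K) (T : Tiling P) : Set (Tile d (CodeLabel Ω K)) :=
  {c | (∃ t ∈ T.tiles, t.supp = c.supp) ∧ (c.label.shape : Set (E d)) = shapeOf c.supp ∧
    c.label.colour = κ (T.translate (anchor c.supp))}

theorem eq_of_mem_codeTiles {κ : Tiling P → K} {T : Tiling P} {c c' : Tile d (CodeLabel Ω K)}
    (hc : c ∈ codeTiles κ T) (hc' : c' ∈ codeTiles κ T) (h : c.supp = c'.supp) : c = c' := by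
  obtain ⟨-, h1, h2⟩ := hc
  obtain ⟨-, h1', h2'⟩ := hc'
  rcases c with ⟨s, ⟨a, b⟩⟩
  rcases c' with ⟨s', ⟨a', b'⟩⟩
  dsimp only at *
  subst h
  rw [h2, h2', Subtype.ext (h1.trans h1'.symm)]

theorem exists_mem_codeTiles (κ : Tiling P → K) {T : Tiling P} (hT : T ∈ Ω) {t : Tile d L}
    (ht : t ∈ T.tiles) : ∃ c ∈ codeTiles (Ω := Ω) κ T, c.supp = t.supp :=
  ⟨⟨t.supp, ⟨⟨shapeOf t.supp, T, hT, t, ht, rfl⟩, κ (T.translate (anchor t.supp))⟩⟩,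
    ⟨⟨t, ht, rfl⟩, rfl, rfl⟩, rfl⟩

theorem patchSupp_codeTiles (κ : Tiling P → K) {T : Tiling P} (hT : T ∈ Ω) :
    patchSupp (codeTiles (Ω := Ω) κ T) = univ := by
  refine eq_univ_of_forall fun x => ?_
  obtain ⟨t, ht, hx⟩ := T.exists_mem_supp x
  obtain ⟨c, hc, hct⟩ := exists_mem_codeTiles κ hT ht
  exact mem_iUnion₂.2 ⟨c, hc, hct ▸ hx⟩

variable [MetricSpace (CodeLabel Ω K)] [Finite (CodeLabel Ω K)]

/-- The coded tiling. -/
noncomputable def code (κ : Tiling P → K) (T : Ω) : Tiling (codePrototiles Ω K) where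
  tiles := codeTiles κ T
  isPatch := by
    refine ⟨?_, ?_, ?_⟩
    · rintro c ⟨-, h, -⟩
      refine ⟨c.label, -anchor c.supp, ?_⟩
      ext1
      · change c.supp = translateSet (c.label.shape : Set (E d)) (-anchor c.supp)
        rw [h, translateSet_shapeOf]
      · rfl
    · intro c hc c' hc' hne
      obtain ⟨t, ht, htc⟩ := hc.1
      obtain ⟨t', ht', htc'⟩ := hc'.1
      rw [← htc, ← htc']
      refine T.1.isPatch.boundary t ht t' ht' fun h => hne (eq_of_mem_codeTiles hc hc' ?_)
      rw [← htc, ← htc', h]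
    · rw [patchSupp_codeTiles κ T.2]
      exact isConnected_univ
  covers := patchSupp_codeTiles κ T.2
  locally_finite r := by
    refine Finite.of_injOn (f := Tile.supp) (t := Tile.supp ''
      {t ∈ T.1.tiles | (t.supp ∩ closedBall 0 r).Nonempty}) ?_ ?_
      ((T.1.locally_finite r).image _)
    · rintro c ⟨⟨⟨t, ht, h⟩, -⟩, hm⟩
      exact ⟨t, ⟨ht, h ▸ hm⟩, h⟩
    · exact fun c hc c' hc' h => eq_of_mem_codeTiles hc.1 hc'.1 h

theorem code_translate (κ : Tiling P → K) (T : Ω) (v : E d) (h : T.1.translate v ∈ Ω) :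
    code κ (⟨T.1.translate v, h⟩ : Ω) = (code κ T).translate v := by
  ext c
  rw [Tiling.mem_translate]
  change c ∈ codeTiles κ (T.1.translate v) ↔ c.translate (-v) ∈ codeTiles κ T.1
  have h1 : (∃ t ∈ (T.1.translate v).tiles, t.supp = c.supp) ↔
      ∃ t ∈ T.1.tiles, t.supp = (c.translate (-v)).supp := by
    constructor
    · rintro ⟨_, ⟨t, ht, rfl⟩, htc⟩
      refine ⟨t, ht, ?_⟩
      simp only [Tile.translate] at htc ⊢
      rw [← htc, translateSet_translateSet, add_neg_cancel, translateSet_zero]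
    · rintro ⟨t, ht, htc⟩
      refine ⟨t.translate v, mem_image_of_mem _ ht, ?_⟩
      simp only [Tile.translate] at htc ⊢
      rw [htc, translateSet_translateSet, neg_add_cancel, translateSet_zero]
  refine Iff.trans (and_congr_right fun hex => ?_) (and_congr_left' h1)
  obtain ⟨t, ht, htc⟩ := hex
  have hc : IsCompact c.supp := htc ▸ (Tiling.isTile _ ht).isCompact
  have hne : c.supp.Nonempty := htc ▸ (Tiling.isTile _ ht).nonempty
  simp only [Tile.translate, shapeOf_translateSet hc hne, anchor_translateSet hc hne,
    Tiling.translate_add, sub_neg_eq_add, add_comm v]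

end

end

/-! ### Anchored tilings and the continuity of the code -/

section

section

variable {d : ℕ} {L : Type*} [MetricSpace L] {P : PrototileSet d L} {Ω : Set (Tiling P)}

/-- Close tiles of finitely many shapes have the same shape and close anchors. -/
theorem exists_norm_anchor_sub_le (hfin : (shapes Ω).Finite) :
    ∃ σ > 0, ∀ t t' : Tile d L, IsTile P t → IsTile P t' → shapeOf t.supp ∈ shapes Ω →
      shapeOf t'.supp ∈ shapes Ω → hausdorffDist t.supp t'.supp < σ →
      shapeOf t.supp = shapeOf t'.supp ∧
        ‖anchor t.supp - anchor t'.supp‖ ≤ d * hausdorffDist t.supp t'.supp := by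
  obtain ⟨σ, hσ, h⟩ := exists_shapeOf_eq hfin fun S hS => by
    obtain ⟨t, ht, -, rfl⟩ := exists_isTile_of_mem_shapes hS
    exact ⟨ht.isCompact, ht.nonempty⟩
  refine ⟨σ, hσ, fun t t' ht ht' hS hS' hlt => ?_⟩
  have h1 := h _ _ ht.isCompact ht'.isCompact ht.nonempty ht'.nonempty hS hS' hlt
  have h2 := congrArg anchor (eq_translateSet_of_shapeOf_eq ht.isCompact ht.nonempty h1)
  rw [anchor_translateSet ht.isCompact ht.nonempty] at h2
  refine ⟨h1, ?_⟩
  rw [h2, sub_sub_cancel]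
  exact norm_corner_sub_le ht.isCompact ht'.isCompact ht.nonempty ht'.nonempty

/-- The tilings with a tile whose anchor is the origin. -/
def anchored (Ω : Set (Tiling P)) : Set (Tiling P) := {T ∈ Ω | ∃ t ∈ T.tiles, anchor t.supp = 0}

theorem mem_anchored_translate (hΩ : IsTilingSpace Ω) {T : Tiling P} (hT : T ∈ Ω) {t : Tile d L}
    (ht : t ∈ T.tiles) : T.translate (anchor t.supp) ∈ anchored Ω :=
  ⟨hΩ.translate_mem T hT _, _, Tiling.translate_mem_translate ht _,
    anchor_shapeOf (T.isTile ht).isCompact (T.isTile ht).nonempty⟩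

theorem isClosed_anchored (hΩ : IsTilingSpace Ω) (hfin : (shapes Ω).Finite) :
    IsClosed (anchored Ω) := by
  refine isClosed_of_closure_subset fun T hT => ?_
  have hTΩ : T ∈ Ω := hΩ.isClosed.closure_subset_iff.2 (fun S hS => hS.1) hT
  refine ⟨hTΩ, ?_⟩
  obtain ⟨σ, hσ, hanc⟩ := exists_norm_anchor_sub_le hfin
  have hA := (T.locally_finite 1).image fun t => anchor t.supp
  have h0 : (0 : E d) ∈ (fun t => anchor t.supp) ''
      {t ∈ T.tiles | (t.supp ∩ closedBall 0 1).Nonempty} := by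
    rw [← hA.isClosed.closure_eq, Metric.mem_closure_iff]
    intro ε hε
    have hη0 : 0 < min (min 1 (σ / 2)) (ε / (1 + d)) := by positivity
    set η := min (min 1 (σ / 2)) (ε / (1 + d)) with hη
    have hη1 : η ≤ 1 := (min_le_left _ _).trans (min_le_left _ _)
    have hησ : η ≤ σ / 2 := (min_le_left _ _).trans (min_le_right _ _)
    obtain ⟨S, ⟨M, hM⟩, hSΩ, s, hs, hs0⟩ :=
      mem_closure_iff_nhds_basis (hasBasis_nhds_tiling T) |>.1 hT η hη0 |>.imp fun _ => And.symm
    have h0s : (0 : E d) ∈ s.supp := hs0 ▸ anchor_mem (S.isTile hs).nonempty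
    obtain ⟨t, ht⟩ := hM.cototal hs ⟨0, h0s, by simp [hη0.le]⟩
    have htT := hM.left ht
    have hnear := hM.near ht
    refine ⟨anchor t.supp, mem_image_of_mem _ ⟨htT, ?_⟩, ?_⟩
    · exact meets_of_tileDist_le (r := 0) (S.isTile hs) (T.isTile htT)
        ((tileDist_comm s t).trans_le hnear) (by linarith) ⟨0, h0s, by simp⟩
    · have h1 := (le_max_left _ _).trans hnear
      have h2 := (hanc t s (T.isTile htT) (S.isTile hs) ⟨T, hTΩ, t, htT, rfl⟩
        ⟨S, hSΩ, s, hs, rfl⟩ (by linarith)).2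
      rw [hs0, sub_zero] at h2
      rw [dist_zero_left]
      have h3 : η * (1 + d) ≤ ε := (le_div_iff₀ (by positivity)).1 (min_le_right _ _)
      have h4 : (d : ℝ) * hausdorffDist t.supp s.supp ≤ d * η := by gcongr
      linarith
  obtain ⟨t, ht, h⟩ := h0
  exact ⟨t, ht.1, h⟩

theorem Tiling.countable_tiles (T : Tiling P) : T.tiles.Countable := by
  have : T.tiles ⊆ ⋃ n : ℕ, {t ∈ T.tiles | (t.supp ∩ closedBall 0 (n : ℝ)).Nonempty} := by
    intro t ht
    obtain ⟨x, hx⟩ := (T.isTile ht).nonempty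
    obtain ⟨n, hn⟩ := exists_nat_ge ‖x‖
    exact mem_iUnion.2 ⟨n, ht, x, hx, by simpa using hn⟩
  exact (countable_iUnion fun n : ℕ => (T.locally_finite n).countable).mono this

/-- In a space whose orbits are, locally, the connected components, the tilings with a tile
anchored at the origin form a locally totally disconnected set: each orbit contains only
countably many of them. -/
theorem isTotallyDisconnected_inter_anchored {X : Type*} [TopologicalSpace X] [AddAction (E d) X]
    (hX : HasLocalCocycles d X) (ψ : Ω ≃ₜ X)
    (hψ : ∀ T : Ω, ∃ K : E d → E d, Continuous K ∧
      ∀ w : E d, (ψ.symm (w +ᵥ ψ T) : Tiling P) = T.1.translate (K w))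
    {T₀ : Tiling P} (hT₀ : T₀ ∈ Ω) : ∃ N ∈ 𝓝 T₀, IsTotallyDisconnected (N ∩ anchored Ω) := by
  obtain ⟨N', hN', c, hc, hC⟩ := hX (ψ ⟨T₀, hT₀⟩)
  have hN'' := ψ.continuous.continuousAt hN'
  rw [mem_map, mem_nhds_subtype] at hN''
  obtain ⟨N, hN, hNN'⟩ := hN''
  refine ⟨N, hN, fun C hCN hCpre x hx y hy => ?_⟩
  set C' : Set Ω := Subtype.val ⁻¹' C with hC'
  have hC'pre : IsPreconnected C' := by
    rw [← IsInducing.subtypeVal.isPreconnected_image, Subtype.image_preimage_coe,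
      inter_eq_right.2 fun S hS => (hCN hS).2.1]
    exact hCpre
  have hψC : ψ '' C' ⊆ N' := by
    rintro _ ⟨S, hS, rfl⟩
    exact hNN' (hCN hS).1
  set S : Ω := ⟨x, (hCN hx).2.1⟩ with hS
  set S' : Ω := ⟨y, (hCN hy).2.1⟩ with hS'
  obtain ⟨K, hK, hKS⟩ := hψ S
  have horb : ∀ R ∈ C', (R : Tiling P) = x.translate (K (c (ψ S) - c (ψ R))) := by
    intro R hR
    rw [← hKS, ← hC _ hψC (hC'pre.image _ ψ.continuous.continuousOn) (ψ S)
      (mem_image_of_mem _ hx) (ψ R) (mem_image_of_mem _ hR), ψ.symm_apply_apply]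
  have hQ : IsPreconnected ((fun R => K (c (ψ S) - c (ψ R))) '' C') :=
    hC'pre.image _ (hK.comp_continuousOn (continuousOn_const.sub
      (hc.comp ψ.continuous.continuousOn fun R hR => hψC (mem_image_of_mem _ hR))))
  have hQc : (fun R => K (c (ψ S) - c (ψ R))) '' C' ⊆ (fun t => anchor t.supp) '' x.tiles := by
    rintro _ ⟨R, hR, rfl⟩
    obtain ⟨-, r, hr, hr0⟩ := (hCN hR).2
    rw [horb R hR] at hr
    obtain ⟨t, ht, rfl⟩ := hr
    refine ⟨t, ht, ?_⟩
    change anchor (translateSet _ _) = 0 at hr0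
    rwa [anchor_translateSet (x.isTile ht).isCompact (x.isTile ht).nonempty, sub_eq_zero] at hr0
  have h := (x.countable_tiles.image fun t => anchor t.supp).isTotallyDisconnected _ hQc hQ
    (mem_image_of_mem _ (show S ∈ C' from hx)) (mem_image_of_mem _ (show S' ∈ C' from hy))
  change (S : Tiling P) = S'
  rw [horb S hx, horb S' hy]
  exact congrArg x.translate h

variable {K : Type} [MetricSpace (CodeLabel Ω K)] [Finite (CodeLabel Ω K)]

/-- If the colouring is locally constant on the anchored tilings, the coded tiling depends
continuously on the tiling: matched tiles have the same shape and nearby anchors, hence the same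
colour. -/
theorem continuous_code (hΩ : IsTilingSpace Ω) (hfin : (shapes Ω).Finite) {κ : Tiling P → K}
    (hκ : ∀ T ∈ anchored Ω, ∀ᶠ T' in 𝓝 T, T' ∈ anchored Ω → κ T' = κ T) :
    Continuous (code (Ω := Ω) κ) := by
  rw [continuous_iff_continuousAt]
  intro T
  rw [ContinuousAt, (hasBasis_nhds_tiling _).tendsto_right_iff]
  intro ε hε
  obtain ⟨σ, hσ, hanc⟩ := exists_norm_anchor_sub_le hfin
  set F := {t ∈ T.1.tiles | (t.supp ∩ closedBall 0 (1 / ε + 1)).Nonempty} with hF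
  have hFfin : F.Finite := T.1.locally_finite _
  -- the colours of the tiles in `F` persist
  have hcol : ∀ t ∈ F, ∃ δ > 0, ∀ᶠ T' in 𝓝 T.1, ∀ a, ‖anchor t.supp - a‖ < δ →
      T'.translate a ∈ anchored Ω → κ (T'.translate a) = κ (T.1.translate (anchor t.supp)) := by
    intro t ht
    have h := (Tiling.continuous_translate.tendsto (T.1, anchor t.supp)).eventually
      (hκ _ (mem_anchored_translate hΩ T.2 ht.1))
    rw [nhds_prod_eq, eventually_prod_iff] at h
    obtain ⟨p, hp, q, hq, hpq⟩ := h
    obtain ⟨δ, hδ, hb⟩ := Metric.eventually_nhds_iff.1 hq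
    refine ⟨δ, hδ, hp.mono fun T' hT' a ha => hpq hT' (hb ?_)⟩
    rwa [dist_comm, dist_eq_norm]
  have hcol' : ∀ᶠ δ in 𝓝[>] (0 : ℝ), ∀ t ∈ F, ∀ᶠ T' in 𝓝 T.1, ∀ a, ‖anchor t.supp - a‖ < δ →
      T'.translate a ∈ anchored Ω → κ (T'.translate a) = κ (T.1.translate (anchor t.supp)) := by
    rw [eventually_all_finite hFfin]
    intro t ht
    obtain ⟨δ, hδ, h⟩ := hcol t ht
    filter_upwards [Ioo_mem_nhdsGT hδ] with δ' hδ'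
    exact h.mono fun T' hT' a ha => hT' a (ha.trans hδ'.2)
  obtain ⟨δ, hδcol, hδ⟩ := (hcol'.and self_mem_nhdsWithin).exists
  replace hδ : 0 < δ := hδ
  rw [← eventually_all_finite hFfin] at hδcol
  have hη0 : 0 < min (min ε 1) (min (σ / 2) (δ / (1 + d))) := by positivity
  set η := min (min ε 1) (min (σ / 2) (δ / (1 + d))) with hη
  have hηε : η ≤ ε := (min_le_left _ _).trans (min_le_left _ _)
  have hη1 : η ≤ 1 := (min_le_left _ _).trans (min_le_right _ _)
  have hησ : η ≤ σ / 2 := (min_le_right _ _).trans (min_le_left _ _)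
  have hηδ : d * η < δ := by
    have h : η ≤ δ / (1 + d) := (min_le_right _ _).trans (min_le_right _ _)
    rw [le_div_iff₀ (by positivity)] at h
    linarith
  have hball : closedBall (0 : E d) (1 / ε) ⊆ closedBall 0 (1 / η) :=
    closedBall_subset_closedBall (one_div_le_one_div_of_le hη0 hηε)
  have hcont := continuous_subtype_val.continuousAt (x := T)
  filter_upwards [hcont.eventually hδcol,
    hcont.eventually ((hasBasis_nhds_tiling T.1).mem_of_mem hη0)] with T' hT' hTT'
  obtain ⟨M, hM⟩ := hTT'
  refine ⟨fun c c' => c ∈ (code κ T).tiles ∧ c' ∈ (code κ T').tiles ∧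
    ∃ t t', t ∈ F ∧ M t t' ∧ t.supp = c.supp ∧ t'.supp = c'.supp, ?_⟩
  have hlabel : ∀ {c c' : Tile d (CodeLabel Ω K)} {t t'}, c ∈ (code κ T).tiles →
      c' ∈ (code κ T').tiles → t ∈ F → M t t' → t.supp = c.supp → t'.supp = c'.supp →
      c.label = c'.label := by
    intro c c' t t' hc hc' ht hm h h'
    have hlt : hausdorffDist t.supp t'.supp ≤ η := (le_max_left _ _).trans (hM.near hm)
    obtain ⟨h1, h2⟩ := hanc t t' (T.1.isTile ht.1) (T'.1.isTile (hM.right hm))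
      ⟨T, T.2, t, ht.1, rfl⟩ ⟨T', T'.2, t', hM.right hm, rfl⟩ (by linarith)
    have h3 : ‖anchor t.supp - anchor t'.supp‖ < δ := by
      have : (d : ℝ) * hausdorffDist t.supp t'.supp ≤ d * η := by gcongr
      linarith
    have h4 := hT' t ht _ h3 (mem_anchored_translate hΩ T'.2 (hM.right hm))
    obtain ⟨-, h5, h6⟩ := hc
    obtain ⟨-, h5', h6'⟩ := hc'
    rw [← h] at h5 h6
    rw [← h'] at h5' h6'
    rcases c with ⟨s, ⟨a, b⟩⟩
    rcases c' with ⟨s', ⟨a', b'⟩⟩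
    dsimp only at *
    rw [h6, h6', h4, Subtype.ext (h5.trans (h1.trans h5'.symm))]
  constructor
  · exact fun h => h.1
  · exact fun h => h.2.1
  · rintro c c' ⟨hc, hc', t, t', ht, hm, h, h'⟩
    refine max_le ?_ ?_
    · rw [← h, ← h']
      exact (le_max_left _ _).trans ((hM.near hm).trans hηε)
    · rw [hlabel hc hc' ht hm h h', dist_self]
      exact hε.le
  · rintro c b c' ⟨hc, hc', t, t', ht, hm, h, h'⟩ ⟨hb, -, s, s', hs, hm', k, k'⟩
    have h1 := Tiling.eq_of_supp_eq (hM.right hm) (hM.right hm') (h'.trans k'.symm)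
    subst h1
    have h2 := hM.inj hm hm'
    subst h2
    exact eq_of_mem_codeTiles hc hb (h.symm.trans k)
  · rintro c c' b' ⟨hc, hc', t, t', ht, hm, h, h'⟩ ⟨-, hb', s, s', hs, hm', k, k'⟩
    have h1 := Tiling.eq_of_supp_eq ht.1 hs.1 (h.trans k.symm)
    subst h1
    have h2 := hM.fn hm hm'
    subst h2
    exact eq_of_mem_codeTiles hc' hb' (h'.symm.trans k')
  · intro c hc hcm
    obtain ⟨t, ht, htc⟩ := hc.1
    rw [← htc] at hcm
    obtain ⟨t', hm⟩ := hM.total ht (hcm.mono (inter_subset_inter_right _ hball))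
    obtain ⟨c', hc', hct'⟩ := exists_mem_codeTiles κ T'.2 (hM.right hm)
    refine ⟨c', hc, hc', t, t', ⟨ht, hcm.mono (inter_subset_inter_right _
      (closedBall_subset_closedBall (by linarith)))⟩, hm, htc, hct'.symm⟩
  · intro c' hc' hcm
    obtain ⟨t', ht', htc⟩ := hc'.1
    rw [← htc] at hcm
    obtain ⟨t, hm⟩ := hM.cototal ht' (hcm.mono (inter_subset_inter_right _ hball))
    obtain ⟨c, hc, hct⟩ := exists_mem_codeTiles κ T.2 (hM.left hm)
    refine ⟨c, hc, hc', t, t', ⟨hM.left hm, ?_⟩, hm, hct.symm, htc⟩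
    exact meets_of_tileDist_le (T'.1.isTile ht') (T.1.isTile (hM.left hm))
      ((tileDist_comm _ _).trans_le (hM.near hm)) (by linarith) hcm

theorem isTilingSpace_range_code (hΩ : IsTilingSpace Ω) {κ : Tiling P → K}
    (hcl : IsClosed (range (code (Ω := Ω) κ))) : IsTilingSpace (range (code (Ω := Ω) κ)) where
  isClosed := hcl
  translate_mem := by
    rintro _ ⟨T, rfl⟩ x
    exact ⟨⟨T.1.translate x, hΩ.translate_mem T T.2 x⟩, code_translate κ T x _⟩

theorem hasFinitelyManyTwoTileShapes_range_code (h : HasFinitelyManyTwoTileShapes Ω)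
    (κ : Tiling P → K) : HasFinitelyManyTwoTileShapes (range (code (Ω := Ω) κ)) := by
  obtain ⟨F, hF, h⟩ := h
  refine ⟨F, hF, ?_⟩
  rintro A ⟨hA2, hAP, _, ⟨T, rfl⟩, hAT⟩
  obtain ⟨c, c', hne, rfl⟩ := encard_eq_two.1 hA2
  have hc := hAT (mem_insert c _)
  have hc' := hAT (mem_insert_of_mem c (mem_singleton c'))
  obtain ⟨t, ht, htc⟩ := hc.1
  obtain ⟨t', ht', htc'⟩ := hc'.1
  have hne' : t ≠ t' := fun h => hne (eq_of_mem_codeTiles hc hc' (by rw [← htc, ← htc', h]))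
  have hsub : ({t, t'} : Set (Tile d L)) ⊆ T.1.tiles := by
    rintro s (rfl | rfl) <;> assumption
  have hpatch : IsPatch P {t, t'} :=
    ⟨fun s hs => T.1.isTile (hsub hs), fun s hs s' hs' => T.1.isPatch.boundary s (hsub hs) s'
      (hsub hs'), by
      have := hAP.connected
      simp only [patchSupp, biUnion_insert, biUnion_singleton] at this ⊢
      rwa [htc, htc']⟩
  obtain ⟨B, hB, x, hx⟩ := h _ ⟨encard_pair hne', hpatch, T, T.2, hsub⟩
  refine ⟨B, hB, x, ?_⟩
  rw [← hx, image_pair, image_pair, htc, htc']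

end

/-- With finitely many labels, finitely many pairs of supports give finitely many two-tile
patches. -/
theorem HasFinitelyManyTwoTileShapes.hasFLC {d : ℕ} {L : Type*} [MetricSpace L] [Finite L]
    {P : PrototileSet d L} {Ω : Set (Tiling P)} (h : HasFinitelyManyTwoTileShapes Ω) :
    HasFLC Ω := by
  obtain ⟨F, hF, h⟩ := h
  refine ⟨⋃ B ∈ {B | B ∈ F ∧ B.Finite}, 𝒫 {t : Tile d L | t.supp ∈ B},
    (hF.subset fun B hB => hB.1).biUnion fun B hB => Finite.powerset ?_, ?_⟩
  · refine ((hB.2.prod (finite_univ (α := L))).image fun p => Tile.mk p.1 p.2).subset ?_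
    exact fun t ht => ⟨(t.supp, t.label), ⟨ht, trivial⟩, rfl⟩
  · intro A hA
    obtain ⟨B, hB, x, hx⟩ := h A hA
    have hBfin : B.Finite := by
      refine Finite.of_finite_image (f := fun S => translateSet S x) ?_
        (translateSet_injective x).injOn
      rw [← hx]
      exact (finite_of_encard_eq_coe (k := 2) hA.1).image _
    refine ⟨translatePatch A (-x), mem_iUnion₂.2 ⟨B, ⟨hB, hBfin⟩, ?_⟩, x, ?_⟩
    · rintro _ ⟨t, ht, rfl⟩
      obtain ⟨S, hS, hSt⟩ : t.supp ∈ (fun S => translateSet S x) '' B :=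
        hx ▸ mem_image_of_mem _ ht
      change translateSet t.supp (-x) ∈ B
      rw [← hSt, translateSet_translateSet, add_neg_cancel, translateSet_zero]
      exact hS
    · simp only [translatePatch, image_image, translate_translate, neg_add_cancel,
        Tile.translate_zero, image_id']

end

/-! ### Separating codes -/

section

variable {d : ℕ} {L : Type*} [MetricSpace L] {P : PrototileSet d L} {Ω : Set (Tiling P)}

theorem PrototileSet.exists_norm_sub_le [CompactSpace L] (P : PrototileSet d L) :
    ∃ M : ℝ, ∀ t, IsTile P t → ∀ x ∈ t.supp, ∀ y ∈ t.supp, ‖x - y‖ ≤ M := by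
  obtain ⟨D, -, hD⟩ := P.exists_norm_le
  refine ⟨D + D, ?_⟩
  rintro _ ⟨l, v, rfl⟩ _ ⟨x, hx, rfl⟩ _ ⟨y, hy, rfl⟩
  dsimp only
  rw [sub_sub_sub_cancel_right]
  exact (norm_sub_le _ _).trans (add_le_add (hD l x hx) (hD l y hy))

/-- A small translation that maps the supports of a tiling to supports of this tiling is trivial. -/
theorem exists_eq_zero_of_translate_supp (hfin : (shapes Ω).Finite) :
    ∃ σ > 0, ∀ T ∈ Ω, ∀ y : E d, ‖y‖ < σ →
      (∀ t ∈ (T.translate y).tiles, ∃ s ∈ T.tiles, s.supp = t.supp) → y = 0 := by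
  obtain ⟨σ, hσ, h⟩ := exists_mem_interior_of_hausdorffDist_lt hfin
  refine ⟨σ, hσ, fun T hT y hy hsupp => ?_⟩
  obtain ⟨t, ht, -⟩ := T.exists_mem_supp 0
  have ht' := T.isTile ht
  obtain ⟨s, hs, hst⟩ := hsupp _ (Tiling.translate_mem_translate ht y)
  replace hst : s.supp = translateSet t.supp y := hst
  have hlt : hausdorffDist t.supp s.supp < σ := by
    have := hausdorffDist_translateSet_le ht'.isCompact ht'.isCompact ht'.nonempty ht'.nonempty 0 y
    rw [translateSet_zero, hausdorffDist_self_zero, zero_add, zero_sub, norm_neg, ← hst] at this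
    exact this.trans_lt hy
  obtain ⟨x, hx, hx'⟩ := h t s ht' (T.isTile hs) ⟨T, hT, t, ht, rfl⟩ ⟨T, hT, s, hs, rfl⟩ hlt
  have hts := Tiling.eq_of_mem_interior ht hs hx hx'
  exact ht'.eq_zero_of_translate_eq (by rw [← hst, ← hts])

/-- The translate of a tiling, as an element of the tiling space. -/
def IsTilingSpace.shift (hΩ : IsTilingSpace Ω) (T : Ω) (v : E d) : Ω :=
  ⟨T.1.translate v, hΩ.translate_mem T T.2 v⟩

theorem IsTilingSpace.continuous_shift (hΩ : IsTilingSpace Ω) :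
    Continuous fun p : Ω × E d => hΩ.shift p.1 p.2 :=
  Continuous.subtype_mk (Tiling.continuous_translate.comp
    ((continuous_subtype_val.comp continuous_fst).prodMk continuous_snd)) _

/-- The anchored tilings can be coloured so that the supports of a tiling, and the colours of its
translates anchored at the origin, determine the tiling.

Tilings with equal codes are mapped by `ψ` to points that shadow each other, hence lie in one orbit
with a small displacement. The displacement of the tilings is then small, too, and vanishes since
their supports are the same. -/
theorem exists_separating_colouring [CompactSpace L] {X : Type*} [UniformSpace X] [T2Space X]
    [AddAction (E d) X] [ContinuousVAdd (E d) X] (hX : HasLocalCocycles d X)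
    (hSE : ∀ r > 0, ∃ V ∈ 𝓤 X, ∀ x y : X, Shadows (d := d) V x y → ∃ v : E d, ‖v‖ < r ∧ x = v +ᵥ y)
    (hΩ : IsTilingSpace Ω) (hfin : (shapes Ω).Finite) (ψ : Ω ≃ₜ X)
    (hψ : ∀ T : Ω, ∃ H : E d ≃ₜ E d, H 0 = 0 ∧ ∀ v, ψ (hΩ.shift T v) = H v +ᵥ ψ T) :
    ∃ (K : Type) (_ : Finite K) (κ : Tiling P → K),
      (∀ T ∈ anchored Ω, ∀ᶠ T' in 𝓝 T, T' ∈ anchored Ω → κ T' = κ T) ∧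
      ∀ T T' : Ω, (∀ t ∈ T.1.tiles, ∃ t' ∈ T'.1.tiles, t'.supp = t.supp ∧
        κ (T.1.translate (anchor t.supp)) = κ (T'.1.translate (anchor t.supp))) → T = T' := by
  have hcpt := hΩ.isCompact hfin
  have : CompactSpace Ω := isCompact_iff_compactSpace.1 hcpt
  have : CompactSpace X := ψ.compactSpace
  obtain ⟨σ, hσ, hσΩ⟩ := exists_eq_zero_of_translate_supp hfin
  have hsymm : ∀ (T : Ω) (H : E d ≃ₜ E d), (∀ v, ψ (hΩ.shift T v) = H v +ᵥ ψ T) →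
      ∀ w, ψ.symm (w +ᵥ ψ T) = hΩ.shift T (H.symm w) := fun T H hH w => by
    rw [ψ.symm_apply_eq, hH, H.apply_symm_apply]
  -- small displacements in `X` do not yield displacements of norm `σ / 2`
  have hr : ∀ᶠ z in 𝓝 (0 : E d), ∀ p ∈ (univ : Set X) ×ˢ sphere (0 : E d) (σ / 2),
      ψ.symm (z +ᵥ p.1) ≠ hΩ.shift (ψ.symm p.1) p.2 := by
    refine (isCompact_univ.prod (isCompact_sphere _ _)).eventually_forall_of_forall_eventually ?_
    rintro ⟨x, y⟩ ⟨-, hy⟩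
    rw [mem_sphere_zero_iff_norm] at hy
    have h1 : Continuous fun q : E d × X × E d => ψ.symm (q.1 +ᵥ q.2.1) :=
      ψ.symm.continuous.comp (continuous_fst.vadd (continuous_fst.comp continuous_snd))
    have h2 : Continuous fun q : E d × X × E d => hΩ.shift (ψ.symm q.2.1) q.2.2 :=
      hΩ.continuous_shift.comp ((ψ.symm.continuous.comp (continuous_fst.comp continuous_snd)).prodMk
        (continuous_snd.comp continuous_snd))
    refine (isOpen_ne_fun h1 h2).mem_nhds ?_
    change ψ.symm ((0 : E d) +ᵥ x) ≠ hΩ.shift (ψ.symm x) y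
    rw [zero_vadd]
    intro h
    have h3 : (ψ.symm x : Tiling P).translate y = ψ.symm x := (congrArg Subtype.val h).symm
    have h4 : y = 0 := hσΩ _ (ψ.symm x).2 y (by linarith) (by
      rw [h3]
      exact fun t ht => ⟨t, ht, rfl⟩)
    rw [h4, norm_zero] at hy
    linarith
  obtain ⟨r, hr0, hr⟩ := Metric.eventually_nhds_iff.1 hr
  obtain ⟨V, hV, hVr⟩ := hSE r hr0
  obtain ⟨V', hV', hV's, hV'V⟩ := comp_symm_mem_uniformity_sets hV
  obtain ⟨M, hM⟩ := P.exists_norm_sub_le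
  set U : Tiling P → Set (Tiling P) := fun T => {T' | ∀ (hT : T ∈ Ω) (hT' : T' ∈ Ω),
    ∀ u ∈ closedBall (0 : E d) M, (ψ (hΩ.shift ⟨T, hT⟩ u), ψ (hΩ.shift ⟨T', hT'⟩ u)) ∈ V'} with hU
  have hUnhds : ∀ T ∈ Ω, U T ∈ 𝓝 T := by
    intro T hT
    have hev : ∀ᶠ S : Ω in 𝓝 ⟨T, hT⟩, ∀ u ∈ closedBall (0 : E d) M,
        (ψ (hΩ.shift ⟨T, hT⟩ u), ψ (hΩ.shift S u)) ∈ V' := by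
      refine (isCompact_closedBall _ _).eventually_forall_of_forall_eventually fun u _ => ?_
      have hc : Continuous fun q : Ω × E d =>
          (ψ (hΩ.shift ⟨T, hT⟩ q.2), ψ (hΩ.shift q.1 q.2)) :=
        (ψ.continuous.comp (hΩ.continuous_shift.comp
          (continuous_const.prodMk continuous_snd))).prodMk (ψ.continuous.comp hΩ.continuous_shift)
      exact hc.continuousAt (x := ((⟨T, hT⟩ : Ω), u)) (nhds_le_uniformity _ hV')
    rw [nhds_subtype_eq_comap, eventually_comap] at hev
    filter_upwards [hev] with S hS _ hSΩ
    exact hS ⟨S, hSΩ⟩ rfl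
  obtain ⟨K, hK, κ, hκ, hκU⟩ := exists_colouring (Ξ := anchored Ω)
    (hcpt.of_isClosed_subset (isClosed_anchored hΩ hfin) fun T hT => hT.1)
    (fun T hT => isTotallyDisconnected_inter_anchored hX ψ (fun S => by
      obtain ⟨H, -, hH⟩ := hψ S
      exact ⟨H.symm, H.symm.continuous, fun w => congrArg Subtype.val (hsymm S H hH w)⟩) hT.1)
    U (fun T hT => mem_nhdsWithin_of_mem_nhds (hUnhds T hT.1))
  refine ⟨K, hK, κ, hκ, fun T T' hTT' => ?_⟩
  have hclose : ∀ v, (ψ (hΩ.shift T v), ψ (hΩ.shift T' v)) ∈ V := by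
    intro v
    obtain ⟨t, ht, hvt⟩ := T.1.exists_mem_supp v
    obtain ⟨t', ht', hsupp, hcol⟩ := hTT' t ht
    have hm : T'.1.translate (anchor t.supp) ∈ anchored Ω :=
      hsupp ▸ mem_anchored_translate hΩ T'.2 ht'
    obtain ⟨S, hS, h1, h2⟩ := hκU _ (mem_anchored_translate hΩ T.2 ht) _ hm hcol
    have hu : v - anchor t.supp ∈ closedBall (0 : E d) M := by
      rw [mem_closedBall_zero_iff]
      exact hM t (T.1.isTile ht) v hvt _ (anchor_mem (T.1.isTile ht).nonempty)
    have h3 := h1 hS.1 (hΩ.translate_mem _ T.2 _) _ hu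
    have h4 := h2 hS.1 (hΩ.translate_mem _ T'.2 _) _ hu
    have key : ∀ R : Ω, hΩ.shift ⟨R.1.translate (anchor t.supp), hΩ.translate_mem _ R.2 _⟩
        (v - anchor t.supp) = hΩ.shift R v := fun R => Subtype.ext (by
      change (R.1.translate _).translate _ = R.1.translate v
      rw [Tiling.translate_add, add_sub_cancel])
    rw [key] at h3 h4
    exact hV'V ⟨_, SetRel.symm V' h3, h4⟩
  obtain ⟨H, hH0, hH⟩ := hψ T
  obtain ⟨H', hH'0, hH'⟩ := hψ T'
  obtain ⟨z, hz, hTz⟩ := hVr (ψ T) (ψ T') ⟨H.symm.trans H', by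
    rw [Homeomorph.trans_apply, H.symm_apply_eq.2 hH0.symm, hH'0], fun w => by
    have h := hclose (H.symm w)
    rwa [hH, hH', H.apply_symm_apply] at h⟩
  have hT : T = hΩ.shift T' (H'.symm z) := by
    rw [← hsymm T' H' hH', ← hTz, ψ.symm_apply_apply]
  have hlt : ‖H'.symm z‖ < σ / 2 := by
    by_contra hge
    have hcont : Continuous fun s : ℝ => ‖H'.symm (s • z)‖ :=
      (H'.symm.continuous.comp (continuous_id.smul continuous_const)).norm
    obtain ⟨s, ⟨hs0, hs1⟩, hs⟩ := intermediate_value_Icc zero_le_one hcont.continuousOn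
      (show σ / 2 ∈ Icc ‖H'.symm ((0 : ℝ) • z)‖ ‖H'.symm ((1 : ℝ) • z)‖ by
        rw [zero_smul, one_smul, H'.symm_apply_eq.2 hH'0.symm, norm_zero]
        exact ⟨by linarith, not_lt.1 hge⟩)
    refine hr (y := s • z) ?_ (ψ T', H'.symm (s • z)) ⟨trivial, mem_sphere_zero_iff_norm.2 hs⟩ ?_
    · rw [dist_zero_right, norm_smul, Real.norm_of_nonneg hs0]
      exact (mul_le_of_le_one_left (norm_nonneg _) hs1).trans_lt hz
    · rw [ψ.symm_apply_apply]
      exact hsymm T' H' hH' _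
  have h0 : H'.symm z = 0 := hσΩ T' T'.2 _ (by linarith) (by
    intro t ht
    have hTv : T'.1.translate (H'.symm z) = T := (congrArg Subtype.val hT).symm
    rw [hTv] at ht
    obtain ⟨t', ht', h, -⟩ := hTT' t ht
    exact ⟨t', ht', h⟩)
  rw [hT, h0]
  exact Subtype.ext Tiling.translate_zero

/-- A compact tiling space with finitely many two-tile shapes and a separating colouring is
homeomorphic to the space of its coded tilings, which has finite local complexity. -/
theorem exists_flc_of_separating_colouring [CompactSpace L] (hΩ : IsTilingSpace Ω)
    (hfin : (shapes Ω).Finite) (htwo : HasFinitelyManyTwoTileShapes Ω) {K : Type} [Finite K]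
    {κ : Tiling P → K} (hκ : ∀ T ∈ anchored Ω, ∀ᶠ T' in 𝓝 T, T' ∈ anchored Ω → κ T' = κ T)
    (hsep : ∀ T T' : Ω, (∀ t ∈ T.1.tiles, ∃ t' ∈ T'.1.tiles, t'.supp = t.supp ∧
        κ (T.1.translate (anchor t.supp)) = κ (T'.1.translate (anchor t.supp))) → T = T') :
    ∃ (L'' : Type) (_ : MetricSpace L'') (_ : CompactSpace L'') (P'' : PrototileSet d L'')
      (Ω'' : Set (Tiling P'')), IsTilingSpace Ω'' ∧ HasFLC Ω'' ∧ Nonempty (Ω ≃ₜ Ω'') := by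
  have : CompactSpace Ω := isCompact_iff_compactSpace.1 (hΩ.isCompact hfin)
  have : Finite (CodeLabel Ω K) := CodeLabel.finite hfin K
  -- any metric on the finite set of labels will do
  let : MetricSpace (CodeLabel Ω K) := MetricSpace.induced
    (fun l => ((Finite.equivFin (CodeLabel Ω K) l : ℕ) : ℝ))
    (Nat.cast_injective.comp (Fin.val_injective.comp (Equiv.injective _))) inferInstance
  have hcont := continuous_code hΩ hfin hκ
  have hinj : Function.Injective (code (Ω := Ω) κ) := by
    intro T T' h
    refine hsep T T' fun t ht => ?_
    obtain ⟨c, hc, hct⟩ := exists_mem_codeTiles κ T.2 ht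
    have hc' : c ∈ codeTiles κ T'.1 := by
      have hc'' : c ∈ (code κ T).tiles := hc
      rw [h] at hc''
      exact hc''
    obtain ⟨t', ht', h'⟩ := hc'.1
    refine ⟨t', ht', h'.trans hct, ?_⟩
    rw [← hct, ← hc.2.2, hc'.2.2]
  exact ⟨CodeLabel Ω K, inferInstance, inferInstance, codePrototiles Ω K, range (code κ),
    isTilingSpace_range_code hΩ (isCompact_range hcont).isClosed,
    (hasFinitelyManyTwoTileShapes_range_code htwo κ).hasFLC,
    ⟨Continuous.homeoOfEquivCompactToT2 (f := Equiv.ofInjective _ hinj)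
      (Continuous.subtype_mk hcont _)⟩⟩

end

/-! ### Strong expansivity of tiling spaces -/

section

variable {d : ℕ} {L : Type*} [MetricSpace L] {P : PrototileSet d L}

/-- On a compact strongly expansive tiling space, shadowing at a sufficiently small scale gives
arbitrarily small displacements. -/
theorem IsTilingSpace.exists_entourage_of_isStronglyExpansive {Ω : Set (Tiling P)} [CompactSpace Ω]
    (hΩ : IsTilingSpace Ω) (hexp : IsStronglyExpansive Ω) :
    letI := hΩ.addAction
    ∀ r > 0, ∃ V ∈ 𝓤 Ω, ∀ x y : Ω, Shadows (d := d) V x y → ∃ v : E d, ‖v‖ < r ∧ x = v +ᵥ y := by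
  let := hΩ.addAction
  have := hΩ.continuousVAdd
  intro r hr
  obtain ⟨ε, hε, hexp⟩ := hexp
  refine exists_entourage_of_stronglyExpansive hε
    (D := {p : Ω × Ω | tilingDist (p.1 : Tiling P) p.2 < ε}) ?_ ?_ hr
  · intro z₀ hz₀ x
    have hc : Continuous fun p : (Ω × Ω) × E d =>
        (((p.1.1 : Tiling P), (p.1.2 : Tiling P)), p.2) := by fun_prop
    exact (hc.tendsto ((x, x), z₀)).eventually
      (eventually_tilingDist_translate_lt (x : Tiling P) hz₀)
  · rintro x y ⟨h, h0, hD⟩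
    obtain ⟨v, hv, hxy⟩ := hexp x x.2 y y.2 ⟨h, h0, hD⟩
    exact ⟨v, hv, Subtype.ext hxy⟩

end

end LabelledTiling

theorem mainTheorem5 {d : ℕ} (hd : 1 ≤ d)
    {L : Type*} [MetricSpace L] [CompactSpace L] (P : LabelledTiling.PrototileSet d L)
    (Ω : Set (LabelledTiling.Tiling P)) (hΩ : LabelledTiling.IsTilingSpace Ω)
    (hdisc : IsTotallyDisconnected (LabelledTiling.transversal Ω))
    (hexp : LabelledTiling.IsStronglyExpansive Ω)
    {L' : Type*} [MetricSpace L'] [CompactSpace L'] (P' : LabelledTiling.PrototileSet d L')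
    (Ω' : Set (LabelledTiling.Tiling P')) (hΩ' : LabelledTiling.IsTilingSpace Ω')
    (hfin : LabelledTiling.HasFinitelyManyTwoTileShapes Ω')
    (hhom : Nonempty (Ω ≃ₜ Ω')) :
    ∃ (L'' : Type) (_ : MetricSpace L'') (_ : CompactSpace L'')
      (P'' : LabelledTiling.PrototileSet d L'') (Ω'' : Set (LabelledTiling.Tiling P'')),
      LabelledTiling.IsTilingSpace Ω'' ∧ LabelledTiling.HasFLC Ω'' ∧ Nonempty (Ω ≃ₜ Ω'') := by
  let := hΩ.addAction
  let := hΩ'.addAction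
  have := hΩ.continuousVAdd
  have := hΩ'.continuousVAdd
  obtain ⟨φ⟩ := hhom
  have hshapes := hfin.finite_shapes hd
  have : CompactSpace Ω' := isCompact_iff_compactSpace.1 (hΩ'.isCompact hshapes)
  have : CompactSpace Ω := φ.symm.compactSpace
  obtain ⟨K, _, κ, hκ, hsep⟩ := LabelledTiling.exists_separating_colouring
    (hΩ.hasLocalCocycles hdisc) (hΩ.exists_entourage_of_isStronglyExpansive hexp) hΩ' hshapes φ.symm
    fun T => LabelledTiling.exists_homeomorph_displacement hΩ.hasDiscretePeriods
      (hΩ.hasLocalCocycles hdisc) hΩ'.hasDiscretePeriods φ.symm T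
  obtain ⟨L'', i₁, i₂, P'', Ω'', h₁, h₂, ⟨χ⟩⟩ :=
    LabelledTiling.exists_flc_of_separating_colouring hΩ' hshapes hfin hκ hsep
  exact ⟨L'', i₁, i₂, P'', Ω'', h₁, h₂, ⟨φ.trans χ⟩⟩
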